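/- Let $R$ be a principal ideal domain in which $2$ is invertible. All objects are $\mathbb Z$-graded and of finite type (finitely generated over $R$ in each degree), and the usual sign rule is in force. A \emph{differential Hopf algebra} $(A,d)$ is an augmented associative unital graded $R$-algebra with a coassociative, counital diagonal $\Delta:A\to A\otimes A$, the counit being the augmentation, such that $\Delta$ and the augmentation are morphisms of graded algebras, together with a differential $d$ (of degree $+1$, $d^2=0$) that is a derivation and a coderivation. A \emph{differential Lie algebra} $(L,\partial)$ is a non-negatively graded $R$-module $L=L_{\ge 0}$ with a bilinear bracket of degree $0$ satisfying graded anti-symmetry, the graded Jacobi identity and $[x,[x,x]]=0$ for $x$ of odd degree, and with a differential $\partial$ of degree $-1$, $\partial^2=0$, such that $\partial[x,y]=[\partial x,y]+(-1)^{\deg x}[x,\partial y]$. Its universal enveloping algebra $U(L,\partial)$ is a differential Hopf algebra with differential of degree $-1$: the elements of $L$ are primitive and have augmentation zero, and the differential is the derivation extending $\partial$. The graded dual of $A$, with $(A^\sharp)_n=\operatorname{Hom}_R(A^n,R)$ and the transposed structure maps, is denoted $(A,d)^\sharp$. A \emph{$\Gamma$-algebra} is a connected ($A=A^{\ge 0}$,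 $A^0=R$) graded-commutative algebra with maps $\gamma^k:A^{2n}\to A^{2nk}$ ($k\ge 0$, $n\ge 1$) such that, for homogeneous elements: $\gamma^0(a)=1$; $\gamma^1(a)=a$; $\gamma^k(a+b)=\sum_{i+j=k}\gamma^i(a)\gamma^j(b)$ for $\deg a=\deg b$; $\gamma^j(a)\gamma^k(a)=\binom{j+k}{j}\gamma^{j+k}(a)$; $\gamma^k(ab)=a^k\gamma^k(b)$ if $\deg a\ge 0$ and $\deg b>0$ are even; $\gamma^k(ab)=0$ if $k\ge 2$ and $\deg a,\deg b$ are odd; and $\gamma^k(\gamma^j(a))=\frac{(jk)!}{k!\,(j!)^k}\gamma^{jk}(a)$ for $j\ge 1$. A \emph{$\Gamma$-morphism} is an algebra morphism commuting with all $\gamma^k$. The tensor product $A\otimes A$ is given the divided powers for which $a\mapsto a\otimes 1$ and $a\mapsto 1\otimes a$ are $\Gamma$-morphisms. A \emph{differential $\Gamma$-Hopf algebra} is a differential Hopf algebra $(A,d)$ such that $A$ admits the structure of a $\Gamma$-algebra for which $\Delta$ is a $\Gamma$-morphism and $d\,\gamma^k(a)=d(a)\,\gamma^{k-1}(a)$ for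 all $k\ge 1$ and all $a$ of positive even degree. \textbf{Theorem.} Let $(A,d)$ be an $R$-free, graded-commutative differential Hopf algebra of finite type. Then $(A,d)^\sharp\cong U(L,\partial)$, as differential Hopf algebras, for some differential Lie algebra $(L,\partial)$ if and only if $(A,d)$ is a differential $\Gamma$-Hopf algebra. -/

import Mathlib

open scoped TensorProduct DirectSum

/-! ### Graded modules and sign conventions -/

section Signs

variable {R : Type*} [CommRing R] {M : Type*} [AddCommGroup M] [Module R M]

/-- The sign involution `a ↦ (-1)^|a| a` of a `ℤ`-graded module. -/
noncomputable def signInvolution (ℳ : ℤ → Submodule R M) [DirectSum.Decomposition ℳ] :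
    M →ₗ[R] M :=
  DirectSum.toModule R ℤ M (fun n => n.negOnePow • (ℳ n).subtype) ∘ₗ
    (DirectSum.decomposeLinearEquiv ℳ).toLinearMap

theorem signInvolution_apply (ℳ : ℤ → Submodule R M) [DirectSum.Decomposition ℳ]
    {n : ℤ} {a : M} (ha : a ∈ ℳ n) : signInvolution ℳ a = n.negOnePow • a := by
  lift a to ℳ n using ha
  simp only [signInvolution, LinearMap.comp_apply, LinearEquiv.coe_coe,
    DirectSum.decomposeLinearEquiv_apply, DirectSum.decompose_coe]
  rw [← DirectSum.lof_eq_of R, DirectSum.toModule_lof]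
  rfl

end Signs

section GradedAlgebras

variable {R : Type*} [CommRing R] {A : Type*} [Ring A] [Algebra R A]

/-- The grading of `A ⊗ A` by total degree. -/
def tensorPiece (𝒜 : ℤ → Submodule R A) (n : ℤ) : Submodule R (A ⊗[R] A) :=
  Submodule.span R {t | ∃ i j : ℤ, i + j = n ∧ ∃ a ∈ 𝒜 i, ∃ b ∈ 𝒜 j, t = a ⊗ₜ[R] b}

/-- The grading by total degree, on the graded tensor product algebra `A ⊗ A`, whose product is
`(a ⊗ b)(a' ⊗ b') = (-1)^{|b||a'|} aa' ⊗ bb'`. -/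
noncomputable def gradedTensorPiece (𝒜 : ℤ → Submodule R A) [GradedAlgebra 𝒜] (n : ℤ) :
    Submodule R (𝒜 ᵍ⊗[R] 𝒜) :=
  (tensorPiece 𝒜 n).map (GradedTensorProduct.of R 𝒜 𝒜).toLinearMap

/-- The map `a ⊗ b ↦ (-1)^{|a||b|} a ⊗ b`, that is, the graded interchange `a ⊗ b ↦ ± b ⊗ a`
followed by the ungraded one. -/
noncomputable def koszulSign (𝒜 : ℤ → Submodule R A) [GradedAlgebra 𝒜] :
    A ⊗[R] A →ₗ[R] A ⊗[R] A :=
  (TensorProduct.comm R A A).toLinearMap ∘ₗ (GradedTensorProduct.of R 𝒜 𝒜).symm.toLinearMap ∘ₗ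
    (GradedTensorProduct.comm 𝒜 𝒜).toLinearMap ∘ₗ (GradedTensorProduct.of R 𝒜 𝒜).toLinearMap

theorem koszulSign_tmul (𝒜 : ℤ → Submodule R A) [GradedAlgebra 𝒜] {i j : ℤ} {a b : A}
    (ha : a ∈ 𝒜 i) (hb : b ∈ 𝒜 j) :
    koszulSign 𝒜 (a ⊗ₜ[R] b) = (i * j).negOnePow • (a ⊗ₜ[R] b) := by
  have h := congrArg (fun t => TensorProduct.comm R A A ((GradedTensorProduct.of R 𝒜 𝒜).symm t))
    (GradedTensorProduct.comm_coe_tmul_coe (R := R) 𝒜 𝒜 ⟨a, ha⟩ ⟨b, hb⟩)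
  simp only [Units.smul_def, map_zsmul, GradedTensorProduct.of_symm_of,
    TensorProduct.comm_tmul, mul_comm j i] at h
  exact h

/-! ### Differential Hopf algebras -/

/-- Graded commutativity: `ab = (-1)^{|a||b|} ba`. -/
def IsGradedCommutative (𝒜 : ℤ → Submodule R A) : Prop :=
  ∀ ⦃i j : ℤ⦄ ⦃a b : A⦄, a ∈ 𝒜 i → b ∈ 𝒜 j → a * b = (i * j).negOnePow • (b * a)

/-- `(A, d)` is a differential Hopf algebra with differential of degree `+1`: an augmented graded
algebra and a (coassociative, counital) graded coalgebra, such that the diagonal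
`A → A ⊗ A` and the augmentation are morphisms of graded algebras, with a differential that is both
a derivation and a coderivation.  Associativity, unit, coassociativity and counit laws are those of
the classes `GradedAlgebra` and `Coalgebra`. -/
structure IsDGHopfAlgebra [Coalgebra R A] (𝒜 : ℤ → Submodule R A) [GradedAlgebra 𝒜]
    (d : A →ₗ[R] A) : Prop where
  counit_of_mem : ∀ ⦃n : ℤ⦄ ⦃a : A⦄, n ≠ 0 → a ∈ 𝒜 n → Coalgebra.counit (R := R) a = 0
  counit_one : Coalgebra.counit (R := R) (1 : A) = 1
  counit_mul : ∀ a b : A, Coalgebra.counit (R := R) (a * b) =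
    Coalgebra.counit (R := R) a * Coalgebra.counit (R := R) b
  comul_mem : ∀ ⦃n : ℤ⦄ ⦃a : A⦄, a ∈ 𝒜 n → Coalgebra.comul (R := R) a ∈ tensorPiece 𝒜 n
  comul_one : GradedTensorProduct.of R 𝒜 𝒜 (Coalgebra.comul (R := R) (1 : A)) = 1
  comul_mul : ∀ a b : A, GradedTensorProduct.of R 𝒜 𝒜 (Coalgebra.comul (R := R) (a * b)) =
    GradedTensorProduct.of R 𝒜 𝒜 (Coalgebra.comul (R := R) a) *
      GradedTensorProduct.of R 𝒜 𝒜 (Coalgebra.comul (R := R) b)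
  d_mem : ∀ ⦃n : ℤ⦄ ⦃a : A⦄, a ∈ 𝒜 n → d a ∈ 𝒜 (n + 1)
  d_d : ∀ a : A, d (d a) = 0
  d_mul : ∀ ⦃n : ℤ⦄ ⦃a : A⦄, a ∈ 𝒜 n → ∀ b : A,
    d (a * b) = d a * b + n.negOnePow • (a * d b)
  counit_d : ∀ a : A, Coalgebra.counit (R := R) (d a) = 0
  /-- `Δ d = (d ⊗ 1 + 1 ⊗ d) Δ`, where `(1 ⊗ d)(a ⊗ b) = (-1)^|a| a ⊗ db`. -/
  comul_d : ∀ a : A, Coalgebra.comul (R := R) (d a) =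
    TensorProduct.map d LinearMap.id (Coalgebra.comul (R := R) a) +
      TensorProduct.map (signInvolution 𝒜) d (Coalgebra.comul (R := R) a)

/-! ### Divided powers -/

/-- `γ` is a system of divided powers `γ^k : B^{2n} → B^{2nk}`, for `k ≥ 0` and `n ≥ 1`, on the
graded algebra `B`.  (The values of `γ` elsewhere are irrelevant.) -/
structure IsDividedPowerSystem {B : Type*} [Ring B] [Module R B] (ℬ : ℤ → Submodule R B)
    (γ : ℕ → B → B) : Prop where
  mem : ∀ ⦃n : ℤ⦄ ⦃a : B⦄ (k : ℕ), 0 < n → Even n → a ∈ ℬ n → γ k a ∈ ℬ (k * n)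
  zero : ∀ ⦃n : ℤ⦄ ⦃a : B⦄, 0 < n → Even n → a ∈ ℬ n → γ 0 a = 1
  one : ∀ ⦃n : ℤ⦄ ⦃a : B⦄, 0 < n → Even n → a ∈ ℬ n → γ 1 a = a
  add : ∀ ⦃n : ℤ⦄ ⦃a b : B⦄ (k : ℕ), 0 < n → Even n → a ∈ ℬ n → b ∈ ℬ n →
    γ k (a + b) = ∑ p ∈ Finset.HasAntidiagonal.antidiagonal k, γ p.1 a * γ p.2 b
  mul : ∀ ⦃n : ℤ⦄ ⦃a : B⦄ (j k : ℕ), 0 < n → Even n → a ∈ ℬ n →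
    γ j a * γ k a = (j + k).choose j • γ (j + k) a
  /-- `γ^k(ab) = a^k γ^k(b)` if `|a|` and `|b|` are even (this includes `|a| = 0`). -/
  even_mul : ∀ ⦃m n : ℤ⦄ ⦃a b : B⦄ (k : ℕ), 0 ≤ m → Even m → 0 < n → Even n →
    a ∈ ℬ m → b ∈ ℬ n → γ k (a * b) = a ^ k * γ k b
  /-- `γ^k(ab) = 0` for `k ≥ 2` if `|a|` and `|b|` are odd. -/
  odd_mul : ∀ ⦃m n : ℤ⦄ ⦃a b : B⦄ (k : ℕ), 2 ≤ k → 0 < m → Odd m → 0 < n → Odd n →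
    a ∈ ℬ m → b ∈ ℬ n → γ k (a * b) = 0
  /-- `γ^k(γ^j(a)) = (jk)! / (k! (j!)^k) γ^{jk}(a)` for `j ≥ 1`. -/
  comp : ∀ ⦃n : ℤ⦄ ⦃a : B⦄ (j k : ℕ), 1 ≤ j → 0 < n → Even n → a ∈ ℬ n →
    γ k (γ j a) = Nat.uniformBell k j • γ (k * j) a

/-- `f` commutes with the divided powers of homogeneous elements of positive even degree. -/
def PreservesDividedPowers {B C : Type*} [Ring B] [Module R B] (ℬ : ℤ → Submodule R B)
    (γ : ℕ → B → B) (δ : ℕ → C → C) (f : B → C) : Prop :=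
  ∀ ⦃n : ℤ⦄ ⦃a : B⦄ (k : ℕ), 0 < n → Even n → a ∈ ℬ n → f (γ k a) = δ k (f a)

/-- `A` is non-negatively graded with `A^0 = R`. -/
def IsConnectedGraded (𝒜 : ℤ → Submodule R A) : Prop :=
  (∀ n : ℤ, n < 0 → 𝒜 n = ⊥) ∧ ∀ a ∈ 𝒜 0, ∃! r : R, algebraMap R A r = a

/-- The divided powers `γ` on `A` make the diagonal `Δ : A → A ⊗ A` a `Γ`-morphism.  Here `A ⊗ A`
has the divided powers of the tensor product of `Γ`-algebras, namely those `δ` for which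
`a ↦ a ⊗ 1` and `a ↦ 1 ⊗ a` are `Γ`-morphisms (the axioms then determine `δ`). -/
def DiagonalPreservesDividedPowers [Coalgebra R A] (𝒜 : ℤ → Submodule R A) [GradedAlgebra 𝒜]
    (γ : ℕ → A → A) : Prop :=
  ∃ δ : ℕ → (𝒜 ᵍ⊗[R] 𝒜) → (𝒜 ᵍ⊗[R] 𝒜),
    IsDividedPowerSystem (gradedTensorPiece 𝒜) δ ∧
    PreservesDividedPowers 𝒜 γ δ (GradedTensorProduct.includeLeft 𝒜 𝒜) ∧
    PreservesDividedPowers 𝒜 γ δ (GradedTensorProduct.includeRight 𝒜 𝒜) ∧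
    PreservesDividedPowers 𝒜 γ δ
      (fun a => GradedTensorProduct.of R 𝒜 𝒜 (Coalgebra.comul (R := R) a))

/-- `(A, d)` is a differential `Γ`-Hopf algebra: a differential Hopf algebra whose underlying
algebra is a `Γ`-algebra (connected, commutative, with divided powers) such that the diagonal is a
`Γ`-morphism and `d` is a `Γ`-derivation. -/
def IsDGGammaHopfAlgebra [Coalgebra R A] (𝒜 : ℤ → Submodule R A) [GradedAlgebra 𝒜]
    (d : A →ₗ[R] A) : Prop :=
  IsDGHopfAlgebra 𝒜 d ∧ IsGradedCommutative 𝒜 ∧ IsConnectedGraded 𝒜 ∧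
    ∃ γ : ℕ → A → A, IsDividedPowerSystem 𝒜 γ ∧ DiagonalPreservesDividedPowers 𝒜 γ ∧
      ∀ ⦃n : ℤ⦄ ⦃a : A⦄ (k : ℕ), 0 < n → Even n → a ∈ 𝒜 n → d (γ (k + 1) a) = d a * γ k a

/-! ### The dual of a differential Hopf algebra -/

/-- The degree `n` part of the graded dual: the functionals that vanish on `A^m` for `m ≠ n`. -/
def dualPiece (𝒜 : ℤ → Submodule R A) (n : ℤ) : Submodule R (Module.Dual R A) where
  carrier := {f | ∀ m : ℤ, m ≠ n → ∀ a ∈ 𝒜 m, f a = 0}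
  add_mem' hf hg m hm a ha := by simp [hf m hm a ha, hg m hm a ha]
  zero_mem' _ _ _ _ := rfl
  smul_mem' r f hf m hm a ha := by simp [hf m hm a ha]

/-- The graded dual `A^♯ = ⨁_n Hom(A^n, R)`. -/
def gradedDual (𝒜 : ℤ → Submodule R A) : Submodule R (Module.Dual R A) := ⨆ n, dualPiece 𝒜 n

/-- The canonical map `A^♯ ⊗ A^♯ → (A ⊗ A)^♯`, `⟨f ⊗ g, a ⊗ b⟩ = (-1)^{|g||a|} ⟨f, a⟩ ⟨g, b⟩`.
(The pairing vanishes unless `|g| = |b|`, so the sign may be computed from `a ⊗ b`.) -/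
noncomputable def dualTensor (𝒜 : ℤ → Submodule R A) [GradedAlgebra 𝒜]
    (t : gradedDual 𝒜 ⊗[R] gradedDual 𝒜) : Module.Dual R (A ⊗[R] A) :=
  TensorProduct.dualDistrib R A A
    (TensorProduct.map (gradedDual 𝒜).subtype (gradedDual 𝒜).subtype t) ∘ₗ koszulSign 𝒜

/-- The product of `A^♯`, transposed to the diagonal: `⟨f g, a⟩ = ⟨f ⊗ g, Δ a⟩`. -/
noncomputable def dualMul [Coalgebra R A] (𝒜 : ℤ → Submodule R A) [GradedAlgebra 𝒜]
    (f g : gradedDual 𝒜) : Module.Dual R A :=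
  dualTensor 𝒜 (f ⊗ₜ[R] g) ∘ₗ Coalgebra.comul

/-- The differential of `A^♯`, of degree `-1`: `⟨∂f, a⟩ = -(-1)^|f| ⟨f, da⟩ = (-1)^|a| ⟨f, da⟩`. -/
noncomputable def dualDifferential (𝒜 : ℤ → Submodule R A) [GradedAlgebra 𝒜] (d : A →ₗ[R] A)
    (f : gradedDual 𝒜) : Module.Dual R A :=
  (f : Module.Dual R A) ∘ₗ d ∘ₗ signInvolution 𝒜

/-- An isomorphism of differential Hopf algebras from `H`, with grading `ℋ`, diagonal `Δ`,
augmentation `ε` and differential `∂` of degree `-1`, onto the dual `(A, d)^♯`, where the structure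
maps of `(A, d)^♯` are the transposes of those of `(A, d)`. -/
structure IsoToDual [Coalgebra R A] (𝒜 : ℤ → Submodule R A) [GradedAlgebra 𝒜] (d : A →ₗ[R] A)
    {H : Type*} [Ring H] [Algebra R H] (ℋ : ℤ → Submodule R H)
    (Δ : H →ₗ[R] H ⊗[R] H) (ε : H →ₗ[R] R) (del : H →ₗ[R] H) where
  equiv : H ≃ₗ[R] gradedDual 𝒜
  mem_iff : ∀ (n : ℤ) (u : H), u ∈ ℋ n ↔ (equiv u : Module.Dual R A) ∈ dualPiece 𝒜 n
  /-- the unit of `A^♯` is the augmentation of `A` -/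
  map_one : (equiv 1 : Module.Dual R A) = Coalgebra.counit
  map_mul : ∀ u v : H, (equiv (u * v) : Module.Dual R A) = dualMul 𝒜 (equiv u) (equiv v)
  /-- the augmentation of `A^♯` is the evaluation at `1` -/
  map_counit : ∀ u : H, ε u = (equiv u : Module.Dual R A) 1
  /-- the diagonal of `A^♯` is transposed to the product: `⟨Δ f, a ⊗ b⟩ = ⟨f, ab⟩` -/
  map_comul : ∀ (u : H) (a b : A),
    dualTensor 𝒜 (TensorProduct.map equiv.toLinearMap equiv.toLinearMap (Δ u)) (a ⊗ₜ[R] b) =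
      (equiv u : Module.Dual R A) (a * b)
  map_d : ∀ u : H, (equiv (del u) : Module.Dual R A) = dualDifferential 𝒜 d (equiv u)

end GradedAlgebras

/-! ### Differential Lie algebras -/

universe u v

/-- A differential (graded) Lie algebra over `R`: non-negatively graded, of finite type, with
differential of degree `-1`. -/
structure DGLieAlgebra (R : Type u) [CommRing R] where
  carrier : Type v
  [addCommGroup : AddCommGroup carrier]
  [module : Module R carrier]
  deg : ℤ → Submodule R carrier
  [decomposition : DirectSum.Decomposition deg]
  deg_neg : ∀ n : ℤ, n < 0 → deg n = ⊥
  finite_deg : ∀ n : ℤ, Module.Finite R (deg n)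
  bracket : carrier →ₗ[R] carrier →ₗ[R] carrier
  bracket_mem : ∀ ⦃i j : ℤ⦄ ⦃x y : carrier⦄, x ∈ deg i → y ∈ deg j → bracket x y ∈ deg (i + j)
  antisymm : ∀ ⦃i j : ℤ⦄ ⦃x y : carrier⦄, x ∈ deg i → y ∈ deg j →
    bracket x y = -((i * j).negOnePow • bracket y x)
  jacobi : ∀ ⦃i j : ℤ⦄ ⦃x y : carrier⦄, x ∈ deg i → y ∈ deg j → ∀ z : carrier,
    bracket x (bracket y z) =
      bracket (bracket x y) z + (i * j).negOnePow • bracket y (bracket x z)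
  odd_cube : ∀ ⦃i : ℤ⦄ ⦃x : carrier⦄, Odd i → x ∈ deg i → bracket x (bracket x x) = 0
  del : carrier →ₗ[R] carrier
  del_mem : ∀ ⦃i : ℤ⦄ ⦃x : carrier⦄, x ∈ deg i → del x ∈ deg (i - 1)
  del_del : ∀ x : carrier, del (del x) = 0
  leibniz : ∀ ⦃i : ℤ⦄ ⦃x : carrier⦄, x ∈ deg i → ∀ y : carrier,
    del (bracket x y) = bracket (del x) y + i.negOnePow • bracket x (del y)

namespace DGLieAlgebra

attribute [instance] addCommGroup module decomposition

variable {R : Type u} [CommRing R] (L : DGLieAlgebra.{u, v} R)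

/-- The defining relations `xy - (-1)^{|x||y|} yx = [x, y]` of the universal enveloping algebra. -/
inductive EnvRel : TensorAlgebra R L.carrier → TensorAlgebra R L.carrier → Prop
  | mk {i j : ℤ} {x y : L.carrier} (hx : x ∈ L.deg i) (hy : y ∈ L.deg j) :
      EnvRel (TensorAlgebra.ι R x * TensorAlgebra.ι R y)
        (TensorAlgebra.ι R (L.bracket x y) +
          (i * j).negOnePow • (TensorAlgebra.ι R y * TensorAlgebra.ι R x))

/-- The universal enveloping algebra `UL`. -/
def Env : Type (max u v) := RingQuot L.EnvRel

noncomputable instance : Ring L.Env := inferInstanceAs (Ring (RingQuot L.EnvRel))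

noncomputable instance : Algebra R L.Env := inferInstanceAs (Algebra R (RingQuot L.EnvRel))

namespace Env

/-- The canonical map `L → UL`. -/
noncomputable def ι : L.carrier →ₗ[R] L.Env :=
  (RingQuot.mkAlgHom R L.EnvRel).toLinearMap ∘ₗ TensorAlgebra.ι R

theorem ι_mul_ι {i j : ℤ} {x y : L.carrier} (hx : x ∈ L.deg i) (hy : y ∈ L.deg j) :
    ι L x * ι L y = ι L (L.bracket x y) + (i * j).negOnePow • (ι L y * ι L x) := by
  have h := RingQuot.mkAlgHom_rel R (EnvRel.mk (L := L) hx hy)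
  rw [map_mul, map_add, Units.smul_def, map_zsmul, map_mul] at h
  exact h

variable {L} in
/-- A morphism of graded Lie algebras from `L` to an algebra extends to `UL`. -/
noncomputable def lift {B : Type*} [Semiring B] [Algebra R B] (f : L.carrier →ₗ[R] B)
    (hf : ∀ ⦃i j : ℤ⦄ ⦃x y : L.carrier⦄, x ∈ L.deg i → y ∈ L.deg j →
      f x * f y = f (L.bracket x y) + (((i * j).negOnePow : ℤ) : R) • (f y * f x)) : L.Env →ₐ[R] B :=
  RingQuot.liftAlgHom R ⟨TensorAlgebra.lift R f, by
    rintro _ _ ⟨hx, hy⟩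
    rw [map_mul, map_add, Units.smul_def, ← Int.cast_smul_eq_zsmul R, map_smul, map_mul]
    simpa using hf hx hy⟩

@[simp]
theorem lift_ι {B : Type*} [Semiring B] [Algebra R B] (f : L.carrier →ₗ[R] B)
    (hf : ∀ ⦃i j : ℤ⦄ ⦃x y : L.carrier⦄, x ∈ L.deg i → y ∈ L.deg j →
      f x * f y = f (L.bracket x y) + (((i * j).negOnePow : ℤ) : R) • (f y * f x)) (x : L.carrier) :
    lift f hf (ι L x) = f x := by
  simp only [lift, ι]
  erw [RingQuot.liftAlgHom_mkAlgHom_apply]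
  simp

theorem hom_ext {B : Type*} [Semiring B] [Algebra R B] {f g : L.Env →ₐ[R] B}
    (h : ∀ x, f (ι L x) = g (ι L x)) : f = g := by
  apply RingQuot.ringQuot_ext'
  apply TensorAlgebra.hom_ext
  ext x
  exact h x

/-- The grading of `UL` induced by that of `L`: the degree `n` part is spanned by the products
`x₁ ⋯ x_r` of homogeneous elements of `L` with `|x₁| + ⋯ + |x_r| = n`. -/
noncomputable def piece (n : ℤ) : Submodule R L.Env :=
  Submodule.span R {u | ∃ l : List (Σ i : ℤ, L.deg i),
    (l.map Sigma.fst).sum = n ∧ u = (l.map fun x => ι L (x.2 : L.carrier)).prod}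

theorem ι_mem {n : ℤ} {x : L.carrier} (hx : x ∈ L.deg n) : ι L x ∈ piece L n :=
  Submodule.subset_span ⟨[⟨n, x, hx⟩], by simp, by simp⟩

instance gradedMonoid : SetLike.GradedMonoid (piece L) where
  one_mem := Submodule.subset_span ⟨[], by simp, by simp⟩
  mul_mem i j u w hu hw := by
    have h : piece L i * piece L j ≤ piece L (i + j) := by
      rw [piece, piece, Submodule.span_mul_span, Submodule.span_le]
      rintro _ ⟨_, ⟨l, hl, rfl⟩, _, ⟨m, hm, rfl⟩, rfl⟩
      exact Submodule.subset_span ⟨l ++ m, by simp [hl, hm], by simp⟩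
    exact h (Submodule.mul_mem_mul hu hw)

/-- The map `x ↦ ∑ n, x_n` from `L` to the external direct sum of the pieces of `UL`. -/
noncomputable def gradedι : L.carrier →ₗ[R] ⨁ n, piece L n :=
  DirectSum.toModule R ℤ _ (fun n => DirectSum.lof R ℤ (fun n => piece L n) n ∘ₗ
    ((ι L ∘ₗ (L.deg n).subtype).codRestrict (piece L n) fun x => ι_mem L x.2)) ∘ₗ
    (DirectSum.decomposeLinearEquiv L.deg).toLinearMap

theorem gradedι_apply {n : ℤ} {x : L.carrier} (hx : x ∈ L.deg n) :
    gradedι L x = DirectSum.of (fun n => piece L n) n ⟨ι L x, ι_mem L hx⟩ := by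
  lift x to L.deg n using hx
  simp only [gradedι, LinearMap.comp_apply, LinearEquiv.coe_coe,
    DirectSum.decomposeLinearEquiv_apply, DirectSum.decompose_coe]
  rw [← DirectSum.lof_eq_of R, DirectSum.toModule_lof]
  rfl

theorem of_eq_of {m n : ℤ} (h : m = n) {u : L.Env} (hu : u ∈ piece L m) :
    DirectSum.of (fun n => piece L n) m ⟨u, hu⟩ =
      DirectSum.of (fun n => piece L n) n ⟨u, h ▸ hu⟩ := by
  subst h; rfl

theorem gradedι_mul ⦃i j : ℤ⦄ ⦃x y : L.carrier⦄ (hx : x ∈ L.deg i) (hy : y ∈ L.deg j) :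
    gradedι L x * gradedι L y =
      gradedι L (L.bracket x y) + (((i * j).negOnePow : ℤ) : R) • (gradedι L y * gradedι L x) := by
  have hyx : ι L y * ι L x ∈ piece L (j + i) :=
    SetLike.mul_mem_graded (ι_mem L hy) (ι_mem L hx)
  have e : DirectSum.of (fun n => piece L n) j ⟨ι L y, ι_mem L hy⟩ *
      DirectSum.of (fun n => piece L n) i ⟨ι L x, ι_mem L hx⟩ =
      DirectSum.of (fun n => piece L n) (i + j) ⟨ι L y * ι L x, add_comm j i ▸ hyx⟩ := by
    rw [DirectSum.of_mul_of, ← of_eq_of L (add_comm j i) hyx]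
    rfl
  rw [gradedι_apply L hx, gradedι_apply L hy, gradedι_apply L (L.bracket_mem hx hy), e,
    DirectSum.of_mul_of, ← DirectSum.lof_eq_of R, ← DirectSum.lof_eq_of R,
    ← DirectSum.lof_eq_of R, ← map_smul, ← map_add]
  congr 1
  refine Subtype.ext ((ι_mul_ι L hx hy).trans ?_)
  rw [Units.smul_def, ← Int.cast_smul_eq_zsmul R]
  rfl

theorem decompose_aux (n : ℤ) (u : piece L n) :
    lift (gradedι L) (gradedι_mul L) (u : L.Env) = DirectSum.of (fun n => piece L n) n u := by
  obtain ⟨u, hu⟩ := u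
  have hprod : ∀ l : List (Σ i : ℤ, L.deg i), ∃ h,
      lift (gradedι L) (gradedι_mul L) (l.map fun x => ι L (x.2 : L.carrier)).prod =
      DirectSum.of (fun n => piece L n) (l.map Sigma.fst).sum
        ⟨(l.map fun x => ι L (x.2 : L.carrier)).prod, h⟩ := by
    intro l
    induction l with
    | nil => exact ⟨SetLike.GradedOne.one_mem, by simp; rfl⟩
    | cons x l ih =>
      obtain ⟨h, ih⟩ := ih
      refine ⟨SetLike.mul_mem_graded (ι_mem L x.2.2) h, ?_⟩
      simp only [List.map_cons, List.prod_cons]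
      rw [map_mul, ih, lift_ι, gradedι_apply L x.2.2, DirectSum.of_mul_of]
      rfl
  induction hu using Submodule.span_induction with
  | mem u h =>
    obtain ⟨l, rfl, rfl⟩ := h
    exact (hprod l).2
  | zero =>
    rw [map_zero]
    exact (map_zero (DirectSum.of (fun n => piece L n) n)).symm
  | add u w hu hw ihu ihw =>
    simp only [map_add] at ihu ihw ⊢
    rw [ihu, ihw, ← map_add]
    rfl
  | smul r u hu ihu =>
    simp only [map_smul] at ihu ⊢
    rw [ihu, ← DirectSum.lof_eq_of R, ← map_smul]
    rfl

/-- The decomposition `UL → ⨁ n, (UL)_n`. -/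
noncomputable def decomposeAlgHom : L.Env →ₐ[R] ⨁ n, piece L n :=
  lift (gradedι L) (gradedι_mul L)

theorem decomposeAlgHom_ι (x : L.carrier) : decomposeAlgHom L (ι L x) = gradedι L x :=
  lift_ι L (gradedι L) (gradedι_mul L) x

noncomputable instance gradedAlgebra : GradedAlgebra (piece L) :=
  GradedAlgebra.ofAlgHom (piece L) (decomposeAlgHom L)
    (hom_ext L fun x => by
      induction x using DirectSum.Decomposition.inductionOn L.deg with
      | zero => simp
      | homogeneous x =>
        simp only [AlgHom.comp_apply, decomposeAlgHom_ι, AlgHom.id_apply]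
        rw [gradedι_apply L x.2, DirectSum.coeAlgHom_of]
      | add x y hx hy => simp only [map_add, hx, hy])
    (decompose_aux L)

/-- The linear map `x ↦ x ⊗ 1 + 1 ⊗ x`. -/
noncomputable def comulι : L.carrier →ₗ[R] (piece L ᵍ⊗[R] piece L) :=
  ((GradedTensorProduct.includeLeft (piece L) (piece L)).toLinearMap +
    (GradedTensorProduct.includeRight (piece L) (piece L)).toLinearMap) ∘ₗ ι L

theorem comulι_mul ⦃i j : ℤ⦄ ⦃x y : L.carrier⦄ (hx : x ∈ L.deg i) (hy : y ∈ L.deg j) :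
    comulι L x * comulι L y =
      comulι L (L.bracket x y) + (i * j).negOnePow • (comulι L y * comulι L x) := by
  have key : ∀ {i j : ℤ} {u w : L.Env}, u ∈ piece L i → w ∈ piece L j →
      GradedTensorProduct.includeRight (piece L) (piece L) u *
        GradedTensorProduct.includeLeft (piece L) (piece L) w = (i * j).negOnePow •
      (GradedTensorProduct.includeLeft (piece L) (piece L) w *
        GradedTensorProduct.includeRight (piece L) (piece L) u) := by
    intro i j u w hu hw
    have h := GradedTensorProduct.tmul_coe_mul_coe_tmul (R := R) (piece L) (piece L) 1 ⟨u, hu⟩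
      ⟨w, hw⟩ 1
    have h' := GradedTensorProduct.tmul_one_mul_one_tmul (R := R) (piece L) (piece L) w u
    simp only [GradedTensorProduct.includeLeft_apply, GradedTensorProduct.includeRight_apply]
    rw [h']
    rw [one_mul, mul_one] at h
    exact h
  simp only [comulι, LinearMap.comp_apply, LinearMap.add_apply, AlgHom.toLinearMap_apply]
  have hb := ι_mul_ι L hx hy
  have hb' : ι L (L.bracket x y) = ι L x * ι L y - (i * j).negOnePow • (ι L y * ι L x) := by
    rw [hb]; abel
  have sq : ((i * j).negOnePow : ℤ) * ((i * j).negOnePow : ℤ) = 1 := by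
    rw [← Units.val_mul, Int.units_mul_self, Units.val_one]
  have k1 := key (ι_mem L hx) (ι_mem L hy)
  have k2 := key (ι_mem L hy) (ι_mem L hx)
  rw [mul_comm j i] at k2
  rw [hb']
  simp only [map_sub, map_mul, Units.smul_def, map_zsmul, add_mul, mul_add, smul_add] at k1 k2 ⊢
  rw [k1, k2, smul_smul, sq, one_smul]
  abel

/-- The diagonal of `UL`: the morphism of algebras with `Δ x = x ⊗ 1 + 1 ⊗ x` for `x ∈ L`. -/
noncomputable def comulAlgHom : L.Env →ₐ[R] (piece L ᵍ⊗[R] piece L) :=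
  lift (comulι L) fun i j x y hx hy => by
    rw [comulι_mul L hx hy, Units.smul_def, Int.cast_smul_eq_zsmul R]

/-- The diagonal of `UL`, as a linear map to `UL ⊗ UL`. -/
noncomputable def comul : L.Env →ₗ[R] L.Env ⊗[R] L.Env :=
  (GradedTensorProduct.of R (piece L) (piece L)).symm.toLinearMap ∘ₗ (comulAlgHom L).toLinearMap

/-- The augmentation of `UL`: the morphism of algebras that vanishes on `L`. -/
noncomputable def counit : L.Env →ₐ[R] R := lift 0 (by intros; simp)

/-- The linear map `L → M₂(UL)` sending `x` to the matrix with rows `((-1)^|x| x, ∂x)` and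
`(0, x)`. -/
noncomputable def delι : L.carrier →ₗ[R] Matrix (Fin 2) (Fin 2) L.Env where
  toFun x := !![ι L (signInvolution L.deg x), ι L (L.del x); 0, ι L x]
  map_add' x y := by ext i j; fin_cases i <;> fin_cases j <;> simp
  map_smul' r x := by ext i j; fin_cases i <;> fin_cases j <;> simp

theorem delι_mul ⦃i j : ℤ⦄ ⦃x y : L.carrier⦄ (hx : x ∈ L.deg i) (hy : y ∈ L.deg j) :
    delι L x * delι L y =
      delι L (L.bracket x y) + (i * j).negOnePow • (delι L y * delι L x) := by
  have h := ι_mul_ι L hx hy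
  have h1 := ι_mul_ι L (L.del_mem hx) hy
  have h2 := ι_mul_ι L hx (L.del_mem hy)
  have e1 : ((i - 1) * j).negOnePow = (i * j).negOnePow * j.negOnePow := by
    rw [sub_mul, one_mul, Int.negOnePow_sub]
  have e2 : (i * (j - 1)).negOnePow = (i * j).negOnePow * i.negOnePow := by
    rw [mul_sub, mul_one, Int.negOnePow_sub]
  rw [e1] at h1
  rw [e2] at h2
  have e3 : (i + j).negOnePow = i.negOnePow * j.negOnePow := Int.negOnePow_add i j
  have s1 := signInvolution_apply _ hx
  have s2 := signInvolution_apply _ hy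
  have s3 := signInvolution_apply _ (L.bracket_mem hx hy)
  have l := L.leibniz hx y
  rw [e3] at s3
  ext a b
  fin_cases a <;> fin_cases b
  · obtain hi | hi := Int.units_eq_one_or i.negOnePow <;>
    obtain hj | hj := Int.units_eq_one_or j.negOnePow <;>
    simp [hi, hj, delι, Matrix.mul_apply, Fin.sum_univ_two, s1, s2, s3, h, Units.smul_def] <;>
    abel
  · obtain hi | hi := Int.units_eq_one_or i.negOnePow <;>
    obtain hj | hj := Int.units_eq_one_or j.negOnePow <;>
    obtain hij | hij := Int.units_eq_one_or (i * j).negOnePow <;>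
    simp [hi, hj, hij, delι, Matrix.mul_apply, Fin.sum_univ_two, s1, s2, l, h1, h2,
      Units.smul_def] <;>
    abel
  · simp [delι, Matrix.mul_apply, Fin.sum_univ_two]
  · simpa [delι, Matrix.mul_apply, Fin.sum_univ_two] using h

/-- The morphism of algebras `UL → M₂(UL)` that sends `u` to the matrix with rows
`((-1)^|u| u, ∂u)` and `(0, u)`. -/
noncomputable def delAlgHom : L.Env →ₐ[R] Matrix (Fin 2) (Fin 2) L.Env :=
  lift (delι L) fun i j x y hx hy => by
    rw [delι_mul L hx hy, Units.smul_def, Int.cast_smul_eq_zsmul R]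

/-- The differential of `UL`: the derivation that extends the differential of `L`. -/
noncomputable def del : L.Env →ₗ[R] L.Env :=
  Matrix.entryLinearMap R L.Env 0 1 ∘ₗ (delAlgHom L).toLinearMap

theorem del_ι (x : L.carrier) : del L (ι L x) = ι L (L.del x) := by
  simp [del, delAlgHom, delι]

theorem delAlgHom_lower (u : L.Env) : delAlgHom L u 1 0 = 0 ∧ delAlgHom L u 1 1 = u := by
  have hu : u ∈ Submodule.span R (Set.range fun l : List L.carrier => (l.map (ι L)).prod) := by
    have h : ∀ u : L.Env, u ∈ Submodule.span R
        {u | ∃ l : List (Σ i : ℤ, L.deg i), u = (l.map fun x => ι L (x.2 : L.carrier)).prod} := by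
      intro u
      induction u using DirectSum.Decomposition.inductionOn (piece L) with
      | zero => exact zero_mem _
      | homogeneous x =>
        refine Submodule.span_mono ?_ x.2
        rintro _ ⟨l, _, h⟩
        exact ⟨l, h⟩
      | add x y hx hy => exact add_mem hx hy
    refine Submodule.span_mono ?_ (h u)
    rintro _ ⟨l, rfl⟩
    exact ⟨l.map fun x => (x.2 : L.carrier), by simp [List.map_map, Function.comp_def]⟩
  induction hu using Submodule.span_induction with
  | mem u h =>
    obtain ⟨l, rfl⟩ := h
    induction l with
    | nil => simp
    | cons x l ih =>
      simp only [List.map_cons, List.prod_cons] at ih ⊢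
      have e : delAlgHom L (ι L x) = delι L x := lift_ι L _ _ x
      rw [map_mul, e]
      simp [Matrix.mul_apply, Fin.sum_univ_two, ih, delι]
  | zero => simp
  | add u w _ _ hu hw => simp [hu, hw]
  | smul r u _ hu => simp [hu]

theorem delAlgHom_upper {n : ℤ} {u : L.Env} (hu : u ∈ piece L n) :
    delAlgHom L u 0 0 = n.negOnePow • u := by
  have hprod : ∀ l : List (Σ i : ℤ, L.deg i),
      delAlgHom L (l.map fun x => ι L (x.2 : L.carrier)).prod 0 0 =
        (l.map Sigma.fst).sum.negOnePow • (l.map fun x => ι L (x.2 : L.carrier)).prod := by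
    intro l
    induction l with
    | nil => simp
    | cons x l ih =>
      have e : delAlgHom L (ι L x.2) = delι L x.2 := lift_ι L _ _ _
      have h0 := (delAlgHom_lower L (l.map fun x => ι L (x.2 : L.carrier)).prod).1
      simp only [List.map_cons, List.prod_cons, List.sum_cons]
      rw [map_mul, e, Int.negOnePow_add, Matrix.mul_apply, Fin.sum_univ_two, ih, h0]
      simp only [delι, LinearMap.coe_mk, AddHom.coe_mk, Matrix.cons_val_zero, Matrix.of_apply,
        Matrix.cons_val', mul_zero, add_zero, signInvolution_apply _ x.2.2, Units.smul_def,
        map_zsmul, mul_smul, smul_mul_assoc, mul_smul_comm]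
      rw [smul_comm]
  induction hu using Submodule.span_induction with
  | mem u h =>
    obtain ⟨l, rfl, rfl⟩ := h
    exact hprod l
  | zero => simp
  | add u w _ _ hu hw => simp [hu, hw]
  | smul r u _ hu =>
    rw [map_smul, Matrix.smul_apply, hu, Units.smul_def, Units.smul_def, smul_comm]

theorem del_mul {n : ℤ} {u : L.Env} (hu : u ∈ piece L n) (w : L.Env) :
    del L (u * w) = del L u * w + n.negOnePow • (u * del L w) := by
  have h1 := delAlgHom_upper L hu
  have h2 := delAlgHom_lower L w
  simp only [del, LinearMap.comp_apply, AlgHom.toLinearMap_apply, Matrix.entryLinearMap_apply,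
    map_mul, Matrix.mul_apply, Fin.sum_univ_two, h1, h2.2, Units.smul_def, smul_mul_assoc]
  exact add_comm _ _

end Env
end DGLieAlgebra

/-! Both directions rest on contractions. A functional `φ` acts on `A` by `a ↦ ∑ ± φ(a'') a'`, where
`Δ a = ∑ a' ⊗ a''`. By coassociativity `contract` turns the product of the dual into composition of
operators. It is injective because `ε ∘ contract φ = φ`. If `φ` is primitive, its contraction is a
graded derivation (`contract_mul`), and the coderivation property of `d` controls how it commutes
with `d` (`contract_d`).

From `UL` to divided powers. If the dual of `A` is `UL`, then `L` acts on `A` by derivations, and an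
element of positive degree killed by all of `L` is zero. Since `A` is the graded dual of `UL`,
one-cocycles of `L` with values in `A` are coboundaries (`exists_action_eq`). For `f` of even
degree, `x ↦ (x f) g_k` is a cocycle as soon as `x g_k = (x f) g_{k-1}`; hence the equations `x
g_{k+1} = (x f) g_k`, `g_0 = 1`, can be solved recursively. In positive degree the solution is
unique, so each axiom for divided powers is proved by checking that both sides have the same
derivatives (`isDividedPowerSystem`). The derivations `x ⊗ 1` and `1 ⊗ x` do the same for `A ⊗ A`,
and uniqueness also gives the compatibility with `Δ` and `d`. `A` is connected because an `x` of
degree zero pairing non-trivially with `A^0` would make infinitely many `g_k` linearly independent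
in the finitely generated module `A^0`.

From divided powers to `UL`. Take for `L` the `Γ`-primitive functionals, those that vanish on
products of elements of positive degree, on scalars and on all `γ^k(a)` with `k ≥ 2`. Contraction
with such a `φ` sends `γ^{k+1}(a)` to `φ(a)`-contracted times `γ^k(a)`, that is, it is a
`Γ`-derivation (`contract_dividedPower`). It follows that `L` is closed under graded commutators,
and under the differential because `d` is a `Γ`-derivation. `UL` acts on `A`, and `(u, a) ↦ ε(u a)`
is the pairing to be shown perfect in each degree.

For this, elements `a_i` and dual `Γ`-primitive functionals are constructed degree by degree
(`exists_dualSystem`). Contraction with the `j`-th functional lowers the exponent of `a_j` in a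
monomial by one, up to a unit and terms of higher weight; divided powers leave no factorials behind.
So the matrix pairing words in the functionals with monomials is block triangular with units on the
diagonal (`isUnit_det_pairingMatrix`). Its invertibility is used twice. The monomials span a
submodule with torsion-free quotient, so over a principal ideal domain the system can be enlarged by
a basis of this quotient until the monomials span `A`. And since the sorted words span `UL`, the
pairing is bijective in each degree (`pairing_bijOn`); the independence half of
Poincaré–Birkhoff–Witt is never needed. Invertibility of `2` makes odd squares vanish in `A` and
equal to `[x, x]/2` in `UL`. -/

section ScalarSigns

/-! ### Signs as scalars, and induction over homogeneous elements. -/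

variable (R : Type*) [CommRing R]

/-- The sign `(-1)^n` as a scalar. -/
def sgn (n : ℤ) : R := ((n.negOnePow : ℤ) : R)

variable {R}

theorem sgn_add (m n : ℤ) : sgn R (m + n) = sgn R m * sgn R n := by
  simp [sgn, Int.negOnePow_add]

theorem sgn_of_even {n : ℤ} (h : Even n) : sgn R n = 1 := by
  simp [sgn, Int.negOnePow_even n h]

theorem sgn_of_odd {n : ℤ} (h : Odd n) : sgn R n = -1 := by
  simp [sgn, Int.negOnePow_odd n h]

@[simp] theorem sgn_zero : sgn R 0 = 1 := sgn_of_even Even.zero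

@[simp] theorem sgn_one : sgn R 1 = -1 := sgn_of_odd odd_one

theorem sgn_mul_self (n : ℤ) : sgn R n * sgn R n = 1 := by
  rw [← sgn_add]; exact sgn_of_even ⟨n, rfl⟩

/-- With the half-difference `k` given explicitly, every comparison of Koszul signs becomes an
identity for `ring`. -/
theorem sgn_congr {m n : ℤ} (k : ℤ) (h : m = n + 2 * k) : sgn R m = sgn R n := by
  subst h
  rw [sgn_add, sgn_of_even (even_two_mul k), mul_one]

theorem sgn_neg (n : ℤ) : sgn R (-n) = sgn R n := sgn_congr (-n) (by ring)

theorem sgn_eq_or (n : ℤ) : sgn R n = 1 ∨ sgn R n = -1 :=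
  (Int.even_or_odd n).imp sgn_of_even sgn_of_odd

theorem negOnePow_smul_eq {M : Type*} [AddCommGroup M] [Module R M] (n : ℤ) (a : M) :
    n.negOnePow • a = sgn R n • a := by
  rw [Units.smul_def, sgn, Int.cast_smul_eq_zsmul R]

end ScalarSigns

section SignPow

variable {R : Type*} [CommRing R] {M : Type*} [AddCommGroup M] [Module R M]

/-- The map `a ↦ (-1)^(p|a|) a`. -/
noncomputable def signPow (ℳ : ℤ → Submodule R M) [DirectSum.Decomposition ℳ] (p : ℤ) :
    M →ₗ[R] M :=
  open Classical in if Even p then LinearMap.id else signInvolution ℳ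

theorem signPow_apply (ℳ : ℤ → Submodule R M) [DirectSum.Decomposition ℳ] (p : ℤ)
    {n : ℤ} {a : M} (ha : a ∈ ℳ n) : signPow ℳ p a = sgn R (p * n) • a := by
  unfold signPow
  split_ifs with h
  · rw [sgn_of_even (h.mul_right n), one_smul]; rfl
  · obtain ⟨k, rfl⟩ := Int.not_even_iff_odd.1 h
    rw [signInvolution_apply _ ha, negOnePow_smul_eq (R := R),
      sgn_congr (k * n) (show (2 * k + 1) * n = n + 2 * (k * n) by ring)]

@[elab_as_elim]
theorem homogeneous_induction (ℳ : ℤ → Submodule R M) [DirectSum.Decomposition ℳ]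
    {P : M → Prop} (a : M) (h : ∀ n, ∀ a ∈ ℳ n, P a) (add : ∀ a b, P a → P b → P (a + b)) :
    P a := by
  induction a using DirectSum.Decomposition.inductionOn ℳ with
  | zero => exact h 0 0 (zero_mem _)
  | homogeneous a => exact h _ _ a.2
  | add a b ha hb => exact add a b ha hb

theorem linearMap_ext_homogeneous (ℳ : ℤ → Submodule R M) [DirectSum.Decomposition ℳ]
    {N : Type*} [AddCommMonoid N] [Module R N] {f g : M →ₗ[R] N}
    (h : ∀ n, ∀ a ∈ ℳ n, f a = g a) : f = g := by
  ext a
  refine homogeneous_induction ℳ (P := fun a => f a = g a) a h fun a b ha hb => ?_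
  rw [map_add, map_add, ha, hb]

end SignPow

/-! ### Slices of tensors and contraction by functionals. -/

section Contraction

variable {R : Type*} [CommRing R] {A : Type*} [Ring A] [Algebra R A]
variable (𝒜 : ℤ → Submodule R A)

/-- `a ⊗ b ↦ φ(b) a`. -/
noncomputable def plainSlice {N : Type*} [AddCommGroup N] [Module R N] (φ : Module.Dual R N) :
    A ⊗[R] N →ₗ[R] A :=
  (TensorProduct.rid R A).toLinearMap ∘ₗ φ.lTensor A

@[simp] theorem plainSlice_tmul {N : Type*} [AddCommGroup N] [Module R N] (φ : Module.Dual R N)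
    (a : A) (b : N) : plainSlice φ (a ⊗ₜ b) = φ b • a := by
  simp [plainSlice]

/-- The contraction `a ↦ ∑ φ(a'') a'` without signs. -/
noncomputable def plainContract [Coalgebra R A] (φ : Module.Dual R A) : Module.End R A :=
  plainSlice φ ∘ₗ Coalgebra.comul

/-- This is coassociativity. It is kept free of signs; the signed version follows from it by
comparing signs degree by degree. -/
theorem plainContract_comp [Coalgebra R A] (φ ψ : Module.Dual R A) (a : A) :
    plainContract φ (plainContract ψ a) = plainContract (φ ∘ₗ plainContract ψ) a := by
  have key : ∀ t : A ⊗[R] A, plainContract φ (plainSlice ψ t) =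
      plainSlice (TensorProduct.lid R R ∘ₗ TensorProduct.map φ ψ)
        (TensorProduct.assoc R A A A (Coalgebra.comul.rTensor A t)) := by
    intro t
    induction t with
    | zero => simp
    | add s t hs ht => simp only [map_add, hs, ht]
    | tmul b c =>
      simp only [plainSlice_tmul, plainContract, LinearMap.comp_apply, map_smul,
        LinearMap.rTensor_tmul]
      generalize (Coalgebra.comul b : A ⊗[R] A) = s
      induction s with
      | zero => simp
      | add s t hs ht => simp only [map_add, smul_add, TensorProduct.add_tmul, hs, ht]
      | tmul x y => simp [smul_smul, mul_comm]
  have h2 : ∀ t : A ⊗[R] A, plainSlice (TensorProduct.lid R R ∘ₗ TensorProduct.map φ ψ)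
      (Coalgebra.comul.lTensor A t) = plainSlice (φ ∘ₗ plainContract ψ) t := by
    intro t
    induction t with
    | zero => simp
    | add s t hs ht => simp only [map_add, hs, ht]
    | tmul b c =>
      simp only [LinearMap.lTensor_tmul]
      have : ∀ s : A ⊗[R] A, TensorProduct.lid R R (TensorProduct.map φ ψ s) =
          φ (plainSlice ψ s) := by
        intro s
        induction s with
        | zero => simp
        | add s t hs ht => simp only [map_add, hs, ht]
        | tmul x y => simp [mul_comm]
      simp [plainContract, this]
  have h := key (Coalgebra.comul a)
  rw [Coalgebra.coassoc_apply, h2] at h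
  exact h

theorem tmul_mem_tensorPiece {i j : ℤ} {a b : A} (ha : a ∈ 𝒜 i) (hb : b ∈ 𝒜 j) :
    a ⊗ₜ[R] b ∈ tensorPiece 𝒜 (i + j) :=
  Submodule.subset_span ⟨i, j, rfl, a, ha, b, hb, rfl⟩

theorem tensorPiece_induction_aux {n : ℤ} {P : A ⊗[R] A → Prop} {t : A ⊗[R] A}
    (ht : t ∈ tensorPiece 𝒜 n)
    (tmul : ∀ i j : ℤ, i + j = n → ∀ a ∈ 𝒜 i, ∀ b ∈ 𝒜 j, P (a ⊗ₜ b))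
    (add : ∀ s t, s ∈ tensorPiece 𝒜 n → t ∈ tensorPiece 𝒜 n → P s → P t → P (s + t)) : P t := by
  -- Proving the claim for all multiples absorbs scalars into the left tensor factor, so `P` need
  -- not be closed under scalars.
  have h : ∀ r : R, P (r • t) := by
    induction ht using Submodule.span_induction with
    | mem t h =>
      obtain ⟨i, j, hij, a, ha, b, hb, rfl⟩ := h
      intro r
      rw [TensorProduct.smul_tmul']
      exact tmul i j hij _ (Submodule.smul_mem _ r ha) b hb
    | zero =>
      intro r
      rw [smul_zero, ← TensorProduct.zero_tmul A (0 : A)]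
      exact tmul n 0 (add_zero n) 0 (zero_mem _) 0 (zero_mem _)
    | add s t hs ht ihs iht =>
      intro r
      rw [smul_add]
      exact add _ _ (Submodule.smul_mem _ r hs) (Submodule.smul_mem _ r ht) (ihs r) (iht r)
    | smul r' t _ ih =>
      intro r
      rw [smul_smul]
      exact ih _
  simpa using h 1

@[elab_as_elim]
theorem tensorPiece_induction {n : ℤ} {P : (t : A ⊗[R] A) → t ∈ tensorPiece 𝒜 n → Prop}
    (tmul : ∀ (i j : ℤ) (hij : i + j = n) (a : A) (ha : a ∈ 𝒜 i) (b : A) (hb : b ∈ 𝒜 j),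
      P (a ⊗ₜ b) (hij ▸ tmul_mem_tensorPiece 𝒜 ha hb))
    (add : ∀ s t hs ht, P s hs → P t ht → P (s + t) (add_mem hs ht)) {t : A ⊗[R] A}
    (ht : t ∈ tensorPiece 𝒜 n) : P t ht := by
  obtain ⟨_, h⟩ : ∃ h, P t h := tensorPiece_induction_aux 𝒜 (P := fun t => ∃ h, P t h) ht
    (fun i j hij a ha b hb => ⟨_, tmul i j hij a ha b hb⟩)
    fun s t _ _ ⟨hs, hs'⟩ ⟨ht, ht'⟩ => ⟨_, add s t hs ht hs' ht'⟩
  exact h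

variable [GradedAlgebra 𝒜]

@[elab_as_elim]
theorem tensor_induction {P : A ⊗[R] A → Prop} (t : A ⊗[R] A)
    (tmul : ∀ i j : ℤ, ∀ a ∈ 𝒜 i, ∀ b ∈ 𝒜 j, P (a ⊗ₜ b))
    (add : ∀ s t, P s → P t → P (s + t)) : P t := by
  induction t with
  | zero =>
    rw [← TensorProduct.zero_tmul A (0 : A)]
    exact tmul 0 0 0 (zero_mem _) 0 (zero_mem _)
  | add s t hs ht => exact add s t hs ht
  | tmul a b =>
    refine homogeneous_induction 𝒜 (P := fun a => P (a ⊗ₜ b)) a (fun i a ha => ?_) ?_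
    · refine homogeneous_induction 𝒜 (P := fun b => P (a ⊗ₜ b)) b
        (fun j b hb => tmul i j a ha b hb) ?_
      intro b b' h h'
      rw [TensorProduct.tmul_add]
      exact add _ _ h h'
    · intro b b' h h'
      rw [TensorProduct.add_tmul]
      exact add _ _ h h'

theorem of_tmul_mul {j k : ℤ} (a b' : A) {b a' : A} (hb : b ∈ 𝒜 j) (ha' : a' ∈ 𝒜 k) :
    GradedTensorProduct.of R 𝒜 𝒜 (a ⊗ₜ b) * GradedTensorProduct.of R 𝒜 𝒜 (a' ⊗ₜ b') =
      sgn R (j * k) • GradedTensorProduct.of R 𝒜 𝒜 ((a * a') ⊗ₜ (b * b')) := by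
  have h := GradedTensorProduct.tmul_coe_mul_coe_tmul (R := R) 𝒜 𝒜 a ⟨b, hb⟩ ⟨a', ha'⟩ b'
  exact h.trans (negOnePow_smul_eq (R := R) _ _)

theorem koszulSign_tmul' {i j : ℤ} {a b : A}
    (ha : a ∈ 𝒜 i) (hb : b ∈ 𝒜 j) :
    koszulSign 𝒜 (a ⊗ₜ[R] b) = sgn R (i * j) • (a ⊗ₜ[R] b) := by
  rw [koszulSign_tmul 𝒜 ha hb, negOnePow_smul_eq (R := R)]

/-- `a ⊗ b ↦ (-1)^{|a||b|} φ(b) a`. -/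
noncomputable def slice : Module.Dual R A →ₗ[R] A ⊗[R] A →ₗ[R] A where
  toFun φ := plainSlice φ ∘ₗ koszulSign 𝒜
  map_add' φ ψ := by
    ext t
    simp [plainSlice, LinearMap.lTensor_add]
  map_smul' r φ := by
    ext t
    simp [plainSlice, LinearMap.lTensor_smul]

theorem slice_tmul (φ : Module.Dual R A) {i j : ℤ} {a b : A} (ha : a ∈ 𝒜 i) (hb : b ∈ 𝒜 j) :
    slice 𝒜 φ (a ⊗ₜ b) = (sgn R (i * j) * φ b) • a := by
  simp [slice, koszulSign_tmul' 𝒜 ha hb, smul_smul]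

variable {𝒜} in
theorem slice_mem {φ : Module.Dual R A} {p n : ℤ} (hφ : φ ∈ dualPiece 𝒜 p) {t : A ⊗[R] A}
    (ht : t ∈ tensorPiece 𝒜 n) : slice 𝒜 φ t ∈ 𝒜 (n - p) := by
  induction ht using tensorPiece_induction 𝒜 with
  | tmul i j hij a ha b hb =>
    rw [slice_tmul 𝒜 φ ha hb]
    by_cases hj : j = p
    · rw [← hij, hj, add_sub_cancel_right]
      exact Submodule.smul_mem _ _ ha
    · rw [hφ j hj b hb, mul_zero, zero_smul]
      exact zero_mem _
  | add s t _ _ hs ht => rw [map_add]; exact add_mem hs ht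

variable {𝒜} in
-- Only terms `a ⊗ b` with `|b| = p` survive, and then `|a| = n - p`, so the Koszul sign is the same
-- for all of them.
theorem slice_eq_plainSlice {φ : Module.Dual R A} {p n : ℤ} (hφ : φ ∈ dualPiece 𝒜 p)
    {t : A ⊗[R] A} (ht : t ∈ tensorPiece 𝒜 n) :
    slice 𝒜 φ t = sgn R (p * (n - p)) • plainSlice φ t := by
  induction ht using tensorPiece_induction 𝒜 with
  | tmul i j hij a ha b hb =>
    rw [slice_tmul 𝒜 φ ha hb, plainSlice_tmul, smul_smul]
    by_cases hj : j = p
    · rw [← hij, hj, add_sub_cancel_right, mul_comm i p]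
    · rw [hφ j hj b hb, mul_zero, mul_zero]
  | add s t _ _ hs ht => rw [map_add, hs, ht, map_add, smul_add]

theorem dualTensor_tmul_apply (f g : gradedDual 𝒜) (t : A ⊗[R] A) :
    dualTensor 𝒜 (f ⊗ₜ g) t = (f : Module.Dual R A) (slice 𝒜 g t) := by
  refine tensor_induction 𝒜 (P := fun t => dualTensor 𝒜 (f ⊗ₜ g) t =
    (f : Module.Dual R A) (slice 𝒜 g t)) t (fun i j a ha b hb => ?_) fun s t hs ht => ?_
  · simp only [dualTensor, LinearMap.comp_apply, koszulSign_tmul' 𝒜 ha hb, map_smul,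
      TensorProduct.map_tmul, TensorProduct.dualDistrib_apply, slice_tmul 𝒜 _ ha hb,
      Submodule.subtype_apply, smul_eq_mul]
    ring
  · rw [map_add, hs, ht, map_add, map_add]

variable [Coalgebra R A]

/-- The contraction `a ↦ ∑ (-1)^{|a'||a''|} φ(a'') a'`, where `Δ a = ∑ a' ⊗ a''`. -/
noncomputable def contract : Module.Dual R A →ₗ[R] Module.End R A where
  toFun φ := slice 𝒜 φ ∘ₗ Coalgebra.comul
  map_add' φ ψ := by ext; simp
  map_smul' r φ := by ext; simp

theorem contract_apply (φ : Module.Dual R A) (a : A) :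
    contract 𝒜 φ a = slice 𝒜 φ (Coalgebra.comul a) := rfl

theorem dualMul_apply (f g : gradedDual 𝒜) (a : A) :
    dualMul 𝒜 f g a = (f : Module.Dual R A) (contract 𝒜 g a) :=
  dualTensor_tmul_apply 𝒜 f g _

end Contraction

/-! ### Contractions on a differential Hopf algebra. -/

section ContractionHopf

variable {R : Type*} [CommRing R] {A : Type*} [Ring A] [Algebra R A] [Coalgebra R A]

variable (R) in
/-- A functional `φ` with `φ(ab) = φ(a) ε(b) + ε(a) φ(b)`, that is, a primitive element of the
dual. -/
def IsPrimitiveFunctional (φ : Module.Dual R A) : Prop :=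
  ∀ a b : A, φ (a * b) = φ a * Coalgebra.counit b + Coalgebra.counit a * φ b

variable {𝒜 : ℤ → Submodule R A} [GradedAlgebra 𝒜] {d : A →ₗ[R] A}

namespace IsDGHopfAlgebra

variable (hopf : IsDGHopfAlgebra 𝒜 d)
include hopf

theorem counit_algebraMap (r : R) : Coalgebra.counit (R := R) (algebraMap R A r) = r := by
  rw [Algebra.algebraMap_eq_smul_one, map_smul, hopf.counit_one, smul_eq_mul, mul_one]

theorem counit_mem_dualPiece : Coalgebra.counit ∈ dualPiece 𝒜 0 :=
  fun _ hm _ ha => hopf.counit_of_mem hm ha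

theorem _root_.IsPrimitiveFunctional.map_one {φ : Module.Dual R A}
    (h : IsPrimitiveFunctional R φ) : φ 1 = 0 := by
  have := h 1 1
  rw [hopf.counit_one, mul_one, mul_one, one_mul] at this
  simpa using this

theorem _root_.IsPrimitiveFunctional.map_algebraMap {φ : Module.Dual R A}
    (h : IsPrimitiveFunctional R φ) (r : R) : φ (algebraMap R A r) = 0 := by
  rw [Algebra.algebraMap_eq_smul_one, map_smul, h.map_one hopf, smul_zero]

theorem contract_mem {φ : Module.Dual R A} {p n : ℤ} (hφ : φ ∈ dualPiece 𝒜 p) {a : A}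
    (ha : a ∈ 𝒜 n) : contract 𝒜 φ a ∈ 𝒜 (n - p) :=
  slice_mem hφ (hopf.comul_mem ha)

theorem contract_eq_plainContract {φ : Module.Dual R A} {p n : ℤ} (hφ : φ ∈ dualPiece 𝒜 p) {a : A}
    (ha : a ∈ 𝒜 n) : contract 𝒜 φ a = sgn R (p * (n - p)) • plainContract φ a :=
  slice_eq_plainSlice hφ (hopf.comul_mem ha)

theorem slice_counit (t : A ⊗[R] A) :
    slice 𝒜 Coalgebra.counit t = plainSlice Coalgebra.counit t := by
  refine tensor_induction 𝒜 (P := fun t => slice 𝒜 Coalgebra.counit t =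
    plainSlice Coalgebra.counit t) t (fun i j a ha b hb => ?_) fun s t hs ht => ?_
  · rw [slice_tmul 𝒜 _ ha hb, plainSlice_tmul]
    by_cases hj : j = 0
    · simp [hj]
    · simp [hopf.counit_of_mem hj hb]
  · rw [map_add, hs, ht, map_add]

theorem slice_counit_tmul (a b : A) :
    slice 𝒜 Coalgebra.counit (a ⊗ₜ b) = Coalgebra.counit (R := R) b • a := by
  rw [hopf.slice_counit, plainSlice_tmul]

theorem counit_slice (φ : Module.Dual R A) (t : A ⊗[R] A) :
    Coalgebra.counit (R := R) (slice 𝒜 φ t) =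
      φ (TensorProduct.lid R A (Coalgebra.counit.rTensor A t)) := by
  refine tensor_induction 𝒜 (P := fun t => Coalgebra.counit (R := R) (slice 𝒜 φ t) =
    φ (TensorProduct.lid R A (Coalgebra.counit.rTensor A t))) t
    (fun i j a ha b hb => ?_) fun s t hs ht => ?_
  · rw [slice_tmul 𝒜 _ ha hb]
    by_cases hi : i = 0
    · simp [hi, mul_comm]
    · simp [hopf.counit_of_mem hi ha]
  · simp only [map_add, hs, ht]

/-- The functional is recovered from its contraction; through `contract_injective`, identities in
the dual can be verified among operators on `A`. -/
theorem counit_contract (φ : Module.Dual R A) (a : A) :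
    Coalgebra.counit (R := R) (contract 𝒜 φ a) = φ a := by
  rw [contract_apply, hopf.counit_slice, Coalgebra.rTensor_counit_comul]
  simp

theorem contract_counit : contract 𝒜 Coalgebra.counit = 1 := by
  ext a
  rw [contract_apply, hopf.slice_counit, plainSlice, LinearMap.comp_apply,
    Coalgebra.lTensor_counit_comul]
  simp

theorem contract_injective : Function.Injective (contract 𝒜) := by
  intro φ ψ h
  ext a
  rw [← hopf.counit_contract, h, hopf.counit_contract]

theorem comp_contract_mem {φ ψ : Module.Dual R A} {p q : ℤ} (hφ : φ ∈ dualPiece 𝒜 p)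
    (hψ : ψ ∈ dualPiece 𝒜 q) : φ ∘ₗ contract 𝒜 ψ ∈ dualPiece 𝒜 (p + q) := by
  intro n hn a ha
  exact hφ _ (fun h => hn (by omega)) _ (hopf.contract_mem hψ ha)

/-- Since `φ ∘ₗ contract 𝒜 ψ` is the product of `φ` and `ψ` in the dual, this says that the dual
acts on `A`. -/
theorem contract_comp {φ ψ : Module.Dual R A} {p q : ℤ} (hφ : φ ∈ dualPiece 𝒜 p)
    (hψ : ψ ∈ dualPiece 𝒜 q) :
    contract 𝒜 (φ ∘ₗ contract 𝒜 ψ) = contract 𝒜 φ * contract 𝒜 ψ := by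
  refine linearMap_ext_homogeneous 𝒜 fun n a ha => ?_
  have h : φ ∘ₗ contract 𝒜 ψ = sgn R (p * q) • (φ ∘ₗ plainContract ψ) := by
    refine linearMap_ext_homogeneous 𝒜 fun m b hb => ?_
    rw [LinearMap.comp_apply]
    by_cases hm : m = p + q
    · rw [hopf.contract_eq_plainContract hψ hb, map_smul, hm, add_sub_cancel_right, mul_comm q p]
      rfl
    · have h1 := hopf.comp_contract_mem hφ hψ m hm b hb
      have h2 := hopf.contract_eq_plainContract hψ hb
      rw [LinearMap.comp_apply, h2, map_smul] at h1
      -- Off degree `p + q` the signed expression vanishes, and the sign is a unit.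
      have h3 : φ (plainContract ψ b) = 0 := by
        rw [← one_smul R (φ _), ← sgn_mul_self (R := R) (q * (m - q)), mul_smul, h1, smul_zero]
      rw [h2, LinearMap.smul_apply, LinearMap.comp_apply, map_smul, h3, smul_zero, smul_zero]
  rw [hopf.contract_eq_plainContract (hopf.comp_contract_mem hφ hψ) ha, Module.End.mul_apply,
    hopf.contract_eq_plainContract hφ (hopf.contract_mem hψ ha),
    hopf.contract_eq_plainContract hψ ha, map_smul, plainContract_comp, h, smul_smul]
  have h' : plainContract (sgn R (p * q) • (φ ∘ₗ plainContract ψ)) a =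
      sgn R (p * q) • plainContract (φ ∘ₗ plainContract ψ) a := by
    simp [plainContract, plainSlice, LinearMap.lTensor_smul]
  rw [h', smul_smul, ← sgn_add, ← sgn_add]
  congr 1
  apply sgn_congr (p * q - p * q)
  ring

/-- `id ⊗ ε` is a morphism of algebras; the interchange sign matters only if `|b| = 0`, where it is
trivial. -/
theorem slice_counit_mul (s t : A ⊗[R] A) :
    slice 𝒜 Coalgebra.counit ((GradedTensorProduct.of R 𝒜 𝒜).symm
      (GradedTensorProduct.of R 𝒜 𝒜 s * GradedTensorProduct.of R 𝒜 𝒜 t)) =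
      slice 𝒜 Coalgebra.counit s * slice 𝒜 Coalgebra.counit t := by
  refine tensor_induction 𝒜 (P := fun s => slice 𝒜 Coalgebra.counit
      ((GradedTensorProduct.of R 𝒜 𝒜).symm
      (GradedTensorProduct.of R 𝒜 𝒜 s * GradedTensorProduct.of R 𝒜 𝒜 t)) =
      slice 𝒜 Coalgebra.counit s * slice 𝒜 Coalgebra.counit t) s
    (fun i j a ha b hb => ?_) fun s s' hs hs' => ?_
  · refine tensor_induction 𝒜 (P := fun t => slice 𝒜 Coalgebra.counit
      ((GradedTensorProduct.of R 𝒜 𝒜).symm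
      (GradedTensorProduct.of R 𝒜 𝒜 (a ⊗ₜ b) * GradedTensorProduct.of R 𝒜 𝒜 t)) =
      slice 𝒜 Coalgebra.counit (a ⊗ₜ b) * slice 𝒜 Coalgebra.counit t) t
      (fun k l a' ha' b' hb' => ?_) fun t t' ht ht' => ?_
    · rw [of_tmul_mul 𝒜 a b' hb ha', map_smul, GradedTensorProduct.of_symm_of, map_smul]
      simp only [hopf.slice_counit_tmul, hopf.counit_mul]
      by_cases hj : j = 0
      · simp [hj, smul_smul, mul_comm]
      · simp [hopf.counit_of_mem hj hb]
    · simp only [map_add, mul_add, ht, ht']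
  · simp only [map_add, add_mul, hs, hs']

/-- A primitive `φ` is a derivation over `ε`, so `id ⊗ φ` is a graded derivation over the morphism
`id ⊗ ε`. Composed with `Δ`, this gives the Leibniz rule for contractions. -/
theorem slice_mul {φ : Module.Dual R A} {p : ℤ} (hφ : φ ∈ dualPiece 𝒜 p)
    (prim : IsPrimitiveFunctional R φ) {m : ℤ} {s : A ⊗[R] A} (hs : s ∈ tensorPiece 𝒜 m)
    (t : A ⊗[R] A) :
    slice 𝒜 φ ((GradedTensorProduct.of R 𝒜 𝒜).symm
      (GradedTensorProduct.of R 𝒜 𝒜 s * GradedTensorProduct.of R 𝒜 𝒜 t)) =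
      slice 𝒜 φ s * slice 𝒜 Coalgebra.counit t +
        sgn R (p * m) • (slice 𝒜 Coalgebra.counit s * slice 𝒜 φ t) := by
  induction hs using tensorPiece_induction 𝒜 with
  | add s s' _ _ hs hs' =>
    simp only [map_add, add_mul, hs, hs', smul_add]
    abel
  | tmul i j hij a ha b hb =>
    refine tensor_induction 𝒜 (P := fun t => slice 𝒜 φ
      ((GradedTensorProduct.of R 𝒜 𝒜).symm
      (GradedTensorProduct.of R 𝒜 𝒜 (a ⊗ₜ b) * GradedTensorProduct.of R 𝒜 𝒜 t)) =
      slice 𝒜 φ (a ⊗ₜ b) * slice 𝒜 Coalgebra.counit t +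
        sgn R (p * m) • (slice 𝒜 Coalgebra.counit (a ⊗ₜ b) * slice 𝒜 φ t)) t
      (fun k l a' ha' b' hb' => ?_) fun t t' ht ht' => ?_
    · rw [of_tmul_mul 𝒜 a b' hb ha', map_smul, GradedTensorProduct.of_symm_of, map_smul]
      rw [slice_tmul 𝒜 φ (SetLike.mul_mem_graded ha ha') (SetLike.mul_mem_graded hb hb'),
        slice_tmul 𝒜 φ ha hb, slice_tmul 𝒜 φ ha' hb', hopf.slice_counit_tmul,
        hopf.slice_counit_tmul, prim]
      simp only [smul_mul_assoc, mul_smul_comm, smul_smul, ← add_smul]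
      congr 1
      rw [mul_add, mul_add]
      congr 1
      -- The term `φ(b) ε(b')` needs `|b'| = 0` and `|b| = p`; the other one needs `|b| = 0` and
      -- `|b'| = p`. In these degrees the signs agree.
      · by_cases hl : l = 0
        · subst hl
          by_cases hj : j = p
          · rw [add_zero, add_mul, sgn_add, mul_comm k j]
            linear_combination (sgn R (i * j) * φ b * Coalgebra.counit (R := R) b') *
              sgn_mul_self (R := R) (j * k)
          · rw [hφ j hj b hb]; ring
        · rw [hopf.counit_of_mem hl hb']; ring
      · by_cases hj : j = 0
        · subst hj
          by_cases hl : l = p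
          · subst hl
            rw [zero_add, add_mul, sgn_add, zero_mul, sgn_zero, ← hij, add_zero, mul_comm i l]
            ring
          · rw [hφ l hl b' hb']; ring
        · rw [hopf.counit_of_mem hj hb]; ring
    · simp only [map_add, mul_add, ht, ht', smul_add]
      abel

theorem contract_mul {φ : Module.Dual R A} {p : ℤ} (hφ : φ ∈ dualPiece 𝒜 p)
    (prim : IsPrimitiveFunctional R φ) {m : ℤ} {a : A} (ha : a ∈ 𝒜 m) (b : A) :
    contract 𝒜 φ (a * b) = contract 𝒜 φ a * b + sgn R (p * m) • (a * contract 𝒜 φ b) := by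
  have h := hopf.slice_mul hφ prim (hopf.comul_mem ha) (Coalgebra.comul b)
  rw [← hopf.comul_mul, GradedTensorProduct.of_symm_of] at h
  have e : ∀ a, slice 𝒜 Coalgebra.counit (Coalgebra.comul a) = a := fun a => by
    rw [← contract_apply, hopf.contract_counit]; rfl
  rw [e, e] at h
  exact h

theorem contract_one {φ : Module.Dual R A} {p : ℤ} (hφ : φ ∈ dualPiece 𝒜 p)
    (prim : IsPrimitiveFunctional R φ) : contract 𝒜 φ 1 = 0 := by
  have h := hopf.contract_mul hφ prim (SetLike.GradedOne.one_mem (A := 𝒜)) 1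
  simpa using h

theorem comp_d_mem {φ : Module.Dual R A} {p : ℤ} (hφ : φ ∈ dualPiece 𝒜 p) :
    φ ∘ₗ d ∈ dualPiece 𝒜 (p - 1) := by
  intro n hn a ha
  exact hφ _ (fun h => hn (by omega)) _ (hopf.d_mem ha)

/-- Apply `φ` to the right factor of `Δ d = (d ⊗ 1 + 1 ⊗ d) Δ`: the first summand gives `d` after
contraction, the second gives contraction with `φ ∘ d`. -/
theorem contract_d {φ : Module.Dual R A} {p : ℤ} (hφ : φ ∈ dualPiece 𝒜 p) (a : A) :
    contract 𝒜 φ (d a) = sgn R p • d (contract 𝒜 φ a) + contract 𝒜 (φ ∘ₗ d) a := by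
  refine homogeneous_induction 𝒜 (P := fun a => contract 𝒜 φ (d a) =
    sgn R p • d (contract 𝒜 φ a) + contract 𝒜 (φ ∘ₗ d) a) a (fun n a ha => ?_) ?_
  · rw [hopf.contract_eq_plainContract hφ (hopf.d_mem ha), hopf.contract_eq_plainContract hφ ha,
      hopf.contract_eq_plainContract (hopf.comp_d_mem hφ) ha]
    have h : ∀ t ∈ tensorPiece 𝒜 n, plainSlice φ (TensorProduct.map d LinearMap.id t +
        TensorProduct.map (signInvolution 𝒜) d t) =
        d (plainSlice φ t) + sgn R (n - p + 1) • plainSlice (φ ∘ₗ d) t := by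
      intro t ht
      induction ht using tensorPiece_induction 𝒜 with
      | tmul i j hij a ha b hb =>
        simp only [map_add, TensorProduct.map_tmul, plainSlice_tmul, map_smul, LinearMap.id_apply,
          signInvolution_apply 𝒜 ha, LinearMap.comp_apply]
        rw [negOnePow_smul_eq (R := R), smul_comm]
        by_cases hj : j + 1 = p
        · rw [show n - p + 1 = i by omega]
        · rw [hφ _ hj _ (hopf.d_mem hb)]; simp
      | add s t _ _ hs ht =>
        simp only [map_add, smul_add] at hs ht ⊢
        rw [add_add_add_comm, hs, ht]
        abel
    have h' := h _ (hopf.comul_mem ha)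
    rw [← hopf.comul_d] at h'
    rw [plainContract, LinearMap.comp_apply, h']
    simp only [smul_add, map_smul, smul_smul, ← sgn_add, plainContract, LinearMap.comp_apply]
    congr 2
    · apply sgn_congr 0; ring
    · apply sgn_congr (n - p + 1); ring
  · intro a b ha hb
    simp only [map_add, ha, hb, smul_add]
    abel

end IsDGHopfAlgebra

end ContractionHopf

/-! ### Divided powers characterised by differential equations. -/

section DerivationCriterion

variable {R : Type*} [CommRing R] {B : Type*} [Ring B] [Algebra R B]

/-- A family of graded derivations `D i`, of degree `-deg i`, of a graded algebra. -/
structure IsDerivationFamily (ℬ : ℤ → Submodule R B) {ι : Type*} (deg : ι → ℤ)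
    (D : ι → B →ₗ[R] B) : Prop where
  mem : ∀ ⦃i : ι⦄ ⦃m : ℤ⦄ ⦃a : B⦄, a ∈ ℬ m → D i a ∈ ℬ (m - deg i)
  leibniz : ∀ ⦃i : ι⦄ ⦃m : ℤ⦄ ⦃a : B⦄ (b : B), a ∈ ℬ m →
    D i (a * b) = D i a * b + sgn R (deg i * m) • (a * D i b)

/-- `g` is a sequence of divided powers of `a`, as far as the operators `D i` can tell. -/
structure IsDividedPowerSequence (ℬ : ℤ → Submodule R B) {ι : Type*} (D : ι → B →ₗ[R] B)
    (m : ℤ) (a : B) (g : ℕ → B) : Prop where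
  zero : g 0 = 1
  mem : ∀ k : ℕ, g k ∈ ℬ (k * m)
  D_succ : ∀ (i : ι) (k : ℕ), D i (g (k + 1)) = D i a * g k

variable {ℬ : ℤ → Submodule R B}

theorem commute_of_even (comm : ∀ ⦃i j : ℤ⦄ ⦃a b : B⦄, a ∈ ℬ i → b ∈ ℬ j →
    a * b = sgn R (i * j) • (b * a)) {i j : ℤ} {a b : B} (hi : Even i) (ha : a ∈ ℬ i)
    (hb : b ∈ ℬ j) : Commute a b := by
  have := comm ha hb
  rwa [sgn_of_even (hi.mul_right j), one_smul] at this

theorem mul_self_of_odd (two : IsUnit (2 : R)) (comm : ∀ ⦃i j : ℤ⦄ ⦃a b : B⦄, a ∈ ℬ i → b ∈ ℬ j →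
    a * b = sgn R (i * j) • (b * a)) {i : ℤ} {a : B} (hi : Odd i) (ha : a ∈ ℬ i) : a * a = 0 := by
  have := comm ha ha
  rw [sgn_of_odd (hi.mul hi), neg_one_smul] at this
  have h2 : (2 : R) • (a * a) = 0 := by rw [two_smul]; nth_rw 1 [this]; simp
  exact (two.smul_eq_zero).1 h2

variable {ι : Type*} {deg : ι → ℤ} {D : ι → B →ₗ[R] B}

theorem eq_of_forall_map_eq (detect : ∀ ⦃m : ℤ⦄ ⦃a : B⦄, 0 < m → a ∈ ℬ m →
    (∀ i, D i a = 0) → a = 0) {m : ℤ} (hm : 0 < m) {a b : B} (ha : a ∈ ℬ m) (hb : b ∈ ℬ m)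
    (h : ∀ i, D i a = D i b) : a = b :=
  sub_eq_zero.1 <| detect hm (sub_mem ha hb) fun i => by rw [map_sub, h, sub_self]

variable [SetLike.GradedMonoid ℬ]

namespace IsDerivationFamily

variable (hD : IsDerivationFamily ℬ deg D)
include hD

theorem map_one (i : ι) : D i 1 = 0 := by
  have := hD.leibniz (i := i) 1 (SetLike.GradedOne.one_mem (A := ℬ))
  simpa using this

omit [SetLike.GradedMonoid ℬ] in
theorem leibniz_even {i : ι} {m : ℤ} (hm : Even m) {a : B} (ha : a ∈ ℬ m) (b : B) :
    D i (a * b) = D i a * b + a * D i b := by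
  rw [hD.leibniz b ha, sgn_of_even (hm.mul_left _), one_smul]

variable (comm : ∀ ⦃i j : ℤ⦄ ⦃a b : B⦄, a ∈ ℬ i → b ∈ ℬ j → a * b = sgn R (i * j) • (b * a))
include comm

omit [SetLike.GradedMonoid ℬ] in
theorem map_pow_even {i : ι} {m : ℤ} (hm : Even m) {a : B} (ha : a ∈ ℬ m) (k : ℕ) :
    D i (a ^ (k + 1)) = (k + 1) • (D i a * a ^ k) := by
  induction k with
  | zero => simp
  | succ k ih =>
    have hc : Commute a (D i a) := commute_of_even comm hm ha (hD.mem ha)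
    rw [pow_succ' a (k + 1), hD.leibniz_even hm ha, ih, mul_smul_comm, ← mul_assoc, hc.eq,
      mul_assoc, ← pow_succ' a k, ← succ_nsmul']

/-- The Leibniz rule applied to the convolution gives two sums, in which one index is shifted after
the vanishing boundary term is removed. -/
theorem sequence_add {m : ℤ} (hm : Even m) {a b : B}
    {g h : ℕ → B} (hg : IsDividedPowerSequence ℬ D m a g)
    (hh : IsDividedPowerSequence ℬ D m b h) :
    IsDividedPowerSequence ℬ D m (a + b)
      (fun k => ∑ p ∈ Finset.HasAntidiagonal.antidiagonal k, g p.1 * h p.2) where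
  zero := by simp [hg.zero, hh.zero]
  mem k := by
    refine Submodule.sum_mem _ fun p hp => ?_
    have := SetLike.mul_mem_graded (hg.mem p.1) (hh.mem p.2)
    rwa [← add_mul, ← Nat.cast_add, Finset.HasAntidiagonal.mem_antidiagonal.1 hp] at this
  D_succ i k := by
    -- That `b` is homogeneous is not assumed; `h 1` is homogeneous and has the same derivatives as
    -- `b`.
    have hb : ∀ j, g j * D i b = D i b * g j := by
      intro j
      cases j with
      | zero => rw [hg.zero, one_mul, mul_one]
      | succ j =>
        have hb : h 1 ∈ ℬ m := by simpa using hh.mem 1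
        have h1 : D i (h 1) = D i b := by simpa [hh.zero] using hh.D_succ i 0
        rw [← h1]
        exact commute_of_even comm (hm.mul_left _) (hg.mem (j + 1)) (hD.mem hb)
    have e : ∀ p : ℕ × ℕ, D i (g p.1 * h p.2) = D i (g p.1) * h p.2 + g p.1 * D i (h p.2) :=
      fun p => hD.leibniz_even (hm.mul_left _) (hg.mem p.1) _
    simp only [map_sum, e, Finset.sum_add_distrib]
    rw [Finset.Nat.sum_antidiagonal_succ, Finset.Nat.sum_antidiagonal_succ']
    simp only [hg.zero, hh.zero, hD.map_one, zero_mul, mul_zero, zero_add,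
      hg.D_succ, hh.D_succ, ← mul_assoc, hb, map_add, add_mul, Finset.mul_sum,
      Finset.sum_add_distrib]

/-- Differentiating `a^{k+1}` produces the factor `k + 1`, which `hgb` absorbs by turning `(k + 1)
g_{k+1}` into `b g_k`. -/
theorem sequence_even_mul {m n : ℤ} (hm : Even m) {a b : B} (ha : a ∈ ℬ m)
    (hb : b ∈ ℬ n) {g : ℕ → B} (hg : IsDividedPowerSequence ℬ D n b g)
    (hgb : ∀ k : ℕ, b * g k = (k + 1) • g (k + 1)) :
    IsDividedPowerSequence ℬ D (m + n) (a * b) (fun k => a ^ k * g k) where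
  zero := by simp [hg.zero]
  mem k := by
    have := SetLike.mul_mem_graded (SetLike.pow_mem_graded k ha) (hg.mem k)
    rwa [nsmul_eq_mul, ← mul_add] at this
  D_succ i k := by
    have hc : Commute a (D i a) := commute_of_even comm hm ha (hD.mem ha)
    have hc' : Commute a (D i b) := commute_of_even comm hm ha (hD.mem hb)
    have hc'' : Commute a b := commute_of_even comm hm ha hb
    rw [hD.leibniz_even (m := (k + 1 : ℕ) • m) (hm.nsmul_right _) (SetLike.pow_mem_graded _ ha),
      hD.leibniz_even hm ha, hD.map_pow_even comm hm ha, hg.D_succ, add_mul, smul_mul_assoc,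
      ← mul_smul_comm, ← hgb]
    congr 1
    · rw [mul_assoc, mul_assoc, ← mul_assoc b, ← mul_assoc (a ^ k) b, (hc''.pow_left k).eq]
    · rw [mul_assoc a, ← mul_assoc (D i b) (a ^ k), ← (hc'.pow_left k).eq, pow_succ', mul_assoc,
        mul_assoc]

/-- As `a² = b² = 0`, the product `D(ab) ab` vanishes, so the sequence `1, ab, 0, 0, …` satisfies
the equations. -/
theorem sequence_odd_mul (two : IsUnit (2 : R)) {m n : ℤ} (hm : Odd m) (hn : Odd n) {a b : B}
    (ha : a ∈ ℬ m) (hb : b ∈ ℬ n) :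
    IsDividedPowerSequence ℬ D (m + n) (a * b)
      (fun k => if k = 0 then 1 else if k = 1 then a * b else 0) where
  zero := by simp
  mem k := by
    match k with
    | 0 => simpa using SetLike.GradedOne.one_mem (A := ℬ)
    | 1 => simpa using SetLike.mul_mem_graded ha hb
    | k + 2 => simp
  D_succ i k := by
    match k with
    | 0 => simp
    | 1 =>
      have h1 : a * a = 0 := mul_self_of_odd two comm hm ha
      have h2 : b * b = 0 := mul_self_of_odd two comm hn hb
      have h3 : a * (a * b) = 0 := by rw [← mul_assoc, h1, zero_mul]
      have h4 : b * (a * b) = 0 := by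
        rw [comm ha hb, mul_smul_comm, ← mul_assoc, h2, zero_mul, smul_zero]
      have h5 := comm (hD.mem (i := i) hb) ha
      have h6 : D i b * (a * b) = sgn R ((n - deg i) * m) • (a * (D i b * b)) := by
        rw [← mul_assoc, h5, smul_mul_assoc, mul_assoc]
      simp [hD.leibniz b ha, add_mul, mul_assoc, h4, h6]
      rw [← mul_assoc a a, h1]
      simp
    | k + 2 => simp

variable (detect : ∀ ⦃m : ℤ⦄ ⦃a : B⦄, 0 < m → a ∈ ℬ m → (∀ i, D i a = 0) → a = 0)
include detect

omit [SetLike.GradedMonoid ℬ] comm hD in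
-- Two solutions that agree at `k` have the same derivatives at `k + 1`, where the degree is
-- positive. An axiom for divided powers thus follows once both sides solve the same equations.
theorem sequence_unique {m : ℤ} (hm : 0 < m) {a : B} {g h : ℕ → B}
    (hg : IsDividedPowerSequence ℬ D m a g) (hh : IsDividedPowerSequence ℬ D m a h) (k : ℕ) :
    g k = h k := by
  induction k with
  | zero => rw [hg.zero, hh.zero]
  | succ k ih =>
    exact eq_of_forall_map_eq detect (mul_pos (by positivity) hm) (hg.mem _) (hh.mem _) fun i => by
      rw [hg.D_succ, hh.D_succ, ih]

omit [SetLike.GradedMonoid ℬ] comm hD in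
theorem sequence_one {m : ℤ} (hm : 0 < m) {a : B} (ha : a ∈ ℬ m) {g : ℕ → B}
    (hg : IsDividedPowerSequence ℬ D m a g) : g 1 = a := by
  refine eq_of_forall_map_eq detect hm (by simpa using hg.mem 1) ha fun i => ?_
  have := hg.D_succ i 0
  rwa [hg.zero, mul_one] at this

/-- Differentiating `g_j g_k` lowers `j + k` by one in two ways; the two binomial coefficients add
up by Pascal's rule. -/
theorem sequence_mul {m : ℤ} (hm : 0 < m) (he : Even m) {a : B} (ha : a ∈ ℬ m) {g : ℕ → B}
    (hg : IsDividedPowerSequence ℬ D m a g) (j k : ℕ) :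
    g j * g k = (j + k).choose j • g (j + k) := by
  obtain ⟨N, hN⟩ : ∃ N, N = j + k := ⟨_, rfl⟩
  induction N generalizing j k with
  | zero =>
    obtain ⟨rfl, rfl⟩ : j = 0 ∧ k = 0 := by omega
    simp [hg.zero]
  | succ N ih =>
    match j, k, hN with
    | 0, k, _ => simp [hg.zero]
    | j + 1, 0, _ => simp [hg.zero]
    | j + 1, k + 1, hN =>
      have e : j + 1 + (k + 1) = j + k + 1 + 1 := by omega
      refine eq_of_forall_map_eq detect (m := ((j + 1 + (k + 1) : ℕ) : ℤ) * m)
        (mul_pos (by positivity) hm) ?_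
        (nsmul_mem (hg.mem _) _) fun i => ?_
      · have := SetLike.mul_mem_graded (hg.mem (j + 1)) (hg.mem (k + 1))
        rwa [← add_mul, ← Nat.cast_add] at this
      · have hc : Commute (g (j + 1)) (D i a) :=
          commute_of_even comm (he.mul_left _) (hg.mem (j + 1)) (hD.mem ha)
        have h1 := ih j (k + 1) (by omega)
        have h2 := ih (j + 1) k (by omega)
        rw [show j + (k + 1) = j + k + 1 by omega] at h1
        rw [show j + 1 + k = j + k + 1 by omega] at h2
        rw [hD.leibniz_even (he.mul_left _) (hg.mem _), hg.D_succ, hg.D_succ, ← mul_assoc, hc.eq,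
          mul_assoc, mul_assoc, h1, h2, e, map_nsmul, hg.D_succ,
          Nat.choose_succ_succ' (j + k + 1), add_smul, mul_smul_comm, mul_smul_comm]

/-- The product formula for `g_{j-1} g_{kj}` contributes a binomial coefficient, which is the factor
in the recursion of `Nat.uniformBell` in `k`. -/
theorem sequence_comp {m : ℤ} (hm : 0 < m) (he : Even m) {a : B} (ha : a ∈ ℬ m) {g : ℕ → B}
    (hg : IsDividedPowerSequence ℬ D m a g) {j : ℕ} (hj : 1 ≤ j) :
    IsDividedPowerSequence ℬ D (j * m) (g j) (fun k => Nat.uniformBell k j • g (k * j)) where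
  zero := by simp [hg.zero, Nat.uniformBell_zero_left]
  mem k := by
    have := hg.mem (k * j)
    rw [Nat.cast_mul, mul_assoc] at this
    exact nsmul_mem this _
  D_succ i k := by
    obtain ⟨j, rfl⟩ : ∃ l, j = l + 1 := ⟨j - 1, by omega⟩
    have e : (k + 1) * (j + 1) = j + k * (j + 1) + 1 := by ring
    rw [e, map_nsmul, hg.D_succ, hg.D_succ, mul_smul_comm, mul_assoc,
      hD.sequence_mul comm detect hm he ha hg, Nat.uniformBell_succ_left, mul_comm, mul_smul,
      mul_smul_comm, Nat.add_sub_cancel, ← add_assoc, Nat.add_sub_cancel,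
      add_comm (k * (j + 1)) j]

/-- Divided powers are detected by derivations. -/
theorem isDividedPowerSystem (two : IsUnit (2 : R)) {γ : ℕ → B → B}
    (hγ : ∀ ⦃m : ℤ⦄ ⦃a : B⦄, 0 < m → Even m → a ∈ ℬ m →
      IsDividedPowerSequence ℬ D m a fun k => γ k a) : IsDividedPowerSystem ℬ γ where
  mem n a k hn he ha := (hγ hn he ha).mem k
  zero n a hn he ha := (hγ hn he ha).zero
  one n a hn he ha := sequence_one detect hn ha (hγ hn he ha)
  add n a b k hn he ha hb := sequence_unique detect hn (hγ hn he (add_mem ha hb))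
    (hD.sequence_add comm he (hγ hn he ha) (hγ hn he hb)) k
  mul n a j k hn he ha := hD.sequence_mul comm detect hn he ha (hγ hn he ha) j k
  even_mul m n a b k hm hem hn hen ha hb := by
    refine sequence_unique detect (add_pos_of_nonneg_of_pos hm hn)
      (hγ (add_pos_of_nonneg_of_pos hm hn) (hem.add hen) (SetLike.mul_mem_graded ha hb))
      (hD.sequence_even_mul comm hem ha hb (hγ hn hen hb) fun k => ?_) k
    have h1 := sequence_one detect hn hb (hγ hn hen hb)
    have := hD.sequence_mul comm detect hn hen hb (hγ hn hen hb) 1 k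
    simp only [h1] at this
    rw [this, add_comm 1 k, Nat.choose_one_right]
  odd_mul m n a b k hk hm hom hn hon ha hb := by
    have := sequence_unique detect (add_pos hm hn)
      (hγ (add_pos hm hn) (hom.add_odd hon) (SetLike.mul_mem_graded ha hb))
      (hD.sequence_odd_mul comm two hom hon ha hb) k
    rw [this, if_neg (by omega), if_neg (by omega)]
  comp n a j k hj hn he ha := by
    have hjn : 0 < (j : ℤ) * n := mul_pos (by exact_mod_cast hj) hn
    exact sequence_unique detect hjn
      (hγ hjn (he.mul_left _) ((hγ hn he ha).mem j))
      (hD.sequence_comp comm detect hn he ha (hγ hn he ha) hj) k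

end IsDerivationFamily

end DerivationCriterion

/-! ### Induction in the enveloping algebra. -/

section EnvInduction

variable {R : Type*} [CommRing R] {L : DGLieAlgebra R}

namespace DGLieAlgebra.Env

@[elab_as_elim]
theorem induction_left {P : L.Env → Prop} (one : P 1)
    (ι_mul : ∀ (i : ℤ) (x : L.carrier), x ∈ L.deg i → ∀ u, P u → P (ι L x * u))
    (add : ∀ u w, P u → P w → P (u + w)) (smul : ∀ (r : R) u, P u → P (r • u)) (u : L.Env) :
    P u := by
  have h0 : P 0 := by simpa using smul 0 1 one
  refine homogeneous_induction (piece L) u (fun n u hu => ?_) add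
  induction hu using Submodule.span_induction with
  | mem u h =>
    obtain ⟨l, hl, rfl⟩ := h
    clear hl
    induction l with
    | nil => simpa using one
    | cons x l ih =>
      simp only [List.map_cons, List.prod_cons]
      exact ι_mul _ _ x.2.2 _ ih
  | zero => exact h0
  | add u w _ _ hu hw => exact add u w hu hw
  | smul r u _ hu => exact smul r u hu

theorem counit_ι (x : L.carrier) : counit L (ι L x) = 0 := by
  simp [counit]

theorem comul_ι (x : L.carrier) : comul L (ι L x) = ι L x ⊗ₜ 1 + 1 ⊗ₜ ι L x := by
  have : comulAlgHom L (ι L x) = comulι L x := lift_ι L _ _ x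
  rw [comul, LinearMap.comp_apply, AlgHom.toLinearMap_apply, this]
  rfl

end DGLieAlgebra.Env

end EnvInduction

/-! ### Homogeneous functionals separate and represent elements. -/

section Dual

variable {R : Type*} [CommRing R] {A : Type*} [Ring A] [Algebra R A]
variable {𝒜 : ℤ → Submodule R A} [GradedAlgebra 𝒜]

theorem comp_proj_mem_dualPiece (φ : Module.Dual R A) (n : ℤ) :
    φ ∘ₗ GradedAlgebra.proj 𝒜 n ∈ dualPiece 𝒜 n := by
  intro m hm a ha
  rw [LinearMap.comp_apply, GradedAlgebra.proj_apply, DirectSum.decompose_of_mem_ne 𝒜 ha hm,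
    map_zero]

theorem comp_proj_apply (φ : Module.Dual R A) {n : ℤ} {a : A} (ha : a ∈ 𝒜 n) :
    (φ ∘ₗ GradedAlgebra.proj 𝒜 n) a = φ a := by
  rw [LinearMap.comp_apply, GradedAlgebra.proj_apply, DirectSum.decompose_of_mem_same 𝒜 ha]

omit [GradedAlgebra 𝒜] in
theorem dualPiece_le_gradedDual (n : ℤ) : dualPiece 𝒜 n ≤ gradedDual 𝒜 :=
  le_iSup (dualPiece 𝒜) n

theorem comp_proj_of_mem {φ : Module.Dual R A} {n : ℤ} (hφ : φ ∈ dualPiece 𝒜 n) :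
    φ ∘ₗ GradedAlgebra.proj 𝒜 n = φ := by
  refine linearMap_ext_homogeneous 𝒜 fun m a ha => ?_
  by_cases h : m = n
  · subst h; exact comp_proj_apply φ ha
  · rw [comp_proj_mem_dualPiece φ n m h a ha, hφ m h a ha]

theorem eq_zero_of_forall_dualPiece [Module.Free R A] {a : A}
    (h : ∀ n, ∀ φ ∈ dualPiece 𝒜 n, φ a = 0) : a = 0 := by
  refine (Module.forall_dual_apply_eq_zero_iff R a).1 fun φ => ?_
  classical
  rw [← DirectSum.sum_support_decompose 𝒜 a, map_sum]
  refine Finset.sum_eq_zero fun n _ => ?_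
  exact h n _ (comp_proj_mem_dualPiece φ n)

/-- Over a principal ideal domain the piece `𝒜 N` is again free, and it is finite, hence reflexive.
-/
theorem exists_eq_of_functional [IsDomain R] [IsPrincipalIdealRing R] [Module.Free R A] (N : ℤ)
    [Module.Finite R (𝒜 N)] (G : dualPiece 𝒜 N →ₗ[R] R) :
    ∃ g ∈ 𝒜 N, ∀ ψ : dualPiece 𝒜 N, (ψ : Module.Dual R A) g = G ψ := by
  have : Module.Free R (𝒜 N) := inferInstance
  let p : A →ₗ[R] 𝒜 N := (DirectSum.component R ℤ (fun n => 𝒜 n) N) ∘ₗ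
    (DirectSum.decomposeLinearEquiv 𝒜).toLinearMap
  have hp : ∀ a : A, (p a : A) = GradedAlgebra.proj 𝒜 N a := fun a => rfl
  let E : Module.Dual R (𝒜 N) →ₗ[R] dualPiece 𝒜 N :=
    { toFun := fun ψ => ⟨ψ ∘ₗ p, fun m hm a ha => by
        have : p a = 0 := by
          apply Subtype.ext
          rw [hp, GradedAlgebra.proj_apply, DirectSum.decompose_of_mem_ne 𝒜 ha hm]; rfl
        rw [LinearMap.comp_apply, this, map_zero]⟩
      map_add' := fun _ _ => rfl
      map_smul' := fun _ _ => rfl }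
  let g := (Module.evalEquiv R (𝒜 N)).symm (G ∘ₗ E)
  refine ⟨g, g.2, fun ψ => ?_⟩
  have h1 : Module.evalEquiv R (𝒜 N) g = G ∘ₗ E := LinearEquiv.apply_symm_apply _ _
  have h2 := LinearMap.congr_fun h1 ((ψ : Module.Dual R A) ∘ₗ (𝒜 N).subtype)
  have h3 : E ((ψ : Module.Dual R A) ∘ₗ (𝒜 N).subtype) = ψ :=
    Subtype.ext (comp_proj_of_mem ψ.2)
  rw [LinearMap.comp_apply, h3] at h2
  exact h2

end Dual

/-! ### The action of `UL` on `A`, and the vanishing of first cohomology. -/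

namespace IsoToDual

variable {R : Type*} [CommRing R] {A : Type*} [Ring A] [Algebra R A] [Coalgebra R A]
variable {𝒜 : ℤ → Submodule R A} [GradedAlgebra 𝒜] {d : A →ₗ[R] A}
variable {L : DGLieAlgebra R}
open DGLieAlgebra.Env DGLieAlgebra
variable (e : IsoToDual 𝒜 d (piece L) (comul L) (counit L).toLinearMap (del L))

/-- The functional on `A` that corresponds to an element of `UL`. -/
noncomputable def functional : L.Env →ₗ[R] Module.Dual R A :=
  (gradedDual 𝒜).subtype ∘ₗ e.equiv.toLinearMap

theorem functional_mem {n : ℤ} {u : L.Env} (hu : u ∈ piece L n) :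
    e.functional u ∈ dualPiece 𝒜 n := (e.mem_iff n u).1 hu

theorem exists_functional_eq {n : ℤ} {φ : Module.Dual R A} (hφ : φ ∈ dualPiece 𝒜 n) :
    ∃ u ∈ piece L n, e.functional u = φ := by
  refine ⟨e.equiv.symm ⟨φ, dualPiece_le_gradedDual n hφ⟩, ?_, by simp [functional]⟩
  rw [e.mem_iff]
  simpa using hφ

theorem functional_one : e.functional 1 = Coalgebra.counit := e.map_one

theorem functional_mul (u w : L.Env) :
    e.functional (u * w) = e.functional u ∘ₗ contract 𝒜 (e.functional w) := by
  ext a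
  have := LinearMap.congr_fun (e.map_mul u w) a
  rw [dualMul_apply] at this
  exact this

/-- Transpose `Δ x = x ⊗ 1 + 1 ⊗ x`, the unit of the dual being the augmentation. -/
theorem isPrimitiveFunctional (hopf : IsDGHopfAlgebra 𝒜 d) (x : L.carrier) :
    IsPrimitiveFunctional R (e.functional (ι L x)) := by
  intro a b
  have h := e.map_comul (ι L x) a b
  have h1 : (e.equiv 1 : Module.Dual R A) = Coalgebra.counit := e.map_one
  have add : ∀ s t, dualTensor 𝒜 (s + t) = dualTensor 𝒜 s + dualTensor 𝒜 t := by
    intro s t; simp only [dualTensor, map_add, LinearMap.add_comp]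
  rw [comul_ι, map_add, add, TensorProduct.map_tmul, TensorProduct.map_tmul, LinearMap.add_apply,
    dualTensor_tmul_apply, dualTensor_tmul_apply] at h
  simp only [LinearEquiv.coe_coe, h1, hopf.slice_counit_tmul, hopf.counit_slice] at h
  change e.functional (ι L x) _ + e.functional (ι L x) _ = e.functional (ι L x) _ at h
  rw [← h]
  simp [mul_comm]

theorem contract_functional_mul (hopf : IsDGHopfAlgebra 𝒜 d) (u w : L.Env) :
    contract 𝒜 (e.functional (u * w)) =
      contract 𝒜 (e.functional u) * contract 𝒜 (e.functional w) := by
  refine homogeneous_induction (piece L) u (fun n u hu => ?_) fun u u' hu hu' => ?_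
  · refine homogeneous_induction (piece L) w (fun m w hw => ?_) fun w w' hw hw' => ?_
    · rw [functional_mul, hopf.contract_comp (e.functional_mem hu) (e.functional_mem hw)]
    · simp only [mul_add, map_add, hw, hw']
  · simp only [add_mul, map_add, hu, hu']

/-- The action of `UL` on `A`. -/
noncomputable def action (hopf : IsDGHopfAlgebra 𝒜 d) : L.Env →ₐ[R] Module.End R A :=
  AlgHom.ofLinearMap (contract 𝒜 ∘ₗ e.functional)
    (by rw [LinearMap.comp_apply, functional_one, hopf.contract_counit])
    (e.contract_functional_mul hopf)

variable (hopf : IsDGHopfAlgebra 𝒜 d)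

theorem action_apply (u : L.Env) : e.action hopf u = contract 𝒜 (e.functional u) := rfl

theorem counit_action (u : L.Env) (a : A) :
    Coalgebra.counit (R := R) (e.action hopf u a) = e.functional u a :=
  hopf.counit_contract _ _

theorem action_mem {n m : ℤ} {u : L.Env} (hu : u ∈ piece L n) {a : A} (ha : a ∈ 𝒜 m) :
    e.action hopf u a ∈ 𝒜 (m - n) :=
  hopf.contract_mem (e.functional_mem hu) ha

theorem eq_zero_of_functional [Module.Free R A] {a : A} (h : ∀ u, e.functional u a = 0) :
    a = 0 :=
  eq_zero_of_forall_dualPiece (𝒜 := 𝒜) fun n φ hφ => by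
    obtain ⟨u, _, rfl⟩ := e.exists_functional_eq hφ
    exact h u

include hopf

/-- If `L` kills `a`, then `UL` acts on `a` through its augmentation, so each functional takes on
`a` a multiple of the value `ε(a) = 0`. -/
theorem eq_zero_of_action [Module.Free R A] {a : A} (ha : Coalgebra.counit (R := R) a = 0)
    (h : ∀ i, ∀ x ∈ L.deg i, e.action hopf (ι L x) a = 0) : a = 0 := by
  refine e.eq_zero_of_functional fun u => ?_
  have key : e.action hopf u a = counit L u • a := by
    induction u using induction_left with
    | one => simp
    | ι_mul i x hx u hu => simp [hu, counit_ι, h i x hx]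
    | add u w hu hw => simp [hu, hw, add_smul]
    | smul r u hu => simp [hu, mul_smul]
  rw [← e.counit_action hopf, key, map_smul, ha, smul_zero]

theorem isDerivationFamily : IsDerivationFamily 𝒜 (fun x : Σ i : ℤ, L.deg i => x.1)
    (fun x => e.action hopf (ι L (x.2 : L.carrier))) where
  mem x _ _ ha := e.action_mem hopf (ι_mem L x.2.2) ha
  leibniz x _ _ b ha := hopf.contract_mul (e.functional_mem (ι_mem L x.2.2))
    (e.isPrimitiveFunctional hopf _) ha b

theorem detect [Module.Free R A] ⦃m : ℤ⦄ ⦃a : A⦄ (hm : 0 < m) (ha : a ∈ 𝒜 m)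
    (h : ∀ x : Σ i : ℤ, L.deg i, e.action hopf (ι L (x.2 : L.carrier)) a = 0) : a = 0 :=
  e.eq_zero_of_action hopf (hopf.counit_of_mem hm.ne' ha) fun i x hx => h ⟨i, x, hx⟩

/-- One-cocycles of `L` with values in `A` are coboundaries. -/
theorem exists_action_eq [IsDomain R] [IsPrincipalIdealRing R] [Module.Free R A] {N : ℤ}
    [Module.Finite R (𝒜 N)] (h : L.carrier →ₗ[R] A)
    (h_mem : ∀ i, ∀ x ∈ L.deg i, h x ∈ 𝒜 (N - i))
    (cocycle : ∀ i j x y, x ∈ L.deg i → y ∈ L.deg j → e.action hopf (ι L x) (h y) =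
      h (L.bracket x y) + sgn R (i * j) • e.action hopf (ι L y) (h x)) :
    ∃ g ∈ 𝒜 N, Coalgebra.counit (R := R) g = 0 ∧
      ∀ i, ∀ x ∈ L.deg i, e.action hopf (ι L x) g = h x := by
  -- The cocycle defines an extension of `R` by the `L`-module `A`, on `A × R`; the cocycle
  -- condition says exactly that `f` respects brackets, so `UL` acts there too.
  let f : L.carrier →ₗ[R] Module.End R (A × R) :=
    { toFun := fun x => LinearMap.inl R A R ∘ₗ
        LinearMap.coprod (e.action hopf (ι L x)) (LinearMap.toSpanSingleton R A (h x))
      map_add' := fun x y => by ext <;> simp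
      map_smul' := fun r x => by ext <;> simp }
  have hf : ∀ x (a : A) (r : R), f x (a, r) = (e.action hopf (ι L x) a + r • h x, 0) := by
    intro x a r; simp [f]
  have rel : ∀ ⦃i j : ℤ⦄ ⦃x y : L.carrier⦄, x ∈ L.deg i → y ∈ L.deg j → f x * f y =
      f (L.bracket x y) + (((i * j).negOnePow : ℤ) : R) • (f y * f x) := by
    intro i j x y hx hy
    have h1 := ι_mul_ι L hx hy
    rw [negOnePow_smul_eq (R := R)] at h1
    have h2 := congrArg (e.action hopf) h1
    rw [map_add, map_smul, _root_.map_mul, _root_.map_mul] at h2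
    refine LinearMap.ext fun ⟨a, r⟩ => ?_
    have h3 := LinearMap.congr_fun h2 a
    simp only [LinearMap.add_apply, LinearMap.smul_apply, Module.End.mul_apply] at h3
    change f x (f y (a, r)) = f (L.bracket x y) (a, r) + sgn R (i * j) • f y (f x (a, r))
    simp only [hf, map_add, map_smul, h3, cocycle i j x y hx hy, zero_smul, add_zero,
      Prod.smul_mk, Prod.mk_add_mk, smul_zero, Prod.mk.injEq, and_true, smul_add]
    rw [smul_comm r (sgn R (i * j))]
    abel
  let W := lift f rel
  have hW : ∀ u (a : A), W u (a, 0) = (e.action hopf u a, 0) := by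
    intro u
    induction u using induction_left with
    | one => simp
    | ι_mul i x hx u hu =>
      intro a
      rw [_root_.map_mul, Module.End.mul_apply, hu, lift_ι, hf]
      simp
    | add u w hu hw => intro a; simp [hu, hw]
    | smul r u hu => intro a; simp [hu]
  -- `G u` is the augmentation of the `A`-component of `u (0, 1)`. In degree `N` it is evaluation at
  -- some `g`, and `G (u x) = ⟨u, h x⟩` forces `x g = h x`.
  let G : L.Env →ₗ[R] R := Coalgebra.counit ∘ₗ LinearMap.fst R A R ∘ₗ
    LinearMap.applyₗ ((0, 1) : A × R) ∘ₗ W.toLinearMap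
  have hG : ∀ u x, G (u * ι L x) = e.functional u (h x) := by
    intro u x
    simp only [G, LinearMap.comp_apply, AlgHom.toLinearMap_apply, LinearMap.applyₗ_apply_apply,
      _root_.map_mul, Module.End.mul_apply]
    rw [show W (ι L x) (0, 1) = (h x, 0) by simp [W, hf], hW, ← e.counit_action hopf]
    rfl
  have hG1 : G 1 = 0 := by simp [G]
  obtain ⟨g, hg, hgG⟩ := exists_eq_of_functional (𝒜 := 𝒜) N
    (G ∘ₗ e.equiv.symm.toLinearMap ∘ₗ Submodule.inclusion (dualPiece_le_gradedDual N))
  have hgG' : ∀ u ∈ piece L N, e.functional u g = G u := by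
    intro u hu
    rw [hgG ⟨_, e.functional_mem hu⟩]
    simp only [LinearMap.comp_apply]
    congr 1
    exact e.equiv.symm_apply_apply u
  refine ⟨g, hg, ?_, fun i x hx => ?_⟩
  · by_cases hN : N = 0
    · subst hN
      rw [← e.functional_one, hgG' 1 SetLike.GradedOne.one_mem, hG1]
    · exact hopf.counit_of_mem hN hg
  · rw [← sub_eq_zero]
    refine e.eq_zero_of_functional fun u => ?_
    rw [map_sub, sub_eq_zero]
    refine homogeneous_induction (piece L) u (fun m u hu => ?_) fun u w hu hw => ?_
    · have h1 : e.functional u (e.action hopf (ι L x) g) = e.functional (u * ι L x) g := by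
        rw [e.functional_mul]; rfl
      have h2 := SetLike.mul_mem_graded hu (ι_mem L hx)
      rw [h1]
      by_cases hm : m + i = N
      · rw [hgG' _ (hm ▸ h2), hG]
      -- Away from total degree `N` both sides vanish for degree reasons.
      · rw [e.functional_mem h2 N (Ne.symm hm) g hg,
          e.functional_mem hu (N - i) (fun h => hm (by omega)) _ (h_mem i x hx)]
    · rw [map_add, LinearMap.add_apply, hu, hw, LinearMap.add_apply]

end IsoToDual

/-! ### From sequences to a system of divided powers. -/

section ChoiceOfSequences

variable {R : Type*} [CommRing R] {B : Type*} [Ring B] [Algebra R B]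
variable {ℬ : ℤ → Submodule R B} {ι : Type*} {D : ι → B →ₗ[R] B}

theorem isDividedPowerSequence_zero [SetLike.GradedMonoid ℬ] (m : ℤ) :
    IsDividedPowerSequence ℬ D m 0 (fun k => if k = 0 then 1 else 0) where
  zero := by simp
  mem k := by
    split_ifs with h
    · simpa [h] using SetLike.GradedOne.one_mem (A := ℬ)
    · exact zero_mem _
  D_succ i k := by simp

/-- The function `γ` must not depend on the degree. A non-zero element has only one degree, and for
zero the sequence `1, 0, 0, …` serves in every degree. -/
theorem exists_dividedPowers [SetLike.GradedMonoid ℬ]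
    (disj : ∀ ⦃m n : ℤ⦄ ⦃a : B⦄, m ≠ n → a ∈ ℬ m → a ∈ ℬ n → a = 0)
    (h : ∀ ⦃m : ℤ⦄ ⦃a : B⦄, 0 < m → Even m → a ∈ ℬ m → ∃ g, IsDividedPowerSequence ℬ D m a g) :
    ∃ γ : ℕ → B → B, ∀ ⦃m : ℤ⦄ ⦃a : B⦄, 0 < m → Even m → a ∈ ℬ m →
      IsDividedPowerSequence ℬ D m a fun k => γ k a := by
  classical
  have h' : ∀ a : B, ∃ g : ℕ → B, ∀ ⦃m : ℤ⦄, 0 < m → Even m → a ∈ ℬ m →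
      IsDividedPowerSequence ℬ D m a g := by
    intro a
    by_cases ha : a = 0
    · subst ha
      exact ⟨_, fun m _ _ _ => isDividedPowerSequence_zero m⟩
    · by_cases hm : ∃ m : ℤ, 0 < m ∧ Even m ∧ a ∈ ℬ m
      · obtain ⟨m, hm, he, hma⟩ := hm
        obtain ⟨g, hg⟩ := h hm he hma
        refine ⟨g, fun n _ _ hna => ?_⟩
        by_cases hmn : m = n
        · exact hmn ▸ hg
        · exact absurd (disj hmn hma hna) ha
      · push Not at hm
        exact ⟨fun _ => 0, fun m hm0 he hma => absurd hma (hm m hm0 he)⟩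
  choose g hg using h'
  exact ⟨fun k a => g a k, fun m a hm he ha => hg a hm he ha⟩

end ChoiceOfSequences

theorem eq_zero_of_mem_of_mem {R : Type*} [CommRing R] {M : Type*} [AddCommGroup M] [Module R M]
    {ℳ : ℤ → Submodule R M} [DirectSum.Decomposition ℳ] ⦃m n : ℤ⦄ ⦃a : M⦄ (hmn : m ≠ n)
    (hm : a ∈ ℳ m) (hn : a ∈ ℳ n) : a = 0 := by
  rw [← DirectSum.decompose_of_mem_same ℳ hm, DirectSum.decompose_of_mem_ne ℳ hn hmn.symm]

/-! ### Existence of divided powers, connectedness, and the differential. -/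

namespace IsoToDual

variable {R : Type*} [CommRing R] [IsDomain R] [IsPrincipalIdealRing R]
variable {A : Type*} [Ring A] [Algebra R A] [Coalgebra R A]
variable {𝒜 : ℤ → Submodule R A} [GradedAlgebra 𝒜] {d : A →ₗ[R] A}
variable {L : DGLieAlgebra R}
open DGLieAlgebra.Env DGLieAlgebra
variable (e : IsoToDual 𝒜 d (piece L) (comul L) (counit L).toLinearMap (del L))
variable (hopf : IsDGHopfAlgebra 𝒜 d)
variable (comm : ∀ ⦃i j : ℤ⦄ ⦃a b : A⦄, a ∈ 𝒜 i → b ∈ 𝒜 j → a * b = sgn R (i * j) • (b * a))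
variable [Module.Free R A]

include comm in
-- `x ↦ (x f) G` is a cocycle: the terms with a second derivative of `f` give the bracket, and the
-- remaining ones, `(x f)(y f) G'`, cancel by graded commutativity because `N` is even.
theorem exists_next {N M : ℤ} [Module.Finite R (𝒜 (M + N))] (hN : Even N) {f G G' : A}
    (hf : f ∈ 𝒜 N) (hG : G ∈ 𝒜 M)
    (h : ∀ i, ∀ x ∈ L.deg i, e.action hopf (ι L x) G = e.action hopf (ι L x) f * G') :
    ∃ g ∈ 𝒜 (M + N), Coalgebra.counit (R := R) g = 0 ∧
      ∀ i, ∀ x ∈ L.deg i, e.action hopf (ι L x) g = e.action hopf (ι L x) f * G := by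
  refine e.exists_action_eq hopf (LinearMap.mulRight R G ∘ₗ LinearMap.applyₗ f ∘ₗ
    (e.action hopf).toLinearMap ∘ₗ ι L) ?_ ?_
  · intro i x hx
    have := SetLike.mul_mem_graded (e.action_mem hopf (ι_mem L hx) hf) hG
    rw [show M + N - i = N - i + M by ring]
    exact this
  · intro i j x y hx hy
    have hD := e.isDerivationFamily hopf
    have h1 := ι_mul_ι L hx hy
    rw [negOnePow_smul_eq (R := R)] at h1
    have h2 := LinearMap.congr_fun (congrArg (e.action hopf) h1) f
    simp only [map_add, map_smul, _root_.map_mul, Module.End.mul_apply, LinearMap.add_apply,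
      LinearMap.smul_apply] at h2
    simp only [LinearMap.comp_apply, LinearMap.applyₗ_apply_apply, AlgHom.toLinearMap_apply,
      LinearMap.mulRight_apply]
    have mx := e.action_mem hopf (ι_mem L hx) hf
    have my := e.action_mem hopf (ι_mem L hy) hf
    have h3 := hD.leibniz (i := ⟨i, x, hx⟩) G my
    have h4 := hD.leibniz (i := ⟨j, y, hy⟩) G mx
    simp only at h3 h4
    rw [h3, h4, h2, h i x hx, h j y hy, ← mul_assoc, ← mul_assoc, comm mx my]
    simp only [add_mul, smul_add, smul_mul_assoc, smul_smul, ← sgn_add]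
    rw [add_assoc]
    congr 2
    obtain ⟨n, rfl⟩ := hN
    congr 1
    apply sgn_congr (2 * i * n - i * j - 2 * n * n)
    ring

include comm in
-- No positivity of `N` is assumed: the case `N = 0` is what rules out non-trivial elements of
-- degree zero. The normalisation by `ε` replaces uniqueness there.
theorem exists_sequence (finite_type : ∀ n : ℤ, Module.Finite R (𝒜 n)) {N : ℤ} (hN : Even N)
    {f : A} (hf : f ∈ 𝒜 N) :
    ∃ g : ℕ → A, IsDividedPowerSequence 𝒜
      (fun x : Σ i : ℤ, L.deg i => e.action hopf (ι L (x.2 : L.carrier))) N f g ∧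
      ∀ k, Coalgebra.counit (R := R) (g (k + 1)) = 0 := by
  -- The invariant of the recursion is that the derivatives of the current term are those of `f`
  -- times some `G'`; it starts at `1` with `G' = 0`.
  let Q : ℕ → A → Prop := fun k G => G ∈ 𝒜 (k * N) ∧
    ∃ G', ∀ i, ∀ x ∈ L.deg i, e.action hopf (ι L x) G = e.action hopf (ι L x) f * G'
  have step : ∀ (k : ℕ) (G : {G // Q k G}), ∃ g : {G // Q (k + 1) G},
      Coalgebra.counit (R := R) g.1 = 0 ∧
      ∀ i, ∀ x ∈ L.deg i, e.action hopf (ι L x) g.1 = e.action hopf (ι L x) f * G.1 := by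
    rintro k ⟨G, hG, G', hG'⟩
    obtain ⟨g, hg, hg0, hg'⟩ := e.exists_next hopf comm hN hf hG hG'
    refine ⟨⟨g, ?_, G, hg'⟩, hg0, hg'⟩
    rw [Nat.cast_succ, add_mul, one_mul]
    exact hg
  choose F hF0 hF using step
  let s : (k : ℕ) → {G // Q k G} := fun k => Nat.rec (motive := fun k => {G // Q k G})
    ⟨1, by simpa using SetLike.GradedOne.one_mem (A := 𝒜), 0, fun i x hx => by
      rw [mul_zero]
      exact (e.isDerivationFamily hopf).map_one ⟨i, x, hx⟩⟩ (fun k p => F k p) k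
  exact ⟨fun k => (s k).1, ⟨rfl, fun k => (s k).2.1, fun x k => hF k (s k) x.1 _ x.2.2⟩,
    fun k => hF0 k (s k)⟩

include comm hopf in
-- If `x` pairs to `r ≠ 0` with some `f` of degree zero, then `ε(x^j g_k)` is `0` for `j < k` and
-- `r^j` for `j = k`. The `g_k` are then linearly independent in the finitely generated module `𝒜
-- 0`.
theorem functional_eq_zero_of_deg_zero (finite_type : ∀ n : ℤ, Module.Finite R (𝒜 n))
    {x : L.carrier} (hx : x ∈ L.deg 0) : e.functional (ι L x) = 0 := by
  by_contra hne
  have hφ := e.functional_mem (ι_mem L hx)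
  have prim := e.isPrimitiveFunctional hopf x
  obtain ⟨f, hf, hf0, hfr⟩ : ∃ f ∈ 𝒜 0, Coalgebra.counit (R := R) f = 0 ∧
      e.functional (ι L x) f ≠ 0 := by
    by_contra hcon
    push Not at hcon
    refine hne (linearMap_ext_homogeneous 𝒜 fun n a ha => ?_)
    by_cases hn : n = 0
    · subst hn
      -- Removing the augmentation does not change the value of a primitive functional, which
      -- vanishes on scalars.
      have := hcon (a - algebraMap R A (Coalgebra.counit (R := R) a))
        (sub_mem ha (SetLike.algebraMap_mem_graded 𝒜 _))
        (by rw [map_sub, hopf.counit_algebraMap, sub_self])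
      rwa [map_sub, prim.map_algebraMap hopf, sub_zero] at this
    · exact hφ n hn a ha
  obtain ⟨g, hg, hg0⟩ := e.exists_sequence hopf comm finite_type Even.zero hf
  have hD := e.isDerivationFamily hopf
  set D := e.action hopf (ι L x) with hDx
  have hDf : Coalgebra.counit (R := R) (D f) = e.functional (ι L x) f := e.counit_action hopf _ _
  have hgm : ∀ k, g k ∈ 𝒜 0 := fun k => by simpa using hg.mem k
  have hDm : ∀ b ∈ 𝒜 0, D b ∈ 𝒜 0 := fun b hb => by
    simpa using hD.mem (i := ⟨0, x, hx⟩) hb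
  have leib : ∀ b ∈ 𝒜 0, ∀ k, D (b * g (k + 1)) = D b * g (k + 1) + (b * D f) * g k := by
    intro b hb k
    have h1 := hD.leibniz_even (i := ⟨0, x, hx⟩) Even.zero hb (g (k + 1))
    have h2 := hg.D_succ ⟨0, x, hx⟩ k
    simp only [← hDx] at h1 h2
    rw [h1, h2, mul_assoc]
  -- The extra factor `b` is needed for the induction: one application of `D` turns `b g_{k+1}` into
  -- two terms of the same shape.
  have low : ∀ j k, j < k → ∀ b ∈ 𝒜 0,
      Coalgebra.counit (R := R) ((D ^ j) (b * g k)) = 0 := by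
    intro j
    induction j with
    | zero =>
      intro k hk b hb
      obtain ⟨k, rfl⟩ : ∃ l, k = l + 1 := ⟨k - 1, by omega⟩
      rw [pow_zero, Module.End.one_apply, hopf.counit_mul, hg0, mul_zero]
    | succ j ih =>
      intro k hk b hb
      obtain ⟨k, rfl⟩ : ∃ l, k = l + 1 := ⟨k - 1, by omega⟩
      rw [pow_succ, Module.End.mul_apply, leib b hb, map_add, map_add, ih _ (by omega) _ (hDm b hb),
        ih _ (by omega) _ (by simpa using SetLike.mul_mem_graded hb (hDm f hf)), add_zero]
  have diag : ∀ j, ∀ b ∈ 𝒜 0, Coalgebra.counit (R := R) ((D ^ j) (b * g j)) =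
      Coalgebra.counit (R := R) b * e.functional (ι L x) f ^ j := by
    intro j
    induction j with
    | zero => intro b hb; simp [hg.zero]
    | succ j ih =>
      intro b hb
      rw [pow_succ, Module.End.mul_apply, leib b hb, map_add, map_add, low j _ (by omega) _ (hDm b hb),
        ih _ (by simpa using SetLike.mul_mem_graded hb (hDm f hf)), hopf.counit_mul, hDf]
      ring
  have hli : LinearIndependent R (fun k : ℕ => (⟨g k, hgm k⟩ : 𝒜 0)) := by
    rw [linearIndependent_iff']
    intro s c hc k
    induction k using Nat.strong_induction_on with
    | _ k ih =>
      intro hk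
      have h1 : ∑ l ∈ s, c l • g l = 0 := by
        have := congrArg (Submodule.subtype (𝒜 0)) hc
        simpa using this
      have h2 := congrArg (fun a => Coalgebra.counit (R := R) ((D ^ k) a)) h1
      simp only [map_sum, map_smul, map_zero] at h2
      rw [Finset.sum_eq_single k] at h2
      · have := diag k 1 SetLike.GradedOne.one_mem
        rw [one_mul, hopf.counit_one, one_mul] at this
        rw [this, smul_eq_mul] at h2
        exact (mul_eq_zero.1 h2).resolve_right (pow_ne_zero _ hfr)
      · intro l hl hlk
        rcases lt_or_gt_of_ne hlk with h | h
        · rw [ih l h hl, zero_smul]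
        · have := low k l h 1 SetLike.GradedOne.one_mem
          rw [one_mul] at this
          rw [this, smul_zero]
      · exact fun h => absurd hk h
  have := hli.finite
  exact not_finite ℕ

include comm hopf in
-- A non-empty product of total degree at most zero contains a factor of degree at most zero, which
-- acts as zero.
theorem functional_of_nonpos (finite_type : ∀ n : ℤ, Module.Finite R (𝒜 n))
    {n : ℤ} (hn : n ≤ 0) {u : L.Env} (hu : u ∈ piece L n) :
    e.functional u = counit L u • Coalgebra.counit := by
  induction hu using Submodule.span_induction with
  | zero => simp
  | add u w _ _ hu hw => rw [map_add, map_add, hu, hw, add_smul]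
  | smul r u _ hu => rw [map_smul, map_smul, hu, smul_eq_mul, mul_smul]
  | mem u h =>
    obtain ⟨l, hl, rfl⟩ := h
    by_cases h : ∃ x ∈ l, x.1 ≤ 0
    · obtain ⟨x, hxl, hx⟩ := h
      have h0 : e.functional (ι L x.2) = 0 := by
        rcases hx.lt_or_eq with h | h
        · have := x.2.2
          simp only [L.deg_neg _ h, Submodule.mem_bot] at this
          rw [this, map_zero, map_zero]
        · exact e.functional_eq_zero_of_deg_zero hopf comm finite_type (h ▸ x.2.2)
      obtain ⟨l₁, l₂, rfl⟩ := List.append_of_mem hxl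
      have h1 : counit L (List.map (fun x => ι L (x.2 : L.carrier)) (l₁ ++ x :: l₂)).prod = 0 := by
        simp [counit_ι]
      have h2 : e.action hopf (List.map (fun x => ι L (x.2 : L.carrier)) (l₁ ++ x :: l₂)).prod
          = 0 := by
        simp only [List.map_append, List.map_cons, List.prod_append, List.prod_cons,
          _root_.map_mul]
        rw [e.action_apply hopf (ι L x.2), h0, map_zero, zero_mul, mul_zero]
      rw [h1, zero_smul]
      apply hopf.contract_injective
      rw [map_zero, ← h2, action_apply]
    · push Not at h
      cases l with
      | nil => simp [functional_one]
      | cons x l =>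
        exfalso
        have h3 : 0 ≤ (l.map Sigma.fst).sum := List.sum_nonneg fun y hy => by
          obtain ⟨z, hz, rfl⟩ := List.mem_map.1 hy
          exact (h z (List.mem_cons_of_mem _ hz)).le
        have h4 := h x List.mem_cons_self
        rw [List.map_cons, List.sum_cons] at hl
        omega

include e comm hopf in
-- In non-positive degrees every functional is a multiple of the augmentation, so an element there
-- with zero augmentation vanishes.
theorem isConnectedGraded (finite_type : ∀ n : ℤ, Module.Finite R (𝒜 n)) :
    IsConnectedGraded 𝒜 := by
  have key : ∀ n ≤ 0, ∀ a ∈ 𝒜 n, Coalgebra.counit (R := R) a = 0 → a = 0 := by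
    intro n hn a ha ha0
    refine eq_zero_of_forall_dualPiece (𝒜 := 𝒜) fun m φ hφ => ?_
    by_cases h : n = m
    · subst h
      obtain ⟨u, hu, rfl⟩ := e.exists_functional_eq hφ
      rw [e.functional_of_nonpos hopf comm finite_type hn hu, LinearMap.smul_apply, ha0, smul_zero]
    · exact hφ n h a ha
  refine ⟨fun n hn => ?_, fun a ha => ⟨Coalgebra.counit (R := R) a, ?_, ?_⟩⟩
  · rw [Submodule.eq_bot_iff]
    exact fun a ha => key n hn.le a ha (hopf.counit_of_mem hn.ne ha)
  · refine (sub_eq_zero.1 (key 0 le_rfl _ (sub_mem ha (SetLike.algebraMap_mem_graded 𝒜 _)) ?_)).symm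
    rw [map_sub, hopf.counit_algebraMap, sub_self]
  · rintro r rfl
    exact (hopf.counit_algebraMap r).symm

omit [IsDomain R] [IsPrincipalIdealRing R] [Module.Free R A] in
theorem functional_comp_d {i : ℤ} {x : L.carrier} (hx : x ∈ L.deg i) :
    e.functional (ι L x) ∘ₗ d = sgn R (i - 1) • e.functional (ι L (L.del x)) := by
  refine linearMap_ext_homogeneous 𝒜 fun n a ha => ?_
  have h := LinearMap.congr_fun (e.map_d (ι L x)) a
  rw [del_ι] at h
  have h1 : e.functional (ι L (L.del x)) a = e.functional (ι L x) (d (signInvolution 𝒜 a)) := h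
  rw [LinearMap.smul_apply, h1, signInvolution_apply 𝒜 ha, negOnePow_smul_eq (R := R), map_smul,
    map_smul, smul_smul, ← sgn_add]
  by_cases hn : n = i - 1
  · subst hn
    rw [sgn_add, sgn_mul_self, one_smul]; rfl
  · have h2 : e.functional (ι L (L.del x)) a = 0 :=
      e.functional_mem (ι_mem L (L.del_mem hx)) n hn a ha
    rw [h1, signInvolution_apply 𝒜 ha, negOnePow_smul_eq (R := R), map_smul, map_smul] at h2
    have h3 : e.functional (ι L x) (d a) = 0 := by
      rw [← one_smul R (e.functional _ _), ← sgn_mul_self (R := R) n, mul_smul, h2, smul_zero]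
    rw [LinearMap.comp_apply, h3, smul_zero]

omit [IsDomain R] [IsPrincipalIdealRing R] in
include comm in
-- Both sides have the same image under each `x`. Commuting `x` past `d` gives `± d x` and `± ∂x`;
-- the first is treated by induction on `k`, the second by the defining equation for `∂x`.
theorem d_dividedPower {m : ℤ} (hm : 0 < m) (he : Even m) {a : A} (ha : a ∈ 𝒜 m) {g : ℕ → A}
    (hg : IsDividedPowerSequence 𝒜
      (fun x : Σ i : ℤ, L.deg i => e.action hopf (ι L (x.2 : L.carrier))) m a g) (k : ℕ) :
    d (g (k + 1)) = d a * g k := by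
  have hD := e.isDerivationFamily hopf
  have md : ∀ k : ℕ, d (g k) ∈ 𝒜 (k * m + 1) := fun k => hopf.d_mem (hg.mem k)
  have act_d : ∀ i x, x ∈ L.deg i → ∀ b : A, e.action hopf (ι L x) (d b) =
      sgn R i • d (e.action hopf (ι L x) b) +
        sgn R (i - 1) • e.action hopf (ι L (L.del x)) b := by
    intro i x hx b
    rw [action_apply, hopf.contract_d (e.functional_mem (ι_mem L hx)), e.functional_comp_d hx,
      map_smul]
    rfl
  have d1 : d 1 = 0 := by
    have := hopf.d_mul (SetLike.GradedOne.one_mem (A := 𝒜)) 1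
    simpa using this
  induction k with
  | zero =>
    have := IsDerivationFamily.sequence_one (e.detect hopf) hm ha hg
    rw [zero_add, this, hg.zero, mul_one]
  | succ k ih =>
    have hmul := SetLike.mul_mem_graded (hopf.d_mem ha) (hg.mem (k + 1))
    refine eq_of_forall_map_eq (e.detect hopf) (m := (k + 1 + 1 : ℕ) * m + 1) (by positivity)
      (md _) ?_ fun x => ?_
    · rw [show ((k + 1 + 1 : ℕ) : ℤ) * m + 1 = m + 1 + (k + 1 : ℕ) * m by push_cast; ring]
      exact hmul
    · obtain ⟨i, x, hx⟩ := x
      have ax : e.action hopf (ι L x) a ∈ 𝒜 (m - i) := hD.mem (i := ⟨i, x, hx⟩) ha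
      have h1 := hg.D_succ ⟨i, x, hx⟩ (k + 1)
      have h1' := hg.D_succ ⟨i, x, hx⟩ k
      have h2 := hg.D_succ ⟨i - 1, L.del x, L.del_mem hx⟩ (k + 1)
      have h3 := hD.leibniz (i := ⟨i, x, hx⟩) (g (k + 1)) (hopf.d_mem ha)
      simp only at h1 h1' h2 h3
      have h4 := hopf.d_mul ax (g (k + 1))
      rw [negOnePow_smul_eq (R := R), ih] at h4
      simp only
      rw [h3, act_d i x hx, act_d i x hx, h1, h2, h4, h1', ← mul_assoc, ← mul_assoc,
        comm ax (hopf.d_mem ha)]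
      simp only [smul_add, add_mul, smul_mul_assoc, smul_smul, ← sgn_add]
      -- After `x a` and `d a` are interchanged, this is the one sign left to compare; it uses that
      -- `m` is even.
      have e1 : sgn R (i + (m - i + (m - i) * (m + 1))) = sgn R (i * (m + 1)) := by
        obtain ⟨n, rfl⟩ := he
        apply sgn_congr (2 * n * n - 2 * i * n - i + 2 * n)
        ring
      rw [e1]
      abel

end IsoToDual

/-! ### Derivations and divided powers on the tensor square. -/

section TensorSquare

variable {R : Type*} [CommRing R] {A : Type*} [Ring A] [Algebra R A]
variable {𝒜 : ℤ → Submodule R A} [GradedAlgebra 𝒜]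

theorem of_mem_gradedTensorPiece {n : ℤ} {t : A ⊗[R] A} (ht : t ∈ tensorPiece 𝒜 n) :
    GradedTensorProduct.of R 𝒜 𝒜 t ∈ gradedTensorPiece 𝒜 n :=
  Submodule.mem_map_of_mem ht

theorem of_tmul_mem {i j : ℤ} {a b : A} (ha : a ∈ 𝒜 i) (hb : b ∈ 𝒜 j) :
    GradedTensorProduct.of R 𝒜 𝒜 (a ⊗ₜ b) ∈ gradedTensorPiece 𝒜 (i + j) :=
  of_mem_gradedTensorPiece (tmul_mem_tensorPiece 𝒜 ha hb)

/-- Homogeneous elements of the tensor square are sums of tensors of homogeneous elements. -/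
@[elab_as_elim]
theorem gradedTensorPiece_induction {n : ℤ}
    {P : (t : 𝒜 ᵍ⊗[R] 𝒜) → t ∈ gradedTensorPiece 𝒜 n → Prop}
    (tmul : ∀ (i j : ℤ) (hij : i + j = n) (a : A) (ha : a ∈ 𝒜 i) (b : A) (hb : b ∈ 𝒜 j),
      P (GradedTensorProduct.of R 𝒜 𝒜 (a ⊗ₜ b)) (hij ▸ of_tmul_mem ha hb))
    (add : ∀ s t hs ht, P s hs → P t ht → P (s + t) (add_mem hs ht)) {t : 𝒜 ᵍ⊗[R] 𝒜}
    (ht : t ∈ gradedTensorPiece 𝒜 n) : P t ht := by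
  have key : ∀ (s : A ⊗[R] A) (hs : s ∈ tensorPiece 𝒜 n),
      P (GradedTensorProduct.of R 𝒜 𝒜 s) (of_mem_gradedTensorPiece hs) := by
    intro s hs
    induction hs using tensorPiece_induction 𝒜 with
    | tmul i j hij a ha b hb => exact tmul i j hij a ha b hb
    | add s t hs ht h h' => exact add _ _ _ _ h h'
  obtain ⟨s, hs, rfl⟩ := ht
  exact key s hs

instance : SetLike.GradedMonoid (gradedTensorPiece 𝒜) where
  one_mem := by
    have := of_tmul_mem (𝒜 := 𝒜) SetLike.GradedOne.one_mem SetLike.GradedOne.one_mem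
    rwa [add_zero] at this
  mul_mem m n s t hs ht := by
    induction hs using gradedTensorPiece_induction with
    | add s s' _ _ h h' => rw [add_mul]; exact add_mem h h'
    | tmul i j hij a ha b hb =>
      induction ht using gradedTensorPiece_induction with
      | add s s' _ _ h h' => rw [mul_add]; exact add_mem h h'
      | tmul k l hkl a' ha' b' hb' =>
        rw [of_tmul_mul 𝒜 a b' hb ha', ← hij, ← hkl, add_add_add_comm]
        exact Submodule.smul_mem _ _
          (of_tmul_mem (SetLike.mul_mem_graded ha ha') (SetLike.mul_mem_graded hb hb'))

theorem gradedTensorPiece_comm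
    (comm : ∀ ⦃i j : ℤ⦄ ⦃a b : A⦄, a ∈ 𝒜 i → b ∈ 𝒜 j → a * b = sgn R (i * j) • (b * a))
    ⦃m n : ℤ⦄ ⦃s t : 𝒜 ᵍ⊗[R] 𝒜⦄ (hs : s ∈ gradedTensorPiece 𝒜 m)
    (ht : t ∈ gradedTensorPiece 𝒜 n) : s * t = sgn R (m * n) • (t * s) := by
  induction hs using gradedTensorPiece_induction with
  | add s s' _ _ h h' => rw [add_mul, h, h', mul_add, smul_add]
  | tmul i j hij a ha b hb =>
    induction ht using gradedTensorPiece_induction with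
    | add s s' _ _ h h' => rw [mul_add, h, h', add_mul, smul_add]
    | tmul k l hkl a' ha' b' hb' =>
      rw [of_tmul_mul 𝒜 a b' hb ha', of_tmul_mul 𝒜 a' b hb' ha, comm ha ha', comm hb hb', ← hij,
        ← hkl]
      simp only [← TensorProduct.smul_tmul', TensorProduct.tmul_smul, map_smul, smul_smul,
        ← sgn_add]
      congr 1
      apply sgn_congr (-(l * i))
      ring

variable {ι : Type*} {deg : ι → ℤ} {D : ι → A →ₗ[R] A}

variable (𝒜 deg D) in
/-- The derivations `D i ⊗ 1` and `1 ⊗ D i` of the tensor square. -/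
noncomputable def tensorDerivation (x : ι ⊕ ι) : (𝒜 ᵍ⊗[R] 𝒜) →ₗ[R] (𝒜 ᵍ⊗[R] 𝒜) :=
  (GradedTensorProduct.of R 𝒜 𝒜).toLinearMap ∘ₗ
    x.elim (fun i => TensorProduct.map (D i) LinearMap.id)
      (fun i => TensorProduct.map (signPow 𝒜 (deg i)) (D i)) ∘ₗ
    (GradedTensorProduct.of R 𝒜 𝒜).symm.toLinearMap

theorem tensorDerivation_inl (i : ι) (a b : A) :
    tensorDerivation 𝒜 deg D (Sum.inl i) (GradedTensorProduct.of R 𝒜 𝒜 (a ⊗ₜ b)) =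
      GradedTensorProduct.of R 𝒜 𝒜 (D i a ⊗ₜ b) := rfl

theorem tensorDerivation_inr (i : ι) {n : ℤ} {a : A} (ha : a ∈ 𝒜 n) (b : A) :
    tensorDerivation 𝒜 deg D (Sum.inr i) (GradedTensorProduct.of R 𝒜 𝒜 (a ⊗ₜ b)) =
      sgn R (deg i * n) • GradedTensorProduct.of R 𝒜 𝒜 (a ⊗ₜ D i b) := by
  rw [← map_smul, TensorProduct.smul_tmul', ← signPow_apply 𝒜 (deg i) ha]
  rfl

theorem gradedTensor_induction {P : 𝒜 ᵍ⊗[R] 𝒜 → Prop} (t : 𝒜 ᵍ⊗[R] 𝒜)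
    (tmul : ∀ i j : ℤ, ∀ a ∈ 𝒜 i, ∀ b ∈ 𝒜 j, P (GradedTensorProduct.of R 𝒜 𝒜 (a ⊗ₜ b)))
    (add : ∀ s t, P s → P t → P (s + t)) : P t :=
  tensor_induction 𝒜 (P := fun t => P (GradedTensorProduct.of R 𝒜 𝒜 t))
    ((GradedTensorProduct.of R 𝒜 𝒜).symm t) tmul fun _ _ => add _ _

/-- This is what makes the criterion for divided powers applicable to `A ⊗ A` without repeating the
argument. -/
theorem IsDerivationFamily.tensor (hD : IsDerivationFamily 𝒜 deg D) :
    IsDerivationFamily (gradedTensorPiece 𝒜) (Sum.elim deg deg) (tensorDerivation 𝒜 deg D) where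
  mem x m t ht := by
    induction ht using gradedTensorPiece_induction with
    | add s t _ _ h h' => rw [map_add]; exact add_mem h h'
    | tmul i j hij a ha b hb =>
      subst hij
      cases x with
      | inl x =>
        rw [tensorDerivation_inl, Sum.elim_inl, add_sub_right_comm]
        exact of_tmul_mem (hD.mem ha) hb
      | inr x =>
        rw [tensorDerivation_inr x ha, Sum.elim_inr, add_sub_assoc]
        exact Submodule.smul_mem _ _ (of_tmul_mem ha (hD.mem hb))
  leibniz x m s t hs := by
    induction hs using gradedTensorPiece_induction with
    | add s s' _ _ h h' =>
      simp only [add_mul, map_add, h, h', smul_add]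
      abel
    | tmul i j hij a ha b hb =>
      subst hij
      refine gradedTensor_induction (P := fun t => tensorDerivation 𝒜 deg D x
        (GradedTensorProduct.of R 𝒜 𝒜 (a ⊗ₜ b) * t) =
          tensorDerivation 𝒜 deg D x (GradedTensorProduct.of R 𝒜 𝒜 (a ⊗ₜ b)) * t +
          sgn R (Sum.elim deg deg x * (i + j)) • (GradedTensorProduct.of R 𝒜 𝒜 (a ⊗ₜ b) *
            tensorDerivation 𝒜 deg D x t)) t (fun k l a' ha' b' hb' => ?_) fun s t hs ht => ?_
      · cases x with
        | inl x =>
          rw [of_tmul_mul 𝒜 a b' hb ha', map_smul, tensorDerivation_inl, tensorDerivation_inl,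
            tensorDerivation_inl, of_tmul_mul 𝒜 (D x a) b' hb ha',
            of_tmul_mul 𝒜 a b' hb (hD.mem ha'), hD.leibniz a' ha, TensorProduct.add_tmul, map_add,
            smul_add]
          congr 1
          simp only [← TensorProduct.smul_tmul', map_smul, smul_smul, ← sgn_add, Sum.elim_inl]
          congr 1
          apply sgn_congr 0
          ring
        | inr x =>
          rw [of_tmul_mul 𝒜 a b' hb ha', map_smul,
            tensorDerivation_inr x (SetLike.mul_mem_graded ha ha'), tensorDerivation_inr x ha,
            tensorDerivation_inr x ha', smul_mul_assoc, mul_smul_comm,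
            of_tmul_mul 𝒜 a b' (hD.mem hb) ha',
            of_tmul_mul 𝒜 a _ hb ha', hD.leibniz b' hb, TensorProduct.tmul_add, map_add,
            smul_add, smul_add]
          simp only [TensorProduct.tmul_smul, map_smul, smul_smul, ← sgn_add, Sum.elim_inr]
          congr 2
          · apply sgn_congr (deg x * k); ring
          · apply sgn_congr 0; ring
      · simp only [mul_add, map_add, hs, ht, smul_add]
        abel

section Sequences

variable (hD : IsDerivationFamily 𝒜 deg D)
include hD

theorem IsDividedPowerSequence.includeLeft {m : ℤ} {a : A} {g : ℕ → A}
    (hg : IsDividedPowerSequence 𝒜 D m a g) :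
    IsDividedPowerSequence (gradedTensorPiece 𝒜) (tensorDerivation 𝒜 deg D) m
      (GradedTensorProduct.of R 𝒜 𝒜 (a ⊗ₜ 1))
      (fun k => GradedTensorProduct.of R 𝒜 𝒜 (g k ⊗ₜ 1)) where
  zero := by rw [hg.zero]; rfl
  mem k := by simpa using of_tmul_mem (hg.mem k) SetLike.GradedOne.one_mem
  D_succ x k := by
    have ha : g 1 ∈ 𝒜 m := by simpa using hg.mem 1
    cases x with
    | inl x =>
      rw [tensorDerivation_inl, tensorDerivation_inl, hg.D_succ]
      have := of_tmul_mul 𝒜 (D x a) (1 : A) (SetLike.GradedOne.one_mem (A := 𝒜)) (hg.mem k)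
      rw [this, zero_mul, sgn_zero, one_smul, one_mul]
    | inr x =>
      have h1 : ∀ b : A, tensorDerivation 𝒜 deg D (Sum.inr x)
          (GradedTensorProduct.of R 𝒜 𝒜 (b ⊗ₜ 1)) = 0 := by
        intro b
        change GradedTensorProduct.of R 𝒜 𝒜 (signPow 𝒜 (deg x) b ⊗ₜ D x 1) = 0
        rw [hD.map_one, TensorProduct.tmul_zero, map_zero]
      rw [h1, h1, zero_mul]

theorem IsDividedPowerSequence.includeRight {m : ℤ} {a : A} {g : ℕ → A}
    (hg : IsDividedPowerSequence 𝒜 D m a g) :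
    IsDividedPowerSequence (gradedTensorPiece 𝒜) (tensorDerivation 𝒜 deg D) m
      (GradedTensorProduct.of R 𝒜 𝒜 (1 ⊗ₜ a))
      (fun k => GradedTensorProduct.of R 𝒜 𝒜 (1 ⊗ₜ g k)) where
  zero := by rw [hg.zero]; rfl
  mem k := by simpa using of_tmul_mem (𝒜 := 𝒜) SetLike.GradedOne.one_mem (hg.mem k)
  D_succ x k := by
    have one : (1 : A) ∈ 𝒜 0 := SetLike.GradedOne.one_mem
    cases x with
    | inl x =>
      rw [tensorDerivation_inl, tensorDerivation_inl, hD.map_one, TensorProduct.zero_tmul,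
        TensorProduct.zero_tmul, map_zero, zero_mul]
    | inr x =>
      rw [tensorDerivation_inr x one, tensorDerivation_inr x one, hg.D_succ, mul_zero, sgn_zero,
        one_smul, one_smul]
      have h1 : D x (g 1) = D x a := by simpa [hg.zero] using hg.D_succ x 0
      have := of_tmul_mul 𝒜 (1 : A) (g k) (hD.mem (i := x) (hg.mem 1)) one
      rw [h1, mul_zero, sgn_zero, one_smul, one_mul] at this
      exact this.symm

variable (two : IsUnit (2 : R))
  (comm : ∀ ⦃i j : ℤ⦄ ⦃a b : A⦄, a ∈ 𝒜 i → b ∈ 𝒜 j → a * b = sgn R (i * j) • (b * a))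
  (nonneg : ∀ n : ℤ, n < 0 → 𝒜 n = ⊥)
  (detect : ∀ ⦃m : ℤ⦄ ⦃a : A⦄, 0 < m → a ∈ 𝒜 m → (∀ i, D i a = 0) → a = 0)
  (ex : ∀ ⦃m : ℤ⦄ ⦃a : A⦄, 0 < m → Even m → a ∈ 𝒜 m → ∃ g, IsDividedPowerSequence 𝒜 D m a g)
include two comm nonneg detect ex

/-- Sums are covered by `sequence_add`. A decomposable tensor is `(a ⊗ 1)(1 ⊗ b)`, and since `m` is
even the two degrees have the same parity, so the product rules apply. -/
theorem exists_tensor_sequence ⦃m : ℤ⦄ ⦃t : 𝒜 ᵍ⊗[R] 𝒜⦄ (hm : 0 < m) (he : Even m)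
    (ht : t ∈ gradedTensorPiece 𝒜 m) :
    ∃ g, IsDividedPowerSequence (gradedTensorPiece 𝒜) (tensorDerivation 𝒜 deg D) m t g := by
  have comm' := gradedTensorPiece_comm comm
  have one : (1 : A) ∈ 𝒜 0 := SetLike.GradedOne.one_mem
  have hgb : ∀ {n : ℤ} {b : A} {g : ℕ → A}, 0 < n → Even n → b ∈ 𝒜 n →
      IsDividedPowerSequence 𝒜 D n b g → ∀ k : ℕ, b * g k = (k + 1) • g (k + 1) := by
    intro n b g hn hen hb hg k
    have := hD.sequence_mul comm detect hn hen hb hg 1 k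
    rwa [IsDerivationFamily.sequence_one detect hn hb hg, add_comm 1 k,
      Nat.choose_one_right] at this
  induction ht using gradedTensorPiece_induction with
  | add s t hs ht h h' =>
    obtain ⟨g, hg⟩ := h
    obtain ⟨g', hg'⟩ := h'
    exact ⟨_, hD.tensor.sequence_add comm' he hg hg'⟩
  | tmul i j hij a ha b hb =>
    have zero : a = 0 ∨ b = 0 → ∃ g, IsDividedPowerSequence (gradedTensorPiece 𝒜)
        (tensorDerivation 𝒜 deg D) m (GradedTensorProduct.of R 𝒜 𝒜 (a ⊗ₜ b)) g := by
      intro h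
      have : (a ⊗ₜ b : A ⊗[R] A) = 0 := by
        rcases h with rfl | rfl
        · rw [TensorProduct.zero_tmul]
        · rw [TensorProduct.tmul_zero]
      rw [this, map_zero]
      exact ⟨_, isDividedPowerSequence_zero m⟩
    rcases lt_or_ge i 0 with hi | hi
    · rw [nonneg i hi, Submodule.mem_bot] at ha
      exact zero (Or.inl ha)
    rcases lt_or_ge j 0 with hj | hj
    · rw [nonneg j hj, Submodule.mem_bot] at hb
      exact zero (Or.inr hb)
    have ml := of_tmul_mem ha one
    have mr := of_tmul_mem one hb
    rw [add_zero] at ml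
    rw [zero_add] at mr
    have split : GradedTensorProduct.of R 𝒜 𝒜 (a ⊗ₜ b) =
        GradedTensorProduct.of R 𝒜 𝒜 (a ⊗ₜ 1) * GradedTensorProduct.of R 𝒜 𝒜 (1 ⊗ₜ b) := by
      rw [of_tmul_mul 𝒜 a b one one]; simp
    rw [split]
    subst hij
    rcases Int.even_or_odd i with hie | hio
    · have hje : Even j := (Int.even_add.1 he).1 hie
      rcases hj.lt_or_eq with hj | rfl
      · obtain ⟨g, hg⟩ := ex hj hje hb
        refine ⟨_, hD.tensor.sequence_even_mul comm' hie ml mr (hg.includeRight hD) fun k => ?_⟩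
        rw [of_tmul_mul 𝒜 1 (g k) hb one, mul_zero, sgn_zero, one_smul, one_mul,
          hgb hj hje hb hg, TensorProduct.tmul_smul, map_nsmul]
      -- If `|b| = 0`, only `a` has positive degree and carries divided powers, so the factors
      -- exchange roles.
      · rw [add_zero] at hm
        obtain ⟨g, hg⟩ := ex hm hie ha
        have h1 := hD.tensor.sequence_even_mul comm' hje mr ml (hg.includeLeft hD) fun k => by
          rw [of_tmul_mul 𝒜 a 1 one (hg.mem k), zero_mul, sgn_zero, one_smul, one_mul,
            hgb hm hie ha hg, ← TensorProduct.smul_tmul', map_nsmul]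
        rw [zero_add, (commute_of_even comm' hje mr ml).eq] at h1
        rw [add_zero]
        exact ⟨_, h1⟩
    · have hjo : Odd j := by
        by_contra h
        rw [Int.not_odd_iff_even] at h
        exact (Int.not_even_iff_odd.2 hio) ((Int.even_add.1 he).2 h)
      exact ⟨_, hD.tensor.sequence_odd_mul comm' two hio hjo ml mr⟩

end Sequences

end TensorSquare

/-! ### Detecting tensors by slices. -/

section Separation

variable {R : Type*} [CommRing R] {A : Type*} [Ring A] [Algebra R A]
variable {𝒜 : ℤ → Submodule R A} [GradedAlgebra 𝒜]

theorem plainSlice_map (φ : Module.Dual R A) (f g : A →ₗ[R] A) (t : A ⊗[R] A) :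
    plainSlice φ (TensorProduct.map f g t) = f (plainSlice (φ ∘ₗ g) t) := by
  induction t with
  | zero => simp
  | add s t hs ht => simp only [map_add, hs, ht]
  | tmul a b => simp

theorem exists_sum_lTensor_proj (t : A ⊗[R] A) : ∃ S : Finset ℤ, ∀ S', S ⊆ S' →
    ∑ n ∈ S', (GradedAlgebra.proj 𝒜 n).lTensor A t = t := by
  classical
  induction t with
  | zero => exact ⟨∅, fun _ _ => by simp⟩
  | add s t hs ht =>
    obtain ⟨S, hS⟩ := hs
    obtain ⟨T, hT⟩ := ht
    refine ⟨S ∪ T, fun S' h => ?_⟩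
    simp only [map_add, Finset.sum_add_distrib]
    rw [hS S' (Finset.union_subset_left h), hT S' (Finset.union_subset_right h)]
  | tmul a b =>
    refine ⟨(DirectSum.decompose 𝒜 b).support, fun S' h => ?_⟩
    simp only [LinearMap.lTensor_tmul, ← TensorProduct.tmul_sum, GradedAlgebra.proj_apply]
    congr 1
    rw [← Finset.sum_subset h, DirectSum.sum_support_decompose]
    intro n _ hn
    simpa using hn

/-- Homogeneous slices determine all slices, as `t` has finitely many components in the right
factor; slices with the coordinate functionals of a basis are the coordinates of `t`. -/
theorem eq_zero_of_forall_plainSlice [Module.Free R A] {t : A ⊗[R] A}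
    (h : ∀ n, ∀ φ ∈ dualPiece 𝒜 n, plainSlice φ t = 0) : t = 0 := by
  have h1 : ∀ φ : Module.Dual R A, plainSlice φ t = 0 := by
    intro φ
    obtain ⟨S, hS⟩ := exists_sum_lTensor_proj (𝒜 := 𝒜) t
    rw [← hS S subset_rfl, map_sum]
    refine Finset.sum_eq_zero fun n _ => ?_
    have := plainSlice_map φ LinearMap.id (GradedAlgebra.proj 𝒜 n) t
    rw [LinearMap.id_apply, h n _ (comp_proj_mem_dualPiece φ n)] at this
    exact this
  let b := Module.Free.chooseBasis R A
  apply (TensorProduct.equivFinsuppOfBasisRight (M := A) b).injective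
  rw [map_zero]
  ext i
  have h2 : ∀ t : A ⊗[R] A, TensorProduct.equivFinsuppOfBasisRight (M := A) b t i =
      plainSlice (b.coord i) t := by
    intro t
    induction t with
    | zero => simp
    | add s t hs ht => simp only [map_add, Finsupp.add_apply, hs, ht]
    | tmul x y => simp
  rw [h2, h1]
  rfl

theorem plainSlice_mem {φ : Module.Dual R A} {p n : ℤ} (hφ : φ ∈ dualPiece 𝒜 p) {t : A ⊗[R] A}
    (ht : t ∈ tensorPiece 𝒜 n) : plainSlice φ t ∈ 𝒜 (n - p) := by
  have h := slice_eq_plainSlice hφ ht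
  have : plainSlice φ t = sgn R (p * (n - p)) • slice 𝒜 φ t := by
    rw [h, smul_smul, sgn_mul_self, one_smul]
  rw [this]
  exact Submodule.smul_mem _ _ (slice_mem hφ ht)

theorem tensorPiece_disjoint [Module.Free R A] ⦃m n : ℤ⦄ ⦃t : A ⊗[R] A⦄ (hmn : m ≠ n)
    (hm : t ∈ tensorPiece 𝒜 m) (hn : t ∈ tensorPiece 𝒜 n) : t = 0 :=
  eq_zero_of_forall_plainSlice (𝒜 := 𝒜) fun p φ hφ =>
    eq_zero_of_mem_of_mem (ℳ := 𝒜) (by omega : m - p ≠ n - p) (plainSlice_mem hφ hm)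
      (plainSlice_mem hφ hn)

theorem signPow_signPow (p : ℤ) (a : A) : signPow 𝒜 p (signPow 𝒜 p a) = a := by
  refine homogeneous_induction 𝒜 a (fun n a ha => ?_) fun a b ha hb => ?_
  · rw [signPow_apply 𝒜 p ha, map_smul, signPow_apply 𝒜 p ha, smul_smul, sgn_mul_self, one_smul]
  · rw [map_add, map_add, ha, hb]

/-- Coassociativity again: the contraction acts on the last factor only and so commutes with `Δ`. -/
theorem comul_plainContract [Coalgebra R A] (φ : Module.Dual R A) (a : A) :
    Coalgebra.comul (plainContract φ a) = (plainContract φ).lTensor A (Coalgebra.comul a) := by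
  have key : ∀ t : A ⊗[R] A, Coalgebra.comul (plainSlice φ t) =
      (plainSlice φ).lTensor A (TensorProduct.assoc R A A A (Coalgebra.comul.rTensor A t)) := by
    intro t
    induction t with
    | zero => simp
    | add s t hs ht => simp only [map_add, hs, ht]
    | tmul b c =>
      simp only [plainSlice_tmul, map_smul, LinearMap.rTensor_tmul]
      generalize (Coalgebra.comul b : A ⊗[R] A) = s
      induction s with
      | zero => simp
      | add s t hs ht => simp only [smul_add, TensorProduct.add_tmul, map_add, hs, ht]
      | tmul x y => simp
  rw [plainContract, LinearMap.comp_apply, key, Coalgebra.coassoc_apply, LinearMap.lTensor_comp,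
    LinearMap.comp_apply]

end Separation

/-! ### The diagonal preserves divided powers. -/

namespace IsoToDual

variable {R : Type*} [CommRing R]
variable {A : Type*} [Ring A] [Algebra R A] [Coalgebra R A]
variable {𝒜 : ℤ → Submodule R A} [GradedAlgebra 𝒜] {d : A →ₗ[R] A}
variable {L : DGLieAlgebra R}
open DGLieAlgebra.Env DGLieAlgebra
variable (e : IsoToDual 𝒜 d (piece L) (comul L) (counit L).toLinearMap (del L))
variable (hopf : IsDGHopfAlgebra 𝒜 d)
variable [Module.Free R A]

/-- The derivations of `A ⊗ A` given by the primitive elements of the dual. -/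
noncomputable abbrev tensorAction : (Σ i : ℤ, L.deg i) ⊕ (Σ i : ℤ, L.deg i) →
    (𝒜 ᵍ⊗[R] 𝒜) →ₗ[R] (𝒜 ᵍ⊗[R] 𝒜) :=
  tensorDerivation 𝒜 (fun x : Σ i : ℤ, L.deg i => x.1)
    (fun x : Σ i : ℤ, L.deg i => e.action hopf (ι L (x.2 : L.carrier)))

/-- If `L` kills the right factor, `UL` acts on it through its augmentation. Pairing the right
factor with `u` is the action of `u` followed by `ε`, so `t` and the asserted tensor have equal
slices. -/
theorem eq_tmul_one_of_tensorAction {t : A ⊗[R] A}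
    (h : ∀ x, e.tensorAction hopf (Sum.inr x) (GradedTensorProduct.of R 𝒜 𝒜 t) = 0) :
    t = plainSlice Coalgebra.counit t ⊗ₜ 1 := by
  have h0 : ∀ i, ∀ x ∈ L.deg i, (e.action hopf (ι L x)).lTensor A t = 0 := by
    intro i x hx
    have h1 : TensorProduct.map (signPow 𝒜 i) (e.action hopf (ι L x)) t = 0 := h ⟨i, x, hx⟩
    have h2 := congrArg ((signPow 𝒜 i).rTensor A) h1
    rw [map_zero, LinearMap.rTensor, ← LinearMap.comp_apply, ← TensorProduct.map_comp] at h2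
    rw [← h2, LinearMap.lTensor, LinearMap.id_comp]
    congr 2
    ext a
    exact (signPow_signPow i a).symm
  have key : ∀ u, (e.action hopf u).lTensor A t = counit L u • t := by
    intro u
    induction u using induction_left with
    | one =>
      rw [_root_.map_one, _root_.map_one, one_smul]
      exact LinearMap.lTensor_id_apply A A t
    | ι_mul i x hx u hu =>
      rw [_root_.map_mul, _root_.map_mul, counit_ι, zero_mul, zero_smul, LinearMap.lTensor_mul,
        Module.End.mul_apply, hu, map_smul, h0 i x hx, smul_zero]
    | add u w hu hw =>
      rw [map_add, LinearMap.lTensor_add, LinearMap.add_apply, hu, hw, map_add, add_smul]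
    | smul r u hu =>
      rw [map_smul, LinearMap.lTensor_smul, LinearMap.smul_apply, hu, map_smul, smul_eq_mul,
        mul_smul]
  rw [← sub_eq_zero]
  refine eq_zero_of_forall_plainSlice (𝒜 := 𝒜) fun n φ hφ => ?_
  obtain ⟨u, _, rfl⟩ := e.exists_functional_eq hφ
  have h1 := plainSlice_map Coalgebra.counit LinearMap.id (e.action hopf u) t
  have h2 : Coalgebra.counit ∘ₗ e.action hopf u = e.functional u := by
    ext a; exact e.counit_action hopf u a
  have h3 : e.functional u 1 = counit L u := (e.map_counit u).symm
  rw [h2, LinearMap.id_apply] at h1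
  rw [map_sub, ← h1, plainSlice_tmul, h3, sub_eq_zero, ← map_smul, ← key u]
  rfl

/-- The derivations `1 ⊗ x` reduce `t` to `a ⊗ 1` with `a` of positive degree, and the derivations
`x ⊗ 1` then kill `a`. -/
theorem tensor_detect ⦃m : ℤ⦄ ⦃t : 𝒜 ᵍ⊗[R] 𝒜⦄ (hm : 0 < m) (ht : t ∈ gradedTensorPiece 𝒜 m)
    (h : ∀ x, e.tensorAction hopf x t = 0) : t = 0 := by
  obtain ⟨t, ht, rfl⟩ := ht
  have h1 := e.eq_tmul_one_of_tensorAction hopf fun x => h (Sum.inr x)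
  have h2 : plainSlice Coalgebra.counit t ∈ 𝒜 m := by
    simpa using plainSlice_mem hopf.counit_mem_dualPiece ht
  have h3 : plainSlice Coalgebra.counit t = 0 := by
    refine e.detect hopf hm h2 fun x => ?_
    have h4 := h (Sum.inl x)
    rw [LinearEquiv.coe_coe, h1, tensorDerivation_inl] at h4
    have h5 : e.action hopf (ι L x.2) (plainSlice Coalgebra.counit t) ⊗ₜ[R] (1 : A) = 0 := h4
    have h6 := congrArg (plainSlice Coalgebra.counit) h5
    rwa [plainSlice_tmul, hopf.counit_one, one_smul, map_zero] at h6
  rw [LinearEquiv.coe_coe, h1, h3, TensorProduct.zero_tmul, map_zero]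

omit [Module.Free R A] in
theorem tensorAction_comul (x : Σ i : ℤ, L.deg i) (a : A) :
    e.tensorAction hopf (Sum.inr x) (GradedTensorProduct.of R 𝒜 𝒜 (Coalgebra.comul a)) =
      GradedTensorProduct.of R 𝒜 𝒜 (Coalgebra.comul (e.action hopf (ι L (x.2 : L.carrier)) a)) := by
  obtain ⟨p, x, hx⟩ := x
  have hφ := e.functional_mem (ι_mem L hx)
  refine homogeneous_induction 𝒜 a (fun n a ha => ?_) fun a b ha hb => ?_
  · rw [action_apply, hopf.contract_eq_plainContract hφ ha, map_smul, comul_plainContract]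
    have key : ∀ t ∈ tensorPiece 𝒜 n,
        TensorProduct.map (signPow 𝒜 p) (e.action hopf (ι L x)) t =
          sgn R (p * (n - p)) • (plainContract (e.functional (ι L x))).lTensor A t := by
      intro t ht
      induction ht using tensorPiece_induction 𝒜 with
      | add s t _ _ h h' => rw [map_add, h, h', map_add, smul_add]
      | tmul i j hij a ha b hb =>
        rw [TensorProduct.map_tmul, signPow_apply 𝒜 p ha, action_apply,
          hopf.contract_eq_plainContract hφ hb, TensorProduct.tmul_smul,
          ← TensorProduct.smul_tmul', smul_smul, ← sgn_add, LinearMap.lTensor_tmul, ← hij]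
        congr 1
        apply sgn_congr 0
        ring
    exact congrArg (GradedTensorProduct.of R 𝒜 𝒜) (key _ (hopf.comul_mem ha))
  · simp only [map_add, ha, hb]

/-- `id ⊗ ε` is multiplicative and intertwines `x ⊗ 1` with `x`, so it carries the sequence of `t`
to a solution of the equations in `A`, where solutions are unique. -/
theorem slice_dividedPower {m : ℤ} (hm : 0 < m) {t : A ⊗[R] A}
    {g : ℕ → A} {h : ℕ → 𝒜 ᵍ⊗[R] 𝒜}
    (hg : IsDividedPowerSequence 𝒜
      (fun x : Σ i : ℤ, L.deg i => e.action hopf (ι L (x.2 : L.carrier))) m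
      (slice 𝒜 Coalgebra.counit t) g)
    (hh : IsDividedPowerSequence (gradedTensorPiece 𝒜) (e.tensorAction hopf) m
      (GradedTensorProduct.of R 𝒜 𝒜 t) h) (k : ℕ) :
    slice 𝒜 Coalgebra.counit ((GradedTensorProduct.of R 𝒜 𝒜).symm (h k)) = g k := by
  refine IsDerivationFamily.sequence_unique (e.detect hopf) hm
    (g := fun k => slice 𝒜 Coalgebra.counit ((GradedTensorProduct.of R 𝒜 𝒜).symm (h k)))
    ⟨?_, fun k => ?_, fun x k => ?_⟩ hg k
  · simp only [hh.zero]
    have := hopf.slice_counit_tmul (𝒜 := 𝒜) 1 1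
    rwa [hopf.counit_one, one_smul] at this
  · obtain ⟨s, hs, hsk⟩ := hh.mem k
    simp only [← hsk]
    simpa using slice_mem hopf.counit_mem_dualPiece hs
  · have h1 : ∀ s : 𝒜 ᵍ⊗[R] 𝒜, e.action hopf (ι L x.2)
        (slice 𝒜 Coalgebra.counit ((GradedTensorProduct.of R 𝒜 𝒜).symm s)) =
        slice 𝒜 Coalgebra.counit ((GradedTensorProduct.of R 𝒜 𝒜).symm
          (e.tensorAction hopf (Sum.inl x) s)) := by
      intro s
      rw [hopf.slice_counit, hopf.slice_counit]
      exact (plainSlice_map Coalgebra.counit (e.action hopf (ι L x.2)) LinearMap.id _).symm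
    have h2 := h1 (GradedTensorProduct.of R 𝒜 𝒜 t)
    rw [GradedTensorProduct.of_symm_of] at h2
    rw [h1, hh.D_succ, h2]
    exact hopf.slice_counit_mul
      ((GradedTensorProduct.of R 𝒜 𝒜).symm
        (e.tensorAction hopf (Sum.inl x) (GradedTensorProduct.of R 𝒜 𝒜 t)))
      ((GradedTensorProduct.of R 𝒜 𝒜).symm (h k))

/-- `Δ` intertwines `x` only with `1 ⊗ x`, so induction shows that the `1 ⊗ x` kill the difference,
which is therefore `c ⊗ 1`. Its slice `c` under `id ⊗ ε` vanishes by `slice_dividedPower`. -/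
theorem comul_dividedPower {m : ℤ} (hm : 0 < m) {a : A}
    {g : ℕ → A} {h : ℕ → 𝒜 ᵍ⊗[R] 𝒜}
    (hg : IsDividedPowerSequence 𝒜
      (fun x : Σ i : ℤ, L.deg i => e.action hopf (ι L (x.2 : L.carrier))) m a g)
    (hh : IsDividedPowerSequence (gradedTensorPiece 𝒜) (e.tensorAction hopf) m
      (GradedTensorProduct.of R 𝒜 𝒜 (Coalgebra.comul a)) h) (k : ℕ) :
    GradedTensorProduct.of R 𝒜 𝒜 (Coalgebra.comul (g k)) = h k := by
  have hE : ∀ b : A, slice 𝒜 Coalgebra.counit (Coalgebra.comul b) = b := fun b => by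
    rw [← contract_apply, hopf.contract_counit]; rfl
  induction k with
  | zero => rw [hg.zero, hh.zero, hopf.comul_one]
  | succ k ih =>
    have h1 := e.slice_dividedPower hopf hm (g := g) (by rwa [hE]) hh (k + 1)
    obtain ⟨s, hs⟩ : ∃ s, GradedTensorProduct.of R 𝒜 𝒜 s = h (k + 1) :=
      ⟨(GradedTensorProduct.of R 𝒜 𝒜).symm (h (k + 1)), by simp⟩
    rw [← hs, GradedTensorProduct.of_symm_of] at h1
    rw [← hs]
    congr 1
    rw [← sub_eq_zero]
    have h2 := e.eq_tmul_one_of_tensorAction hopf (t := Coalgebra.comul (g (k + 1)) - s)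
      fun x => by
        rw [map_sub, map_sub, hs, hh.D_succ, e.tensorAction_comul hopf, e.tensorAction_comul hopf,
          hg.D_succ x k, hopf.comul_mul, ih, sub_self]
    rw [h2, map_sub, ← hopf.slice_counit (𝒜 := 𝒜), ← hopf.slice_counit (𝒜 := 𝒜), h1, hE, sub_self,
      TensorProduct.zero_tmul]

end IsoToDual

/-- The dual of an enveloping algebra is a differential `Γ`-Hopf algebra. -/
theorem IsoToDual.isDGGammaHopfAlgebra {R : Type*} [CommRing R] [IsDomain R]
    [IsPrincipalIdealRing R] (two_unit : IsUnit (2 : R))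
    {A : Type*} [Ring A] [Algebra R A] [Coalgebra R A] {𝒜 : ℤ → Submodule R A} [GradedAlgebra 𝒜]
    {d : A →ₗ[R] A} (hopf : IsDGHopfAlgebra 𝒜 d) (comm : IsGradedCommutative 𝒜)
    [Module.Free R A] (finite_type : ∀ n : ℤ, Module.Finite R (𝒜 n)) {L : DGLieAlgebra R}
    (e : IsoToDual 𝒜 d (DGLieAlgebra.Env.piece L) (DGLieAlgebra.Env.comul L)
      (DGLieAlgebra.Env.counit L).toLinearMap (DGLieAlgebra.Env.del L)) :
    IsDGGammaHopfAlgebra 𝒜 d := by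
  have comm' : ∀ ⦃i j : ℤ⦄ ⦃a b : A⦄, a ∈ 𝒜 i → b ∈ 𝒜 j → a * b = sgn R (i * j) • (b * a) :=
    fun i j a b ha hb => by rw [comm ha hb, negOnePow_smul_eq (R := R)]
  have conn := e.isConnectedGraded hopf comm' finite_type
  have hD := e.isDerivationFamily hopf
  have ex : ∀ ⦃m : ℤ⦄ ⦃a : A⦄, 0 < m → Even m → a ∈ 𝒜 m → ∃ g, IsDividedPowerSequence 𝒜
      (fun x : Σ i : ℤ, L.deg i => e.action hopf (DGLieAlgebra.Env.ι L (x.2 : L.carrier))) m a g :=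
    fun m a _ he ha => by
      obtain ⟨g, hg, _⟩ := e.exists_sequence hopf comm' finite_type he ha
      exact ⟨g, hg⟩
  obtain ⟨γ, hγ⟩ := exists_dividedPowers (eq_zero_of_mem_of_mem (ℳ := 𝒜)) ex
  have disj : ∀ ⦃m n : ℤ⦄ ⦃t : 𝒜 ᵍ⊗[R] 𝒜⦄, m ≠ n → t ∈ gradedTensorPiece 𝒜 m →
      t ∈ gradedTensorPiece 𝒜 n → t = 0 := by
    rintro m n _ hmn ⟨t, ht, rfl⟩ ⟨s, hs, hst⟩
    have := (GradedTensorProduct.of R 𝒜 𝒜).injective hst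
    subst this
    rw [tensorPiece_disjoint hmn ht hs, map_zero]
  -- The divided powers of `A ⊗ A` solve the equations for `x ⊗ 1` and `1 ⊗ x`; uniqueness of
  -- solutions then yields all compatibilities with the inclusions.
  obtain ⟨δ, hδ⟩ := exists_dividedPowers disj
    (exists_tensor_sequence hD two_unit comm' conn.1 (e.detect hopf) ex)
  refine ⟨hopf, comm, conn, γ, hD.isDividedPowerSystem comm' (e.detect hopf) two_unit hγ,
    ⟨δ, hD.tensor.isDividedPowerSystem (gradedTensorPiece_comm comm') (e.tensor_detect hopf)
      two_unit hδ, ?_, ?_, ?_⟩, ?_⟩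
  · intro n a k hn he ha
    refine IsDerivationFamily.sequence_unique (e.tensor_detect hopf) hn
      ((hγ hn he ha).includeLeft hD) (hδ hn he ?_) k
    simpa using of_tmul_mem ha SetLike.GradedOne.one_mem
  · intro n a k hn he ha
    refine IsDerivationFamily.sequence_unique (e.tensor_detect hopf) hn
      ((hγ hn he ha).includeRight hD) (hδ hn he ?_) k
    simpa using of_tmul_mem (𝒜 := 𝒜) SetLike.GradedOne.one_mem ha
  · intro n a k hn he ha
    exact e.comul_dividedPower hopf hn (hγ hn he ha)
      (hδ hn he (of_mem_gradedTensorPiece (hopf.comul_mem ha))) k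
  · intro n a k hn he ha
    exact e.d_dividedPower hopf comm' hn he ha (hγ hn he ha) k

/-! ### `Γ`-primitive functionals. -/

section GammaPrimitive

variable {R : Type*} [CommRing R] {A : Type*} [Ring A] [Algebra R A] [Coalgebra R A]

/-- The hypotheses on `(A, d)` with divided powers `γ` that make it a differential `Γ`-Hopf
algebra. -/
structure IsGammaHopf (𝒜 : ℤ → Submodule R A) [GradedAlgebra 𝒜] (d : A →ₗ[R] A)
    (γ : ℕ → A → A) : Prop where
  hopf : IsDGHopfAlgebra 𝒜 d
  comm : ∀ ⦃i j : ℤ⦄ ⦃a b : A⦄, a ∈ 𝒜 i → b ∈ 𝒜 j → a * b = sgn R (i * j) • (b * a)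
  connected : IsConnectedGraded 𝒜
  dividedPowers : IsDividedPowerSystem 𝒜 γ
  diagonal : DiagonalPreservesDividedPowers 𝒜 γ
  d_dividedPower : ∀ ⦃n : ℤ⦄ ⦃a : A⦄ (k : ℕ), 0 < n → Even n → a ∈ 𝒜 n →
    d (γ (k + 1) a) = d a * γ k a

/-- The functionals of degree `n` that vanish on products and on higher divided powers of elements
of positive degree. -/
def gammaPiece (𝒜 : ℤ → Submodule R A) (γ : ℕ → A → A) (n : ℤ) :
    Submodule R (Module.Dual R A) where
  carrier := {φ | φ ∈ dualPiece 𝒜 n ∧ IsPrimitiveFunctional R φ ∧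
    ∀ ⦃m : ℤ⦄ ⦃a : A⦄ (k : ℕ), 0 < m → Even m → a ∈ 𝒜 m → φ (γ (k + 2) a) = 0}
  add_mem' := by
    rintro φ ψ ⟨h1, h2, h3⟩ ⟨h1', h2', h3'⟩
    refine ⟨add_mem h1 h1', fun a b => ?_, fun m a k hm he ha => ?_⟩
    · simp only [LinearMap.add_apply, h2 a b, h2' a b]; ring
    · rw [LinearMap.add_apply, h3 k hm he ha, h3' k hm he ha, add_zero]
  zero_mem' := ⟨zero_mem _, fun a b => by simp, fun m a k _ _ _ => rfl⟩
  smul_mem' := by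
    rintro r φ ⟨h1, h2, h3⟩
    refine ⟨Submodule.smul_mem _ r h1, fun a b => ?_, fun m a k hm he ha => ?_⟩
    · simp only [LinearMap.smul_apply, h2 a b, smul_eq_mul]; ring
    · rw [LinearMap.smul_apply, h3 k hm he ha, smul_zero]

variable {𝒜 : ℤ → Submodule R A} [GradedAlgebra 𝒜] {d : A →ₗ[R] A} {γ : ℕ → A → A}

namespace IsGammaHopf

variable (hA : IsGammaHopf 𝒜 d γ)
include hA

theorem primitive_apply_zero {φ : Module.Dual R A} (prim : IsPrimitiveFunctional R φ) {a : A}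
    (ha : a ∈ 𝒜 0) : φ a = 0 := by
  obtain ⟨r, rfl, _⟩ := hA.connected.2 a ha
  exact prim.map_algebraMap hA.hopf r

/-- Both sides behave alike under sums, so decomposable tensors suffice. There the axioms determine
`δ`, and `φ` kills scalars and higher divided powers. The case `t = Δ a` is the aim. -/
theorem slice_dividedPower {δ : ℕ → (𝒜 ᵍ⊗[R] 𝒜) → (𝒜 ᵍ⊗[R] 𝒜)}
    (hδ : IsDividedPowerSystem (gradedTensorPiece 𝒜) δ)
    (hl : PreservesDividedPowers 𝒜 γ δ (GradedTensorProduct.includeLeft 𝒜 𝒜))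
    (hr : PreservesDividedPowers 𝒜 γ δ (GradedTensorProduct.includeRight 𝒜 𝒜))
    {p : ℤ} {φ : Module.Dual R A} (hφ : φ ∈ gammaPiece 𝒜 γ p) {n : ℤ} (hn : 0 < n) (he : Even n)
    {t : 𝒜 ᵍ⊗[R] 𝒜} (ht : t ∈ gradedTensorPiece 𝒜 n) (k : ℕ) :
    slice 𝒜 φ ((GradedTensorProduct.of R 𝒜 𝒜).symm (δ (k + 1) t)) =
      slice 𝒜 φ ((GradedTensorProduct.of R 𝒜 𝒜).symm t) *
        slice 𝒜 Coalgebra.counit ((GradedTensorProduct.of R 𝒜 𝒜).symm (δ k t)) := by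
  obtain ⟨hφp, prim, hφγ⟩ := hφ
  have one : (1 : A) ∈ 𝒜 0 := SetLike.GradedOne.one_mem
  have sε : slice 𝒜 Coalgebra.counit ((GradedTensorProduct.of R 𝒜 𝒜).symm 1) = (1 : A) := by
    have := hA.hopf.slice_counit_tmul (𝒜 := 𝒜) 1 1
    rwa [hA.hopf.counit_one, one_smul] at this
  have sφ : slice 𝒜 φ ((GradedTensorProduct.of R 𝒜 𝒜).symm 1) = (0 : A) := by
    have := slice_tmul 𝒜 φ one one
    rwa [prim.map_one hA.hopf, mul_zero, zero_smul] at this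
  have smem : ∀ {m : ℤ} {s : 𝒜 ᵍ⊗[R] 𝒜}, s ∈ gradedTensorPiece 𝒜 m →
      (GradedTensorProduct.of R 𝒜 𝒜).symm s ∈ tensorPiece 𝒜 m := by
    rintro m _ ⟨s, hs, rfl⟩; simpa using hs
  induction ht using gradedTensorPiece_induction generalizing k with
  | add s t hs ht ihs iht =>
    have e : ∀ q : ℕ × ℕ, slice 𝒜 φ ((GradedTensorProduct.of R 𝒜 𝒜).symm (δ q.1 s * δ q.2 t)) =
        slice 𝒜 φ ((GradedTensorProduct.of R 𝒜 𝒜).symm (δ q.1 s)) *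
          slice 𝒜 Coalgebra.counit ((GradedTensorProduct.of R 𝒜 𝒜).symm (δ q.2 t)) +
        slice 𝒜 Coalgebra.counit ((GradedTensorProduct.of R 𝒜 𝒜).symm (δ q.1 s)) *
          slice 𝒜 φ ((GradedTensorProduct.of R 𝒜 𝒜).symm (δ q.2 t)) := by
      intro q
      have := hA.hopf.slice_mul hφp prim (smem (hδ.mem q.1 hn he hs))
        ((GradedTensorProduct.of R 𝒜 𝒜).symm (δ q.2 t))
      rwa [sgn_of_even ((he.mul_left _).mul_left _), one_smul] at this
    have hc : ∀ i, slice 𝒜 Coalgebra.counit ((GradedTensorProduct.of R 𝒜 𝒜).symm (δ i s)) *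
        slice 𝒜 φ ((GradedTensorProduct.of R 𝒜 𝒜).symm t) =
        slice 𝒜 φ ((GradedTensorProduct.of R 𝒜 𝒜).symm t) *
        slice 𝒜 Coalgebra.counit ((GradedTensorProduct.of R 𝒜 𝒜).symm (δ i s)) := by
      intro i
      have h1 := slice_mem hA.hopf.counit_mem_dualPiece (smem (hδ.mem i hn he hs))
      rw [sub_zero] at h1
      exact commute_of_even hA.comm (he.mul_left _) h1 (slice_mem hφp (smem ht))
    have hmul : ∀ x y : 𝒜 ᵍ⊗[R] 𝒜, slice 𝒜 Coalgebra.counit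
        ((GradedTensorProduct.of R 𝒜 𝒜).symm (x * y)) =
        slice 𝒜 Coalgebra.counit ((GradedTensorProduct.of R 𝒜 𝒜).symm x) *
        slice 𝒜 Coalgebra.counit ((GradedTensorProduct.of R 𝒜 𝒜).symm y) := fun x y =>
      hA.hopf.slice_counit_mul ((GradedTensorProduct.of R 𝒜 𝒜).symm x)
        ((GradedTensorProduct.of R 𝒜 𝒜).symm y)
    rw [hδ.add (k + 1) hn he hs ht, hδ.add k hn he hs ht]
    simp only [map_sum, e, Finset.sum_add_distrib]
    rw [Finset.Nat.sum_antidiagonal_succ, Finset.Nat.sum_antidiagonal_succ']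
    simp only [hδ.zero hn he hs, hδ.zero hn he ht, sφ, zero_mul, mul_zero, zero_add, ihs, iht,
      hmul, ← mul_assoc, hc, map_add, add_mul, Finset.mul_sum, Finset.sum_add_distrib]
  | tmul i j hij a ha b hb =>
    have hmem := of_tmul_mem ha hb
    rw [hij] at hmem
    cases k with
    | zero => rw [zero_add, hδ.one hn he hmem, hδ.zero hn he hmem, sε, mul_one]
    | succ k =>
    have zero : a = 0 ∨ b = 0 → GradedTensorProduct.of R 𝒜 𝒜 (a ⊗ₜ b) = 0 := by
      rintro (rfl | rfl)
      · rw [TensorProduct.zero_tmul, map_zero]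
      · rw [TensorProduct.tmul_zero, map_zero]
    have hzero : GradedTensorProduct.of R 𝒜 𝒜 (a ⊗ₜ b) = 0 → slice 𝒜 φ
        ((GradedTensorProduct.of R 𝒜 𝒜).symm
          (δ (k + 1 + 1) (GradedTensorProduct.of R 𝒜 𝒜 (a ⊗ₜ b)))) =
      slice 𝒜 φ ((GradedTensorProduct.of R 𝒜 𝒜).symm (GradedTensorProduct.of R 𝒜 𝒜 (a ⊗ₜ b))) *
        slice 𝒜 Coalgebra.counit ((GradedTensorProduct.of R 𝒜 𝒜).symm
          (δ (k + 1) (GradedTensorProduct.of R 𝒜 𝒜 (a ⊗ₜ b)))) := by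
      intro h
      -- That positive divided powers of `0` vanish is read off from `0 = 0 * 0` and `0 ^ (k + 2) =
      -- 0`.
      have h0 := hδ.even_mul (m := 0) (n := n) (k + 1 + 1) le_rfl Even.zero hn he
        (zero_mem _) (zero_mem _)
      rw [zero_mul, pow_succ, mul_zero, zero_mul] at h0
      rw [h, h0, map_zero, map_zero, zero_mul]
    rcases lt_or_ge i 0 with hi | hi
    · rw [hA.connected.1 i hi, Submodule.mem_bot] at ha
      exact hzero (zero (Or.inl ha))
    rcases lt_or_ge j 0 with hj | hj
    · rw [hA.connected.1 j hj, Submodule.mem_bot] at hb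
      exact hzero (zero (Or.inr hb))
    have ml := of_tmul_mem ha one
    have mr := of_tmul_mem one hb
    rw [add_zero] at ml
    rw [zero_add] at mr
    rcases Int.even_or_odd i with hie | hio
    · have hje : Even j := (Int.even_add.1 (hij ▸ he)).1 hie
      rcases hj.lt_or_eq with hj | rfl
      -- Here `δ^l(a ⊗ b) = a^l ⊗ γ^l(b)`: on the left `φ` kills `γ^{k+2}(b)`, on the right `ε`
      -- kills `γ^{k+1}(b)`.
      · have key : ∀ l, δ l (GradedTensorProduct.of R 𝒜 𝒜 (a ⊗ₜ b)) =
            GradedTensorProduct.of R 𝒜 𝒜 ((a ^ l) ⊗ₜ γ l b) := by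
          intro l
          have h1 := hδ.even_mul l hi hie hj hje ml mr
          have h2 : δ l (GradedTensorProduct.of R 𝒜 𝒜 (1 ⊗ₜ b)) =
            GradedTensorProduct.of R 𝒜 𝒜 (1 ⊗ₜ γ l b) := (hr l hj hje hb).symm
          have h3 : GradedTensorProduct.of R 𝒜 𝒜 (a ⊗ₜ 1) ^ l =
              GradedTensorProduct.of R 𝒜 𝒜 ((a ^ l) ⊗ₜ 1) :=
            (map_pow (GradedTensorProduct.includeLeft 𝒜 𝒜) a l).symm
          rw [h2, h3, of_tmul_mul 𝒜 _ _ one one, of_tmul_mul 𝒜 _ _ one one] at h1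
          simpa using h1
        rw [key, key, GradedTensorProduct.of_symm_of, GradedTensorProduct.of_symm_of, GradedTensorProduct.of_symm_of,
          slice_tmul 𝒜 φ (SetLike.pow_mem_graded _ ha) (hA.dividedPowers.mem _ hj hje hb),
          hφγ k hj hje hb, hA.hopf.slice_counit_tmul,
          hA.hopf.counit_of_mem _ (hA.dividedPowers.mem _ hj hje hb)]
        · simp
        · exact (mul_pos (by positivity) hj).ne'
      · rw [add_zero] at hij
        subst hij
        have key : ∀ l, δ l (GradedTensorProduct.of R 𝒜 𝒜 (a ⊗ₜ b)) =
            GradedTensorProduct.of R 𝒜 𝒜 (γ l a ⊗ₜ (b ^ l)) := by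
          intro l
          have h1 := hδ.even_mul l le_rfl hje hn he mr ml
          have h2 : δ l (GradedTensorProduct.of R 𝒜 𝒜 (a ⊗ₜ 1)) =
            GradedTensorProduct.of R 𝒜 𝒜 (γ l a ⊗ₜ 1) := (hl l hn he ha).symm
          have h3 : GradedTensorProduct.of R 𝒜 𝒜 (1 ⊗ₜ b) ^ l =
              GradedTensorProduct.of R 𝒜 𝒜 (1 ⊗ₜ (b ^ l)) :=
            (map_pow (GradedTensorProduct.includeRight 𝒜 𝒜) b l).symm
          have hbl : b ^ l ∈ 𝒜 0 := by simpa using SetLike.pow_mem_graded l hb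
          rw [h2, h3, of_tmul_mul 𝒜 _ _ hb ha,
            of_tmul_mul 𝒜 _ _ hbl (hA.dividedPowers.mem l hn he ha)] at h1
          simpa using h1
        rw [key, GradedTensorProduct.of_symm_of, GradedTensorProduct.of_symm_of,
          slice_tmul 𝒜 φ (hA.dividedPowers.mem _ hn he ha) (SetLike.pow_mem_graded _ hb),
          slice_tmul 𝒜 φ ha hb, hA.primitive_apply_zero prim hb, hA.primitive_apply_zero prim]
        · simp
        · simpa using SetLike.pow_mem_graded (k + 1 + 1) hb
    · have hjo : Odd j := by
        by_contra h
        rw [Int.not_odd_iff_even] at h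
        exact (Int.not_even_iff_odd.2 hio) ((Int.even_add.1 (hij ▸ he)).2 h)
      have hi' : 0 < i := hi.lt_of_ne (by rintro rfl; exact absurd hio (by decide))
      have hj' : 0 < j := hj.lt_of_ne (by rintro rfl; exact absurd hjo (by decide))
      have split : GradedTensorProduct.of R 𝒜 𝒜 (a ⊗ₜ b) =
          GradedTensorProduct.of R 𝒜 𝒜 (a ⊗ₜ 1) * GradedTensorProduct.of R 𝒜 𝒜 (1 ⊗ₜ b) := by
        rw [of_tmul_mul 𝒜 a b one one]; simp
      have key : ∀ l, 2 ≤ l → δ l (GradedTensorProduct.of R 𝒜 𝒜 (a ⊗ₜ b)) = 0 := by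
        intro l hl
        rw [split]
        exact hδ.odd_mul l hl hi' hio hj' hjo ml mr
      rw [key _ (by omega), map_zero, map_zero]
      cases k with
      | succ k => rw [key _ (by omega), map_zero, map_zero, mul_zero]
      | zero =>
        rw [zero_add, hδ.one hn he hmem, GradedTensorProduct.of_symm_of,
          hA.hopf.slice_counit_tmul, hA.hopf.counit_of_mem hj'.ne' hb, zero_smul, mul_zero]

/-- Contraction with a `Γ`-primitive functional is a `Γ`-derivation. -/
theorem contract_dividedPower {p : ℤ} {φ : Module.Dual R A} (hφ : φ ∈ gammaPiece 𝒜 γ p) {n : ℤ}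
    (hn : 0 < n) (he : Even n) {a : A} (ha : a ∈ 𝒜 n) (k : ℕ) :
    contract 𝒜 φ (γ (k + 1) a) = contract 𝒜 φ a * γ k a := by
  obtain ⟨δ, hδ, hl, hr, hdiag⟩ := hA.diagonal
  have h := hA.slice_dividedPower hδ hl hr hφ hn he
    (of_mem_gradedTensorPiece (hA.hopf.comul_mem ha)) k
  have h1 := hdiag (k + 1) hn he ha
  have h2 := hdiag k hn he ha
  simp only at h1 h2
  rw [← h1, ← h2, GradedTensorProduct.of_symm_of, GradedTensorProduct.of_symm_of,
    GradedTensorProduct.of_symm_of, ← contract_apply, ← contract_apply, ← contract_apply,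
    hA.hopf.contract_counit] at h
  exact h

end IsGammaHopf

end GammaPrimitive

/-! ### The Lie algebra of `Γ`-primitive functionals: closure and grading. -/

section Functionals

variable {R : Type*} [CommRing R] {A : Type*} [Ring A] [Algebra R A]

theorem plainSlice_add_left {N : Type*} [AddCommGroup N] [Module R N] (φ ψ : Module.Dual R N)
    (t : A ⊗[R] N) : plainSlice (φ + ψ) t = plainSlice φ t + plainSlice ψ t := by
  simp [plainSlice, LinearMap.lTensor_add]

theorem plainSlice_smul_left {N : Type*} [AddCommGroup N] [Module R N] (r : R)
    (φ : Module.Dual R N) (t : A ⊗[R] N) : plainSlice (r • φ) t = r • plainSlice φ t := by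
  simp [plainSlice, LinearMap.lTensor_smul]

variable {𝒜 : ℤ → Submodule R A} [GradedAlgebra 𝒜]

theorem comp_signInvolution_eq {i : ℤ} {f : Module.Dual R A} (hf : f ∈ dualPiece 𝒜 i) :
    f ∘ₗ signInvolution 𝒜 = sgn R i • f := by
  refine linearMap_ext_homogeneous 𝒜 fun n a ha => ?_
  rw [LinearMap.comp_apply, signInvolution_apply 𝒜 ha, negOnePow_smul_eq (R := R), map_smul,
    LinearMap.smul_apply]
  by_cases hn : n = i
  · rw [hn]
  · rw [hf n hn a ha, smul_zero, smul_zero]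

end Functionals

section DualLieAlgebra

variable {R : Type*} [CommRing R] {A : Type*} [Ring A] [Algebra R A] [Coalgebra R A]

variable (𝒜 : ℤ → Submodule R A) [GradedAlgebra 𝒜]

/-- The graded commutator of functionals on `A`, for the product dual to the diagonal. -/
noncomputable def dualBracket : Module.Dual R A →ₗ[R] Module.Dual R A →ₗ[R] Module.Dual R A :=
  -- Omitting the signs in the second contraction supplies the factor `(-1)^{|f||g|}`, so the graded
  -- commutator is bilinear on all functionals, homogeneous or not.
  LinearMap.mk₂ R (fun f g => f ∘ₗ contract 𝒜 g - g ∘ₗ plainContract f)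
    (fun f f' g => by
      ext a; simp [plainContract, plainSlice_add_left]; ring)
    (fun r f g => by
      ext a; simp [plainContract, plainSlice_smul_left]; ring)
    (fun f g g' => by ext a; simp; ring)
    (fun r f g => by ext a; simp; ring)

variable {𝒜} {d : A →ₗ[R] A} {γ : ℕ → A → A}

namespace IsDGHopfAlgebra

variable (hopf : IsDGHopfAlgebra 𝒜 d)
include hopf

theorem dualBracket_eq {i j : ℤ} {f g : Module.Dual R A} (hf : f ∈ dualPiece 𝒜 i)
    (hg : g ∈ dualPiece 𝒜 j) : dualBracket 𝒜 f g =
      f ∘ₗ contract 𝒜 g - sgn R (i * j) • (g ∘ₗ contract 𝒜 f) := by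
  rw [dualBracket, LinearMap.mk₂_apply]
  congr 1
  refine linearMap_ext_homogeneous 𝒜 fun n a ha => ?_
  have h1 := hopf.contract_eq_plainContract hf ha
  have h2 : plainContract f a = sgn R (i * (n - i)) • contract 𝒜 f a := by
    rw [h1, smul_smul, sgn_mul_self, one_smul]
  rw [LinearMap.comp_apply, h2, LinearMap.smul_apply, LinearMap.comp_apply, map_smul]
  by_cases hn : n - i = j
  · rw [hn]
  · rw [hg _ hn _ (hopf.contract_mem hf ha), smul_zero, smul_zero]

theorem dualBracket_mem {i j : ℤ} {f g : Module.Dual R A} (hf : f ∈ dualPiece 𝒜 i)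
    (hg : g ∈ dualPiece 𝒜 j) : dualBracket 𝒜 f g ∈ dualPiece 𝒜 (i + j) := by
  rw [hopf.dualBracket_eq hf hg]
  refine sub_mem (hopf.comp_contract_mem hf hg) (Submodule.smul_mem _ _ ?_)
  rw [add_comm]
  exact hopf.comp_contract_mem hg hf

theorem contract_dualBracket {i j : ℤ} {f g : Module.Dual R A} (hf : f ∈ dualPiece 𝒜 i)
    (hg : g ∈ dualPiece 𝒜 j) : contract 𝒜 (dualBracket 𝒜 f g) =
      contract 𝒜 f * contract 𝒜 g - sgn R (i * j) • (contract 𝒜 g * contract 𝒜 f) := by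
  rw [hopf.dualBracket_eq hf hg, map_sub, map_smul, hopf.contract_comp hf hg,
    hopf.contract_comp hg hf]

/-- The differential of the dual becomes the graded commutator with `d`, which reduces its
properties to identities between commutators. -/
theorem contract_dualDifferential {i : ℤ} {f : Module.Dual R A} (hf : f ∈ dualPiece 𝒜 i) :
    contract 𝒜 (f ∘ₗ d ∘ₗ signInvolution 𝒜) =
      d * contract 𝒜 f - sgn R i • (contract 𝒜 f * d) := by
  rw [← LinearMap.comp_assoc, comp_signInvolution_eq (hopf.comp_d_mem hf), map_smul]
  ext a
  have h : contract 𝒜 (f ∘ₗ d) a = contract 𝒜 f (d a) - sgn R i • d (contract 𝒜 f a) :=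
    eq_sub_of_add_eq' (hopf.contract_d hf a).symm
  have e : sgn R (i - 1) = - sgn R i := by
    rw [sub_eq_add_neg, sgn_add, sgn_neg, sgn_one, mul_neg_one]
  simp only [LinearMap.smul_apply, h, e, LinearMap.sub_apply, Module.End.mul_apply, smul_sub,
    smul_smul, neg_mul, sgn_mul_self, neg_smul, one_smul]
  abel

theorem dualDifferential_mem {i : ℤ} {f : Module.Dual R A} (hf : f ∈ dualPiece 𝒜 i) :
    f ∘ₗ d ∘ₗ signInvolution 𝒜 ∈ dualPiece 𝒜 (i - 1) := by
  rw [← LinearMap.comp_assoc, comp_signInvolution_eq (hopf.comp_d_mem hf)]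
  exact Submodule.smul_mem _ _ (hopf.comp_d_mem hf)

end IsDGHopfAlgebra

namespace IsGammaHopf

variable (hA : IsGammaHopf 𝒜 d γ)
include hA

/-- Evaluated on `γ^{k+2}(a)`, the commutator is `g(a) f(γ^{k+1}(a))` minus the same with `f` and
`g` exchanged, up to sign. For `k ≥ 1` both vanish; for `k = 0` they cancel. -/
theorem dualBracket_mem {i j : ℤ} {f g : Module.Dual R A} (hf : f ∈ gammaPiece 𝒜 γ i)
    (hg : g ∈ gammaPiece 𝒜 γ j) : dualBracket 𝒜 f g ∈ gammaPiece 𝒜 γ (i + j) := by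
  have hopf := hA.hopf
  obtain ⟨hf1, hf2, hf3⟩ := id hf
  obtain ⟨hg1, hg2, hg3⟩ := id hg
  refine ⟨hopf.dualBracket_mem hf1 hg1, fun a b => ?_, fun m a k hm he ha => ?_⟩
  · rw [hopf.dualBracket_eq hf1 hg1]
    refine homogeneous_induction 𝒜 a (fun m a ha => ?_) fun a a' h h' => ?_
    · simp only [LinearMap.sub_apply, LinearMap.smul_apply, LinearMap.comp_apply,
        hopf.contract_mul hf1 hf2 ha, hopf.contract_mul hg1 hg2 ha, map_add, map_smul, hf2 _ _,
        hg2 _ _, hopf.counit_contract, smul_eq_mul]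
      have e1 : sgn R (j * m) * f a = sgn R (i * j) * f a := by
        by_cases h : m = i
        · rw [h, mul_comm j i]
        · rw [hf1 m h a ha, mul_zero, mul_zero]
      have e2 : sgn R (i * m) * g a = sgn R (i * j) * g a := by
        by_cases h : m = j
        · rw [h]
        · rw [hg1 m h a ha, mul_zero, mul_zero]
      have e3 : ∀ l : ℤ, sgn R (l * m) * Coalgebra.counit (R := R) a =
          Coalgebra.counit (R := R) a := by
        intro l
        by_cases h : m = 0
        · rw [h, mul_zero, sgn_zero, one_mul]
        · rw [hopf.counit_of_mem h ha, mul_zero]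
      linear_combination (g b) * e1 + f (contract 𝒜 g b) * e3 j -
        sgn R (i * j) * f b * e2 - sgn R (i * j) * g (contract 𝒜 f b) * e3 i -
        g a * f b * sgn_mul_self (R := R) (i * j)
    · rw [add_mul, map_add, h, h', map_add, map_add]; ring
  · rw [hopf.dualBracket_eq hf1 hg1]
    simp only [LinearMap.sub_apply, LinearMap.smul_apply, LinearMap.comp_apply,
      hA.contract_dividedPower hf hm he ha, hA.contract_dividedPower hg hm he ha, hf2 _ _,
      hg2 _ _, hopf.counit_contract]
    have hε : Coalgebra.counit (R := R) (γ (k + 1) a) = 0 :=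
      hopf.counit_of_mem (mul_pos (by positivity) hm).ne' (hA.dividedPowers.mem _ hm he ha)
    rw [hε]
    cases k with
    | succ k => rw [hf3 k hm he ha, hg3 k hm he ha]; simp
    | zero =>
      rw [zero_add, hA.dividedPowers.one hm he ha]
      -- If `f(a) ≠ 0` then `i = m` is even, so the commutator sign is `1` and the two products
      -- cancel.
      by_cases hi : m = i
      · subst hi
        rw [sgn_of_even (he.mul_right j)]
        simp [mul_comm]
      · rw [hf1 m hi a ha]
        simp

/-- `d γ^{k+2}(a) = d(a) γ^{k+1}(a)` is a product of two elements with zero augmentation, on which a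
primitive functional vanishes. -/
theorem dualDifferential_mem {i : ℤ} {f : Module.Dual R A} (hf : f ∈ gammaPiece 𝒜 γ i) :
    f ∘ₗ d ∘ₗ signInvolution 𝒜 ∈ gammaPiece 𝒜 γ (i - 1) := by
  have hopf := hA.hopf
  obtain ⟨hf1, hf2, hf3⟩ := hf
  refine ⟨hopf.dualDifferential_mem hf1, fun a b => ?_, fun m a k hm he ha => ?_⟩
  · refine homogeneous_induction 𝒜 a (fun m a ha => ?_) fun a a' h h' => ?_
    · refine homogeneous_induction 𝒜 b (fun l b hb => ?_) fun b b' h h' => ?_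
      · simp only [LinearMap.comp_apply, signInvolution_apply 𝒜 ha, signInvolution_apply 𝒜 hb,
          signInvolution_apply 𝒜 (SetLike.mul_mem_graded ha hb), negOnePow_smul_eq (R := R),
          map_smul, hopf.d_mul ha, map_add, hf2 _ _, hopf.counit_d, smul_eq_mul]
        have e1 : ∀ x : R, x * sgn R l * Coalgebra.counit (R := R) b =
            x * Coalgebra.counit (R := R) b := by
          intro x
          by_cases h : l = 0
          · rw [h, sgn_zero, mul_one]
          · rw [hopf.counit_of_mem h hb, mul_zero, mul_zero]
        have e2 : ∀ x : R, x * sgn R m * Coalgebra.counit (R := R) a =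
            x * Coalgebra.counit (R := R) a := by
          intro x
          by_cases h : m = 0
          · rw [h, sgn_zero, mul_one]
          · rw [hopf.counit_of_mem h ha, mul_zero, mul_zero]
        rw [sgn_add]
        linear_combination e1 (sgn R m * f (d a)) +
          e2 (sgn R m * sgn R l * f (d b)) + (sgn R l * f (d b) * Coalgebra.counit (R := R) a) *
            (sgn_mul_self (R := R) m) - e2 (sgn R m * sgn R l * f (d b))
      · rw [mul_add, map_add, h, h', map_add, map_add]; ring
    · rw [add_mul, map_add, h, h', map_add, map_add]; ring
  · have hmem := hA.dividedPowers.mem (k + 2) hm he ha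
    have hε : Coalgebra.counit (R := R) (γ (k + 1) a) = 0 :=
      hopf.counit_of_mem (mul_pos (by positivity) hm).ne' (hA.dividedPowers.mem _ hm he ha)
    rw [LinearMap.comp_apply, LinearMap.comp_apply, signInvolution_apply 𝒜 hmem,
      negOnePow_smul_eq (R := R), map_smul, map_smul, hA.d_dividedPower (k + 1) hm he ha, hf2, hε,
      hopf.counit_d, mul_zero, zero_mul, add_zero, smul_zero]

omit hA in
variable (𝒜 γ) in
/-- The `Γ`-primitive functionals of all degrees. -/
def carrier : Submodule R (Module.Dual R A) := ⨆ n, gammaPiece 𝒜 γ n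

omit hA in
variable (𝒜 γ) in
/-- The `Γ`-primitive functionals of degree `n`. -/
def degree (n : ℤ) : Submodule R (carrier 𝒜 γ) :=
  (gammaPiece 𝒜 γ n).comap (carrier 𝒜 γ).subtype

omit hA [GradedAlgebra 𝒜] in
theorem carrier_induction {P : carrier 𝒜 γ → Prop} (f : carrier 𝒜 γ)
    (mem : ∀ n, ∀ f ∈ degree 𝒜 γ n, P f) (add : ∀ f g, P f → P g → P (f + g)) : P f := by
  obtain ⟨f, hf⟩ := f
  unfold carrier at hf
  induction hf using Submodule.iSup_induction' with
  | mem i f hf => exact mem i _ hf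
  | zero => exact mem 0 _ (zero_mem _)
  | add f g hf hg h h' => exact add _ _ h h'

omit hA in
variable (𝒜 γ) in
theorem iSupIndep_degree : iSupIndep (degree 𝒜 γ) := by
  rw [iSupIndep_def]
  intro i
  rw [Submodule.disjoint_def]
  intro f hf hf'
  let T : carrier 𝒜 γ →ₗ[R] Module.Dual R A :=
    (LinearMap.lcomp R R (GradedAlgebra.proj 𝒜 i)) ∘ₗ (carrier 𝒜 γ).subtype
  have hT : ∀ g, T g = (g : Module.Dual R A) ∘ₗ GradedAlgebra.proj 𝒜 i := fun g => rfl
  have hle : (⨆ j, ⨆ (_ : j ≠ i), degree 𝒜 γ j) ≤ LinearMap.ker T := by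
    refine iSup₂_le fun j hj g hg => ?_
    rw [LinearMap.mem_ker, hT]
    refine linearMap_ext_homogeneous 𝒜 fun n a ha => ?_
    rw [LinearMap.comp_apply, GradedAlgebra.proj_apply, LinearMap.zero_apply]
    exact hg.1 i hj.symm _ (SetLike.coe_mem _)
  have h1 := hle hf'
  rw [LinearMap.mem_ker, hT] at h1
  have h2 : (f : Module.Dual R A) ∘ₗ GradedAlgebra.proj 𝒜 i = f := comp_proj_of_mem hf.1
  rw [h2] at h1
  exact Subtype.ext h1

omit hA [GradedAlgebra 𝒜] in
variable (𝒜 γ) in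
theorem iSup_degree : ⨆ n, degree 𝒜 γ n = ⊤ := by
  rw [eq_top_iff]
  intro f _
  refine carrier_induction (P := fun f => f ∈ ⨆ n, degree 𝒜 γ n) f (fun n f hf => ?_)
    fun f g hf hg => add_mem hf hg
  exact Submodule.mem_iSup_of_mem n hf

theorem dualBracket_mem_carrier {f g : Module.Dual R A} (hf : f ∈ carrier 𝒜 γ)
    (hg : g ∈ carrier 𝒜 γ) : dualBracket 𝒜 f g ∈ carrier 𝒜 γ := by
  refine carrier_induction (P := fun f => dualBracket 𝒜 f.1 g ∈ carrier 𝒜 γ) ⟨f, hf⟩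
    (fun i f hf => ?_) fun f f' h h' => ?_
  · refine carrier_induction (P := fun g => dualBracket 𝒜 f.1 g.1 ∈ carrier 𝒜 γ) ⟨g, hg⟩
      (fun j g hg => ?_) fun g g' h h' => ?_
    · exact Submodule.mem_iSup_of_mem (i + j) (hA.dualBracket_mem hf hg)
    · rw [Submodule.coe_add, map_add]; exact add_mem h h'
  · rw [Submodule.coe_add, map_add, LinearMap.add_apply]; exact add_mem h h'

theorem dualDifferential_mem_carrier {f : Module.Dual R A} (hf : f ∈ carrier 𝒜 γ) :
    f ∘ₗ d ∘ₗ signInvolution 𝒜 ∈ carrier 𝒜 γ := by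
  refine carrier_induction (P := fun f => f.1 ∘ₗ d ∘ₗ signInvolution 𝒜 ∈ carrier 𝒜 γ) ⟨f, hf⟩
    (fun i f hf => ?_) fun f f' h h' => ?_
  · exact Submodule.mem_iSup_of_mem (i - 1) (hA.dualDifferential_mem hf)
  · rw [Submodule.coe_add, LinearMap.add_comp]; exact add_mem h h'

theorem gammaPiece_eq_bot {n : ℤ} (hn : n ≤ 0) : gammaPiece 𝒜 γ n = ⊥ := by
  rw [Submodule.eq_bot_iff]
  rintro f ⟨h1, h2, _⟩
  refine linearMap_ext_homogeneous 𝒜 fun m a ha => ?_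
  by_cases hm : m = n
  · subst hm
    rcases hn.lt_or_eq with h | h
    · rw [hA.connected.1 m h, Submodule.mem_bot] at ha
      rw [ha, map_zero, map_zero]
    · exact hA.primitive_apply_zero h2 (h ▸ ha)
  · exact h1 m hm a ha

end IsGammaHopf

end DualLieAlgebra

/-! ### Lie identities for graded commutators in an associative algebra. -/

section GradedCommutators

variable {R : Type*} [CommRing R] {E : Type*} [Ring E] [Algebra R E]

theorem gradedCommutator_odd_cube (x : E) :
    x * (x * x - (-1 : R) • (x * x)) - (1 : R) • ((x * x - (-1 : R) • (x * x)) * x) = 0 := by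
  rw [neg_one_smul, one_smul]
  noncomm_ring

theorem gradedCommutator_antisymm (x y : E) (i j : ℤ) :
    x * y - sgn R (i * j) • (y * x) =
      -(sgn R (i * j) • (y * x - sgn R (j * i) • (x * y))) := by
  rw [mul_comm j i]
  obtain h | h := sgn_eq_or (R := R) (i * j) <;> rw [h] <;>
  simp only [one_smul, neg_smul] <;> noncomm_ring

theorem gradedCommutator_jacobi (x y z : E) (i j k : ℤ) :
    x * (y * z - sgn R (j * k) • (z * y)) -
      sgn R (i * (j + k)) • ((y * z - sgn R (j * k) • (z * y)) * x) =
    ((x * y - sgn R (i * j) • (y * x)) * z -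
      sgn R ((i + j) * k) • (z * (x * y - sgn R (i * j) • (y * x)))) +
    sgn R (i * j) • (y * (x * z - sgn R (i * k) • (z * x)) -
      sgn R (j * (i + k)) • ((x * z - sgn R (i * k) • (z * x)) * y)) := by
  rw [mul_add, add_mul, mul_add, sgn_add, sgn_add, sgn_add, mul_comm j i]
  obtain h1 | h1 := sgn_eq_or (R := R) (i * j) <;> obtain h2 | h2 := sgn_eq_or (R := R) (i * k) <;>
  obtain h3 | h3 := sgn_eq_or (R := R) (j * k) <;> rw [h1, h2, h3] <;>
  simp only [mul_one, mul_neg, one_smul, neg_smul, neg_neg, sub_neg_eq_add] <;>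
  noncomm_ring

theorem gradedCommutator_leibniz (d x y : E) (i j : ℤ) :
    d * (x * y - sgn R (i * j) • (y * x)) -
      sgn R (i + j) • ((x * y - sgn R (i * j) • (y * x)) * d) =
    ((d * x - sgn R i • (x * d)) * y - sgn R ((i - 1) * j) • (y * (d * x - sgn R i • (x * d)))) +
    sgn R i • (x * (d * y - sgn R j • (y * d)) -
      sgn R (i * (j - 1)) • ((d * y - sgn R j • (y * d)) * x)) := by
  have e1 : sgn R ((i - 1) * j) = sgn R (i * j) * sgn R j := by
    rw [sub_mul, sub_eq_add_neg, sgn_add, sgn_neg, one_mul]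
  have e2 : sgn R (i * (j - 1)) = sgn R (i * j) * sgn R i := by
    rw [mul_sub, sub_eq_add_neg, sgn_add, sgn_neg, mul_one]
  rw [e1, e2, sgn_add]
  obtain h1 | h1 := sgn_eq_or (R := R) (i * j) <;> obtain h2 | h2 := sgn_eq_or (R := R) i <;>
  obtain h3 | h3 := sgn_eq_or (R := R) j <;> rw [h1, h2, h3] <;>
  simp only [mul_one, mul_neg, one_smul, neg_smul, neg_neg, sub_neg_eq_add] <;>
  noncomm_ring

end GradedCommutators

/-! ### The Lie algebra laws, pulled back along `contract`. -/

section DualLieAlgebraLaws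

variable {R : Type*} [CommRing R] {A : Type*} [Ring A] [Algebra R A] [Coalgebra R A]
variable {𝒜 : ℤ → Submodule R A} [GradedAlgebra 𝒜] {d : A →ₗ[R] A} {γ : ℕ → A → A}

namespace IsDGHopfAlgebra

variable (hopf : IsDGHopfAlgebra 𝒜 d) {i j k : ℤ} {f g h : Module.Dual R A}
  (hf : f ∈ dualPiece 𝒜 i) (hg : g ∈ dualPiece 𝒜 j)
include hopf hf

theorem dualBracket_odd_cube (hi : Odd i) : dualBracket 𝒜 f (dualBracket 𝒜 f f) = 0 := by
  apply hopf.contract_injective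
  rw [hopf.contract_dualBracket hf (hopf.dualBracket_mem hf hf), hopf.contract_dualBracket hf hf,
    sgn_of_odd (hi.mul hi), sgn_of_even ((Even.add_self i).mul_left i), map_zero]
  exact gradedCommutator_odd_cube _

include hg

theorem dualBracket_antisymm :
    dualBracket 𝒜 f g = -(sgn R (i * j) • dualBracket 𝒜 g f) := by
  apply hopf.contract_injective
  rw [map_neg, map_smul, hopf.contract_dualBracket hf hg, hopf.contract_dualBracket hg hf]
  exact gradedCommutator_antisymm _ _ i j

theorem dualBracket_jacobi (hh : h ∈ dualPiece 𝒜 k) :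
    dualBracket 𝒜 f (dualBracket 𝒜 g h) = dualBracket 𝒜 (dualBracket 𝒜 f g) h +
      sgn R (i * j) • dualBracket 𝒜 g (dualBracket 𝒜 f h) := by
  apply hopf.contract_injective
  rw [map_add, map_smul, hopf.contract_dualBracket hf (hopf.dualBracket_mem hg hh),
    hopf.contract_dualBracket (hopf.dualBracket_mem hf hg) hh,
    hopf.contract_dualBracket hg (hopf.dualBracket_mem hf hh),
    hopf.contract_dualBracket hf hg, hopf.contract_dualBracket hf hh,
    hopf.contract_dualBracket hg hh]
  exact gradedCommutator_jacobi _ _ _ i j k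

theorem dualBracket_leibniz : dualBracket 𝒜 f g ∘ₗ d ∘ₗ signInvolution 𝒜 =
    dualBracket 𝒜 (f ∘ₗ d ∘ₗ signInvolution 𝒜) g +
      sgn R i • dualBracket 𝒜 f (g ∘ₗ d ∘ₗ signInvolution 𝒜) := by
  apply hopf.contract_injective
  rw [map_add, map_smul, hopf.contract_dualDifferential (hopf.dualBracket_mem hf hg),
    hopf.contract_dualBracket hf hg,
    hopf.contract_dualBracket (hopf.dualDifferential_mem hf) hg,
    hopf.contract_dualBracket hf (hopf.dualDifferential_mem hg),
    hopf.contract_dualDifferential hf, hopf.contract_dualDifferential hg]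
  exact gradedCommutator_leibniz d _ _ i j

end IsDGHopfAlgebra

theorem IsDGHopfAlgebra.dualDifferential_dualDifferential (hopf : IsDGHopfAlgebra 𝒜 d)
    (f : Module.Dual R A) :
    (f ∘ₗ d ∘ₗ signInvolution 𝒜) ∘ₗ d ∘ₗ signInvolution 𝒜 = 0 := by
  refine linearMap_ext_homogeneous 𝒜 fun n a ha => ?_
  simp only [LinearMap.comp_apply, signInvolution_apply 𝒜 ha, negOnePow_smul_eq (R := R),
    map_smul, signInvolution_apply 𝒜 (hopf.d_mem ha), hopf.d_d, map_zero, smul_zero]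
  rfl

namespace IsGammaHopf

variable (𝒜 γ) in
theorem isInternal_degree : DirectSum.IsInternal (degree 𝒜 γ) := by
  have h := DirectSum.isInternal_submodule_of_iSupIndep_of_iSup_eq_top (R := R)
    (M := carrier 𝒜 γ) (A := degree 𝒜 γ) (iSupIndep_degree 𝒜 γ)
  have h' := h (iSup_degree 𝒜 γ)
  exact h'

/-- A functional of degree `n` is determined by its restriction to `𝒜 n`, so the piece embeds in a
Noetherian module. -/
theorem finite_degree (h𝒜 : ∀ n, Module.Finite R (Module.Dual R (𝒜 n))) [IsNoetherianRing R]
    (n : ℤ) : Module.Finite R (degree 𝒜 γ n) := by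
  let T : degree 𝒜 γ n →ₗ[R] Module.Dual R (𝒜 n) :=
    LinearMap.lcomp R R (𝒜 n).subtype ∘ₗ (carrier 𝒜 γ).subtype ∘ₗ (degree 𝒜 γ n).subtype
  have hT : ∀ f a, T f a = f.1.1 a := fun f a => rfl
  have : IsNoetherian R (Module.Dual R (𝒜 n)) := isNoetherian_of_isNoetherianRing_of_finite R _
  refine Module.Finite.of_injective T fun f g hfg => ?_
  refine Subtype.ext (Subtype.ext (linearMap_ext_homogeneous 𝒜 fun m a ha => ?_))
  by_cases hm : m = n
  · subst hm
    have := LinearMap.congr_fun hfg ⟨a, ha⟩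
    rwa [hT, hT] at this
  · have h1 : (f.1.1 : Module.Dual R A) ∈ gammaPiece 𝒜 γ n := f.2
    have h2 : (g.1.1 : Module.Dual R A) ∈ gammaPiece 𝒜 γ n := g.2
    rw [h1.1 m hm a ha, h2.1 m hm a ha]

variable (hA : IsGammaHopf 𝒜 d γ)

/-- The bracket of `Γ`-primitive functionals. -/
noncomputable def bracket : carrier 𝒜 γ →ₗ[R] carrier 𝒜 γ →ₗ[R] carrier 𝒜 γ :=
  LinearMap.mk₂ R (fun f g => ⟨dualBracket 𝒜 f.1 g.1, hA.dualBracket_mem_carrier f.2 g.2⟩)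
    (fun _ _ _ => Subtype.ext (by simp))
    (fun _ _ _ => Subtype.ext (by simp))
    (fun _ _ _ => Subtype.ext (by simp))
    (fun _ _ _ => Subtype.ext (by simp))

/-- The differential of `Γ`-primitive functionals. -/
noncomputable def del : carrier 𝒜 γ →ₗ[R] carrier 𝒜 γ where
  toFun f := ⟨f.1 ∘ₗ d ∘ₗ signInvolution 𝒜, hA.dualDifferential_mem_carrier f.2⟩
  map_add' _ _ := rfl
  map_smul' _ _ := rfl

theorem bracket_odd_cube {i : ℤ} {f : carrier 𝒜 γ} (hf : f ∈ degree 𝒜 γ i) (hi : Odd i) :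
    hA.bracket f (hA.bracket f f) = 0 :=
  Subtype.ext (hA.hopf.dualBracket_odd_cube hf.1 hi)

theorem bracket_antisymm {i j : ℤ} {f g : carrier 𝒜 γ} (hf : f ∈ degree 𝒜 γ i)
    (hg : g ∈ degree 𝒜 γ j) : hA.bracket f g = -(sgn R (i * j) • hA.bracket g f) :=
  Subtype.ext (hA.hopf.dualBracket_antisymm hf.1 hg.1)

theorem bracket_jacobi {i j : ℤ} {f g : carrier 𝒜 γ} (hf : f ∈ degree 𝒜 γ i)
    (hg : g ∈ degree 𝒜 γ j) (h : carrier 𝒜 γ) : hA.bracket f (hA.bracket g h) =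
      hA.bracket (hA.bracket f g) h + sgn R (i * j) • hA.bracket g (hA.bracket f h) := by
  refine carrier_induction (P := fun h => hA.bracket f (hA.bracket g h) =
      hA.bracket (hA.bracket f g) h + sgn R (i * j) • hA.bracket g (hA.bracket f h))
    h (fun k h hh => ?_) fun h h' e e' => ?_
  · exact Subtype.ext (hA.hopf.dualBracket_jacobi hf.1 hg.1 hh.1)
  · simp only [map_add, smul_add, e, e']
    abel

theorem del_bracket {i : ℤ} {f : carrier 𝒜 γ} (hf : f ∈ degree 𝒜 γ i) (g : carrier 𝒜 γ) :
    hA.del (hA.bracket f g) = hA.bracket (hA.del f) g + sgn R i • hA.bracket f (hA.del g) := by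
  refine carrier_induction (P := fun g => hA.del (hA.bracket f g) =
      hA.bracket (hA.del f) g + sgn R i • hA.bracket f (hA.del g))
    g (fun j g hg => ?_) fun g g' e e' => ?_
  · exact Subtype.ext (hA.hopf.dualBracket_leibniz hf.1 hg.1)
  · simp only [map_add, smul_add, e, e']
    abel

end IsGammaHopf

end DualLieAlgebraLaws

/-! ### The differential Lie algebra attached to `A`. -/

section LieAlgebra

variable {R : Type u} [CommRing R] [IsNoetherianRing R]
  {A : Type v} [Ring A] [Algebra R A] [Coalgebra R A]
variable {𝒜 : ℤ → Submodule R A} [GradedAlgebra 𝒜] {d : A →ₗ[R] A} {γ : ℕ → A → A}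

namespace IsGammaHopf

/-- The differential Lie algebra of `Γ`-primitive functionals on `A`. -/
noncomputable def lieAlgebra (hA : IsGammaHopf 𝒜 d γ)
    (h𝒜 : ∀ n, Module.Finite R (Module.Dual R (𝒜 n))) : DGLieAlgebra.{u, max u v} R where
  carrier := carrier 𝒜 γ
  deg := degree 𝒜 γ
  decomposition := (isInternal_degree 𝒜 γ).chooseDecomposition
  deg_neg n hn := by
    rw [Submodule.eq_bot_iff]
    intro f hf
    have h : (f : Module.Dual R A) ∈ gammaPiece 𝒜 γ n := hf
    rw [hA.gammaPiece_eq_bot hn.le, Submodule.mem_bot] at h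
    exact Subtype.ext h
  finite_deg := finite_degree h𝒜
  bracket := hA.bracket
  bracket_mem _ _ _ _ hf hg := hA.dualBracket_mem hf hg
  antisymm _ _ _ _ hf hg := by
    rw [negOnePow_smul_eq (R := R)]
    exact hA.bracket_antisymm hf hg
  jacobi _ _ _ _ hf hg h := by
    rw [negOnePow_smul_eq (R := R)]
    exact hA.bracket_jacobi hf hg h
  odd_cube _ _ hi hf := hA.bracket_odd_cube hf hi
  del := hA.del
  del_mem _ _ hf := hA.dualDifferential_mem hf
  del_del f := Subtype.ext (hA.hopf.dualDifferential_dualDifferential f.1)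
  leibniz _ _ hf g := by
    rw [negOnePow_smul_eq (R := R)]
    exact hA.del_bracket hf g

variable (hA : IsGammaHopf 𝒜 d γ) (h𝒜 : ∀ n, Module.Finite R (Module.Dual R (𝒜 n)))

/-- The inclusion of the `Γ`-primitive functionals in all functionals. -/
noncomputable def toDual : (hA.lieAlgebra h𝒜).carrier →ₗ[R] Module.Dual R A :=
  (carrier 𝒜 γ).subtype

theorem toDual_mem {n : ℤ} {x : (hA.lieAlgebra h𝒜).carrier} (hx : x ∈ (hA.lieAlgebra h𝒜).deg n) :
    hA.toDual h𝒜 x ∈ gammaPiece 𝒜 γ n := hx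

theorem exists_toDual_eq {n : ℤ} {f : Module.Dual R A} (hf : f ∈ gammaPiece 𝒜 γ n) :
    ∃ x ∈ (hA.lieAlgebra h𝒜).deg n, hA.toDual h𝒜 x = f :=
  ⟨⟨f, Submodule.mem_iSup_of_mem n hf⟩, hf, rfl⟩

theorem toDual_injective : Function.Injective (hA.toDual h𝒜) := Subtype.val_injective

theorem toDual_bracket (x y : (hA.lieAlgebra h𝒜).carrier) :
    hA.toDual h𝒜 ((hA.lieAlgebra h𝒜).bracket x y) =
      dualBracket 𝒜 (hA.toDual h𝒜 x) (hA.toDual h𝒜 y) := rfl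

theorem toDual_del (x : (hA.lieAlgebra h𝒜).carrier) :
    hA.toDual h𝒜 ((hA.lieAlgebra h𝒜).del x) =
      hA.toDual h𝒜 x ∘ₗ d ∘ₗ signInvolution 𝒜 := rfl

end IsGammaHopf

end LieAlgebra

/-! ### The enveloping algebra acting on `A`, and the pairing it defines. -/

section EnvAction

open DGLieAlgebra DGLieAlgebra.Env

variable {R : Type*} [CommRing R] {A : Type*} [Ring A] [Algebra R A] [Coalgebra R A]

/-- `τ` is a morphism of differential Lie algebras from `L` to the primitive functionals on `A`. -/
structure IsPrimitiveRepresentation (𝒜 : ℤ → Submodule R A) [GradedAlgebra 𝒜] (d : A →ₗ[R] A)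
    (L : DGLieAlgebra R) (τ : L.carrier →ₗ[R] Module.Dual R A) : Prop where
  mem : ∀ ⦃n : ℤ⦄ ⦃x : L.carrier⦄, x ∈ L.deg n → τ x ∈ dualPiece 𝒜 n
  primitive : ∀ ⦃n : ℤ⦄ ⦃x : L.carrier⦄, x ∈ L.deg n → IsPrimitiveFunctional R (τ x)
  bracket : ∀ x y : L.carrier, τ (L.bracket x y) = dualBracket 𝒜 (τ x) (τ y)
  del : ∀ x : L.carrier, τ (L.del x) = τ x ∘ₗ d ∘ₗ signInvolution 𝒜

variable {𝒜 : ℤ → Submodule R A} [GradedAlgebra 𝒜] {d : A →ₗ[R] A}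
  {L : DGLieAlgebra R} {τ : L.carrier →ₗ[R] Module.Dual R A}

namespace IsPrimitiveRepresentation

variable (hτ : IsPrimitiveRepresentation 𝒜 d L τ) (hopf : IsDGHopfAlgebra 𝒜 d)

/-- The action of `UL` on `A` that extends the contractions with primitive functionals. -/
noncomputable def action : L.Env →ₐ[R] Module.End R A :=
  Env.lift (contract 𝒜 ∘ₗ τ) fun i j x y hx hy => by
    have h : contract 𝒜 (τ (L.bracket x y)) = contract 𝒜 (τ x) * contract 𝒜 (τ y) -
        sgn R (i * j) • (contract 𝒜 (τ y) * contract 𝒜 (τ x)) := by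
      rw [hτ.bracket, hopf.contract_dualBracket (hτ.mem hx) (hτ.mem hy)]
    exact (sub_eq_iff_eq_add.1 h.symm)

theorem action_ι (x : L.carrier) : hτ.action hopf (ι L x) = contract 𝒜 (τ x) :=
  Env.lift_ι L _ _ x

theorem action_ι_mul (x : L.carrier) (u : L.Env) (a : A) :
    hτ.action hopf (ι L x * u) a = contract 𝒜 (τ x) (hτ.action hopf u a) := by
  rw [map_mul, action_ι, Module.End.mul_apply]

/-- The functional on `A` given by an element of `UL`. -/
noncomputable def pairing : L.Env →ₗ[R] Module.Dual R A :=
  LinearMap.compRight R Coalgebra.counit ∘ₗ (hτ.action hopf).toLinearMap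

theorem pairing_apply (u : L.Env) (a : A) :
    hτ.pairing hopf u a = Coalgebra.counit (hτ.action hopf u a) := rfl

theorem pairing_one : hτ.pairing hopf 1 = Coalgebra.counit := by
  ext a
  rw [pairing_apply, map_one, Module.End.one_apply]

theorem action_mem {n m : ℤ} {u : L.Env} (hu : u ∈ piece L n) {a : A} (ha : a ∈ 𝒜 m) :
    hτ.action hopf u a ∈ 𝒜 (m - n) := by
  induction hu using Submodule.span_induction with
  | mem u h =>
    obtain ⟨l, rfl, rfl⟩ := h
    induction l with
    | nil => simpa using ha
    | cons x l ih =>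
      simp only [List.map_cons, List.prod_cons, List.sum_cons] at ih ⊢
      rw [action_ι_mul]
      have := hopf.contract_mem (hτ.mem x.2.2) ih
      rwa [sub_sub, add_comm _ x.1] at this
  | zero => simp
  | add u w _ _ hu hw => rw [map_add, LinearMap.add_apply]; exact add_mem hu hw
  | smul r u _ hu => rw [map_smul, LinearMap.smul_apply]; exact Submodule.smul_mem _ r hu

theorem pairing_mem {n : ℤ} {u : L.Env} (hu : u ∈ piece L n) :
    hτ.pairing hopf u ∈ dualPiece 𝒜 n := by
  intro m hm a ha
  exact hopf.counit_of_mem (sub_ne_zero.2 hm) (hτ.action_mem hopf hu ha)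

theorem pairing_mem_gradedDual (u : L.Env) : hτ.pairing hopf u ∈ gradedDual 𝒜 := by
  refine homogeneous_induction (piece L) u (fun n u hu => ?_) fun u w hu hw => ?_
  · exact dualPiece_le_gradedDual n (hτ.pairing_mem hopf hu)
  · rw [map_add]; exact add_mem hu hw

include hopf in
omit τ hτ in
theorem _root_.IsDGHopfAlgebra.contract_comp' {φ ψ : Module.Dual R A} {p : ℤ}
    (hφ : φ ∈ dualPiece 𝒜 p) (hψ : ψ ∈ gradedDual 𝒜) :
    contract 𝒜 (φ ∘ₗ contract 𝒜 ψ) = contract 𝒜 φ * contract 𝒜 ψ := by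
  unfold gradedDual at hψ
  induction hψ using Submodule.iSup_induction' with
  | mem i ψ hψ => exact hopf.contract_comp hφ hψ
  | zero => simp
  | add ψ ψ' _ _ h h' => rw [map_add, LinearMap.comp_add, map_add, h, h', mul_add]

/-- The action of `u` is recovered from the functional it defines; hence the pairing turns products
of `UL` into products of the dual. -/
theorem action_eq_contract (u : L.Env) : hτ.action hopf u = contract 𝒜 (hτ.pairing hopf u) := by
  induction u using Env.induction_left with
  | one => rw [map_one, pairing_one, hopf.contract_counit]
  | ι_mul i x hx u hu =>
    have h : hτ.pairing hopf (ι L x * u) = τ x ∘ₗ contract 𝒜 (hτ.pairing hopf u) := by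
      ext a
      rw [pairing_apply, action_ι_mul, hopf.counit_contract, hu, LinearMap.comp_apply]
    rw [h, hopf.contract_comp' (hτ.mem hx) (hτ.pairing_mem_gradedDual hopf u), map_mul, action_ι,
      ← hu]
  | add u w hu hw => rw [map_add, map_add, map_add, hu, hw]
  | smul r u hu => rw [map_smul, map_smul, map_smul, hu]

theorem pairing_mul (u w : L.Env) :
    hτ.pairing hopf (u * w) = hτ.pairing hopf u ∘ₗ contract 𝒜 (hτ.pairing hopf w) := by
  ext a
  rw [pairing_apply, map_mul, Module.End.mul_apply, LinearMap.comp_apply, ← action_eq_contract,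
    pairing_apply]

theorem action_one (u : L.Env) : hτ.action hopf u 1 = counit L u • (1 : A) := by
  induction u using Env.induction_left with
  | one => simp
  | ι_mul i x hx u hu =>
    rw [action_ι_mul, hu, map_smul, hopf.contract_one (hτ.mem hx) (hτ.primitive hx), map_mul,
      counit_ι, zero_mul, smul_zero, zero_smul]
  | add u w hu hw => rw [map_add, LinearMap.add_apply, hu, hw, map_add, add_smul]
  | smul r u hu => rw [map_smul, LinearMap.smul_apply, hu, map_smul, smul_assoc]

/-- On `L` this is `contract_dualDifferential`, and both sides satisfy the same Leibniz rule in `u`.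
-/
theorem action_del {n : ℤ} {u : L.Env} (hu : u ∈ piece L n) : hτ.action hopf (Env.del L u) =
    d ∘ₗ hτ.action hopf u - sgn R n • (hτ.action hopf u ∘ₗ d) := by
  induction hu using Submodule.span_induction with
  | mem u h =>
    obtain ⟨l, rfl, rfl⟩ := h
    induction l with
    | nil =>
      have h : Env.del L (1 : L.Env) = 0 := by
        have := del_mul L (SetLike.GradedOne.one_mem (A := piece L)) 1
        simpa using this
      ext a
      simp [h]
    | cons x l ih =>
      simp only [List.map_cons, List.prod_cons, List.sum_cons] at ih ⊢
      have h1 := hopf.contract_dualDifferential (hτ.mem x.2.2)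
      rw [← hτ.del] at h1
      rw [del_mul L (ι_mem L x.2.2), del_ι, negOnePow_smul_eq (R := R), map_add, map_smul, map_mul,
        map_mul, map_mul, action_ι, action_ι, ih, h1, sgn_add]
      generalize contract 𝒜 (τ x.2) = T
      generalize hτ.action hopf (l.map fun x => ι L (x.2 : L.carrier)).prod = S
      ext a
      simp only [LinearMap.add_apply, LinearMap.sub_apply, LinearMap.smul_apply,
        Module.End.mul_apply, LinearMap.comp_apply, map_sub, map_smul, smul_sub, mul_smul]
      abel
  | zero => simp
  | add u w _ _ hu hw =>
    rw [map_add, map_add, hu, hw, map_add, LinearMap.comp_add, LinearMap.add_comp, smul_add]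
    abel
  | smul r u _ hu =>
    rw [map_smul, map_smul, hu, map_smul, LinearMap.comp_smul, LinearMap.smul_comp, smul_sub,
      smul_comm r]

theorem pairing_del (u : L.Env) :
    hτ.pairing hopf (Env.del L u) = hτ.pairing hopf u ∘ₗ d ∘ₗ signInvolution 𝒜 := by
  refine homogeneous_induction (piece L) u (fun n u hu => ?_) fun u w hu hw => ?_
  · rw [← LinearMap.comp_assoc, comp_signInvolution_eq (hopf.comp_d_mem (hτ.pairing_mem hopf hu))]
    ext a
    rw [pairing_apply, hτ.action_del hopf hu, LinearMap.sub_apply, map_sub, LinearMap.comp_apply,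
      hopf.counit_d, LinearMap.smul_apply, map_smul]
    have e : sgn R (n - 1) = - sgn R n := by
      rw [sub_eq_add_neg, sgn_add, sgn_neg, sgn_one, mul_neg_one]
    simp [pairing_apply, e]
  · rw [map_add, map_add, hu, hw, map_add, LinearMap.add_comp]

/-- The action of `UL ⊗ UL` on a product `a b`, with `a` of degree `m`. -/
noncomputable def tensorAction (m : ℤ) (a b : A) : (L.Env ⊗[R] L.Env) →ₗ[R] A :=
  LinearMap.mul' R A ∘ₗ TensorProduct.map
    (LinearMap.applyₗ a ∘ₗ (hτ.action hopf).toLinearMap)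
    (LinearMap.applyₗ b ∘ₗ (hτ.action hopf).toLinearMap ∘ₗ signPow (piece L) m)

theorem tensorAction_tmul {m : ℤ} (a b : A) {q : ℤ} (u : L.Env) {w : L.Env}
    (hw : w ∈ piece L q) : hτ.tensorAction hopf m a b (u ⊗ₜ w) =
      sgn R (m * q) • (hτ.action hopf u a * hτ.action hopf w b) := by
  simp [tensorAction, signPow_apply (piece L) m hw]

/-- This is the Leibniz rule for `x` applied to `(u a)(w b)`; the sign in `tensorAction` comes from
moving `w` past `a`. -/
theorem contract_tensorAction {m : ℤ} {a : A} (ha : a ∈ 𝒜 m) (b : A) {i : ℤ} {x : L.carrier}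
    (hx : x ∈ L.deg i) (t : L.Env ⊗[R] L.Env) :
    hτ.tensorAction hopf m a b ((GradedTensorProduct.of R (piece L) (piece L)).symm
      (GradedTensorProduct.of R (piece L) (piece L) (ι L x ⊗ₜ 1 + 1 ⊗ₜ ι L x) *
        GradedTensorProduct.of R (piece L) (piece L) t)) =
      contract 𝒜 (τ x) (hτ.tensorAction hopf m a b t) := by
  refine tensor_induction (piece L) (P := fun t => hτ.tensorAction hopf m a b
    ((GradedTensorProduct.of R (piece L) (piece L)).symm
      (GradedTensorProduct.of R (piece L) (piece L) (ι L x ⊗ₜ 1 + 1 ⊗ₜ ι L x) *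
        GradedTensorProduct.of R (piece L) (piece L) t)) =
      contract 𝒜 (τ x) (hτ.tensorAction hopf m a b t)) t (fun p q u hu w hw => ?_)
    fun s t hs ht => ?_
  · have one : (1 : L.Env) ∈ piece L 0 := SetLike.GradedOne.one_mem
    rw [map_add, add_mul, of_tmul_mul (piece L) _ _ one hu,
      of_tmul_mul (piece L) _ _ (ι_mem L hx) hu, map_add, map_smul, map_smul,
      GradedTensorProduct.of_symm_of, GradedTensorProduct.of_symm_of, map_add, map_smul, map_smul,
      one_mul, one_mul, hτ.tensorAction_tmul hopf a b _ hw,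
      hτ.tensorAction_tmul hopf a b _ (SetLike.mul_mem_graded (ι_mem L hx) hw),
      hτ.tensorAction_tmul hopf a b _ hw, map_smul,
      hopf.contract_mul (hτ.mem hx) (hτ.primitive hx) (hτ.action_mem hopf hu ha), action_ι_mul,
      action_ι_mul, zero_mul, sgn_zero, one_smul, smul_add, smul_smul, smul_smul]
    congr 2
    rw [← sgn_add, ← sgn_add]
    exact sgn_congr (i * p) (by ring)
  · rw [map_add (GradedTensorProduct.of R (piece L) (piece L)) s t, mul_add, map_add, map_add, hs,
      ht, map_add, map_add]

/-- `A` is a module algebra over `UL`. Followed by `ε`, this is the duality between the diagonal of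
`UL` and the product of `A`. -/
theorem action_apply_mul {m : ℤ} {a : A} (ha : a ∈ 𝒜 m) (b : A) (u : L.Env) :
    hτ.action hopf u (a * b) = hτ.tensorAction hopf m a b (comul L u) := by
  induction u using Env.induction_left with
  | one =>
    have h : comul L 1 = (1 : L.Env) ⊗ₜ[R] (1 : L.Env) := by
      rw [comul, LinearMap.comp_apply, AlgHom.toLinearMap_apply, map_one]; rfl
    rw [h, hτ.tensorAction_tmul hopf a b 1 SetLike.GradedOne.one_mem]
    simp
  | ι_mul i x hx u hu =>
    rw [action_ι_mul, hu, ← hτ.contract_tensorAction hopf ha b hx, ← comul_ι]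
    simp [comul]
  | add u w hu hw => simp only [map_add, LinearMap.add_apply, hu, hw]
  | smul r u hu => simp only [map_smul, LinearMap.smul_apply, hu]

variable (e : L.Env ≃ₗ[R] gradedDual 𝒜)
  (he : ∀ u, (e u : Module.Dual R A) = hτ.pairing hopf u)
include he

theorem dualTensor_map {m : ℤ} {a : A} (ha : a ∈ 𝒜 m) (b : A) (t : L.Env ⊗[R] L.Env) :
    dualTensor 𝒜 (TensorProduct.map e.toLinearMap e.toLinearMap t) (a ⊗ₜ[R] b) =
      Coalgebra.counit (R := R) (hτ.tensorAction hopf m a b t) := by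
  refine tensor_induction (piece L) (P := fun t =>
    dualTensor 𝒜 (TensorProduct.map e.toLinearMap e.toLinearMap t) (a ⊗ₜ[R] b) =
      Coalgebra.counit (R := R) (hτ.tensorAction hopf m a b t)) t (fun p q u hu w hw => ?_)
    fun s t hs ht => ?_
  · rw [TensorProduct.map_tmul, dualTensor_tmul_apply, hτ.tensorAction_tmul hopf a b u hw, map_smul,
      hopf.counit_mul, ← pairing_apply, ← pairing_apply, LinearEquiv.coe_coe, he, he]
    refine homogeneous_induction 𝒜 b (fun n b hb => ?_) fun b b' h h' => ?_
    · rw [slice_tmul 𝒜 _ ha hb, map_smul, smul_eq_mul, smul_eq_mul]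
      by_cases hn : n = q
      · rw [hn]; ring
      · rw [hτ.pairing_mem hopf hw n hn b hb]; ring
    · rw [TensorProduct.tmul_add, map_add, map_add, h, h', map_add, mul_add, smul_add]
  · rw [map_add, map_add, map_add, ← hs, ← ht]
    simp only [dualTensor, map_add, LinearMap.add_comp, LinearMap.add_apply]

/-- If the functionals of the elements of `UL` are the elements of the graded dual of `A`, then
`UL` is the dual of `A`. -/
noncomputable def isoToDual
    (mem_iff : ∀ n u, hτ.pairing hopf u ∈ dualPiece 𝒜 n → u ∈ piece L n) :
    IsoToDual 𝒜 d (piece L) (comul L) (counit L).toLinearMap (Env.del L) where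
  equiv := e
  mem_iff n u := by
    rw [he]
    exact ⟨hτ.pairing_mem hopf, mem_iff n u⟩
  map_one := by rw [he, pairing_one]
  map_mul u w := by
    ext a
    rw [dualMul_apply, he, he, he, pairing_mul, LinearMap.comp_apply]
  map_counit u := by
    rw [he, pairing_apply, action_one, map_smul, hopf.counit_one, smul_eq_mul, mul_one]
    rfl
  map_comul u a b := by
    refine homogeneous_induction 𝒜 a (fun m a ha => ?_) fun a a' h h' => ?_
    · rw [hτ.dualTensor_map hopf e he ha, he, pairing_apply, hτ.action_apply_mul hopf ha]
    · rw [TensorProduct.add_tmul, map_add, h, h', add_mul, map_add]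
  map_d u := by
    rw [he, pairing_del, dualDifferential, he]

end IsPrimitiveRepresentation

end EnvAction

theorem isUnit_sgn {R : Type*} [CommRing R] (n : ℤ) : IsUnit (sgn R n) :=
  IsUnit.of_mul_eq_one _ (sgn_mul_self n)

/-! ### The weight filtration. -/

section WeightFiltration

variable {R : Type*} [CommRing R] {A : Type*} [Ring A] [Algebra R A] [Coalgebra R A]

/-- The elements of weight at least `w`: those that fewer than `w` contractions with `Γ`-primitive
functionals followed by the augmentation send to zero. -/
noncomputable def weightFiltration (𝒜 : ℤ → Submodule R A) [GradedAlgebra 𝒜] (γ : ℕ → A → A) :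
    ℕ → Submodule R A
  | 0 => ⊤
  | w + 1 => LinearMap.ker (Coalgebra.counit (R := R) (A := A)) ⊓
      ⨅ n, ⨅ φ : gammaPiece 𝒜 γ n, (weightFiltration 𝒜 γ w).comap (contract 𝒜 (φ : Module.Dual R A))

variable {𝒜 : ℤ → Submodule R A} [GradedAlgebra 𝒜] {d : A →ₗ[R] A} {γ : ℕ → A → A}

theorem mem_weightFiltration_zero (a : A) : a ∈ weightFiltration 𝒜 γ 0 := Submodule.mem_top

theorem mem_weightFiltration_succ {w : ℕ} {a : A} : a ∈ weightFiltration 𝒜 γ (w + 1) ↔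
    Coalgebra.counit (R := R) a = 0 ∧
      ∀ n, ∀ φ ∈ gammaPiece 𝒜 γ n, contract 𝒜 φ a ∈ weightFiltration 𝒜 γ w := by
  simp [weightFiltration]

theorem weightFiltration_succ_le (w : ℕ) :
    weightFiltration 𝒜 γ (w + 1) ≤ weightFiltration 𝒜 γ w := by
  induction w with
  | zero => exact fun a _ => mem_weightFiltration_zero a
  | succ w ih =>
    intro a ha
    rw [mem_weightFiltration_succ] at ha ⊢
    exact ⟨ha.1, fun n φ hφ => ih (ha.2 n φ hφ)⟩

theorem weightFiltration_antitone : Antitone (weightFiltration 𝒜 γ) :=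
  antitone_nat_of_succ_le weightFiltration_succ_le

theorem counit_contract_list_eq_zero {ι : Type*} {deg : ι → ℤ} {x : ι → Module.Dual R A}
    (hx : ∀ i, x i ∈ gammaPiece 𝒜 γ (deg i)) (l : List ι) {w : ℕ} (hw : l.length < w) {a : A}
    (ha : a ∈ weightFiltration 𝒜 γ w) :
    Coalgebra.counit (R := R) ((l.map fun i => contract 𝒜 (x i)).prod a) = 0 := by
  induction l using List.reverseRecOn generalizing w a with
  | nil =>
    obtain ⟨w, rfl⟩ : ∃ k, w = k + 1 := ⟨w - 1, by simp at hw; omega⟩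
    exact (mem_weightFiltration_succ.1 ha).1
  | append_singleton l i ih =>
    obtain ⟨w, rfl⟩ : ∃ k, w = k + 1 := ⟨w - 1, by simp at hw; omega⟩
    rw [List.map_append, List.prod_append, Module.End.mul_apply]
    refine ih (w := w) (by simpa using hw) ?_
    simpa using (mem_weightFiltration_succ.1 ha).2 _ _ (hx i)

namespace IsDGHopfAlgebra

variable (hopf : IsDGHopfAlgebra 𝒜 d)
include hopf

/-- Induction on `p + q`: by the Leibniz rule a contraction lowers the weight of only one factor in
each term. A factor of weight `0` has nothing to lose, and the weight is taken from the other. -/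
theorem mul_mem_weightFiltration {m : ℤ} {a b : A} (hm : a ∈ 𝒜 m) {p q : ℕ}
    (ha : a ∈ weightFiltration 𝒜 γ p) (hb : b ∈ weightFiltration 𝒜 γ q) :
    a * b ∈ weightFiltration 𝒜 γ (p + q) := by
  obtain ⟨N, hN⟩ : ∃ N, N = p + q := ⟨_, rfl⟩
  rw [← hN]
  induction N generalizing m a b p q with
  | zero => exact mem_weightFiltration_zero _
  | succ N ih =>
    rw [mem_weightFiltration_succ, hopf.counit_mul]
    constructor
    · cases p with
      | zero =>
        obtain ⟨q, rfl⟩ : ∃ k, q = k + 1 := ⟨q - 1, by omega⟩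
        rw [(mem_weightFiltration_succ.1 hb).1, mul_zero]
      | succ p => rw [(mem_weightFiltration_succ.1 ha).1, zero_mul]
    · intro n φ hφ
      rw [hopf.contract_mul hφ.1 hφ.2.1 hm]
      have hm' := hopf.contract_mem hφ.1 hm
      refine add_mem ?_ (Submodule.smul_mem _ _ ?_)
      · cases p with
        | zero =>
          obtain ⟨q, rfl⟩ : ∃ k, q = k + 1 := ⟨q - 1, by omega⟩
          exact ih hm' (mem_weightFiltration_zero _) (weightFiltration_succ_le _ hb) (by omega)
        | succ p => exact ih hm' ((mem_weightFiltration_succ.1 ha).2 _ _ hφ) hb (by omega)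
      · cases q with
        | zero =>
          obtain ⟨p, rfl⟩ : ∃ k, p = k + 1 := ⟨p - 1, by omega⟩
          exact ih hm (weightFiltration_succ_le _ ha) (mem_weightFiltration_zero _) (by omega)
        | succ q => exact ih hm ha ((mem_weightFiltration_succ.1 hb).2 _ _ hφ) (by omega)

theorem sub_counit_mem_weightFiltration (a : A) :
    a - Coalgebra.counit (R := R) a • (1 : A) ∈ weightFiltration 𝒜 γ 1 := by
  rw [mem_weightFiltration_succ]
  exact ⟨by simp [hopf.counit_one], fun n φ _ => mem_weightFiltration_zero _⟩

end IsDGHopfAlgebra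

/-- A contraction replaces `γ^{k+1}(a)` by a multiple of `γ^k(a)`, so the weight drops by at most
one. -/
theorem IsGammaHopf.dividedPower_mem_weightFiltration (hA : IsGammaHopf 𝒜 d γ) {n : ℤ}
    (hn : 0 < n) (he : Even n) {a : A} (ha : a ∈ 𝒜 n) (k : ℕ) :
    γ k a ∈ weightFiltration 𝒜 γ k := by
  induction k with
  | zero => exact mem_weightFiltration_zero _
  | succ k ih =>
    rw [mem_weightFiltration_succ]
    refine ⟨hA.hopf.counit_of_mem (mul_pos (by positivity) hn).ne'
      (hA.dividedPowers.mem (k + 1) hn he ha), fun m φ hφ => ?_⟩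
    rw [hA.contract_dividedPower hφ hn he ha]
    have := hA.hopf.mul_mem_weightFiltration (hA.hopf.contract_mem hφ.1 ha)
      (mem_weightFiltration_zero _) ih
    rwa [zero_add] at this

end WeightFiltration

/-! ### Monomials in divided powers and their contractions. -/

section Monomials

variable {R : Type*} [CommRing R] {A : Type*} [Ring A] [Algebra R A] [Coalgebra R A]

/-- A system of homogeneous elements of positive degree with dual `Γ`-primitive functionals. -/
structure DualSystem (𝒜 : ℤ → Submodule R A) (γ : ℕ → A → A) (I : Type*) [DecidableEq I] where
  deg : I → ℤ
  elt : I → A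
  functional : I → Module.Dual R A
  deg_pos : ∀ i, 0 < deg i
  elt_mem : ∀ i, elt i ∈ 𝒜 (deg i)
  functional_mem : ∀ i, functional i ∈ gammaPiece 𝒜 γ (deg i)
  functional_elt : ∀ i j, functional i (elt j) = if i = j then 1 else 0

variable {𝒜 : ℤ → Submodule R A} {γ : ℕ → A → A} {I : Type*} [DecidableEq I]

namespace DualSystem

variable (S : DualSystem 𝒜 γ I)

open Classical in
/-- The `k`-th divided power of the `i`-th element, or its ordinary power if its degree is odd. -/
noncomputable def power (i : I) (k : ℕ) : A :=
  if Even (S.deg i) then γ k (S.elt i) else S.elt i ^ k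

/-- The monomial with exponents `e` in the elements with index in the list `l`. -/
noncomputable def monomial (l : List I) (e : I → ℕ) : A := (l.map fun i => S.power i (e i)).prod

/-- The exponents of elements of odd degree are at most `1`. -/
def Admissible (e : I → ℕ) : Prop := ∀ i, Odd (S.deg i) → e i ≤ 1

variable [GradedAlgebra 𝒜] {d : A →ₗ[R] A} (hA : IsGammaHopf 𝒜 d γ)
include hA

theorem power_zero (i : I) : S.power i 0 = 1 := by
  unfold power
  split_ifs with h
  · exact hA.dividedPowers.zero (S.deg_pos i) h (S.elt_mem i)
  · exact pow_zero _

theorem power_one (i : I) : S.power i 1 = S.elt i := by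
  unfold power
  split_ifs with h
  · exact hA.dividedPowers.one (S.deg_pos i) h (S.elt_mem i)
  · exact pow_one _

theorem power_mem (i : I) (k : ℕ) : S.power i k ∈ 𝒜 (k * S.deg i) := by
  unfold power
  split_ifs with h
  · exact hA.dividedPowers.mem k (S.deg_pos i) h (S.elt_mem i)
  · have := SetLike.pow_mem_graded k (S.elt_mem i)
    rwa [nsmul_eq_mul] at this

theorem elt_mem_weightFiltration (i : I) : S.elt i ∈ weightFiltration 𝒜 γ 1 := by
  rw [mem_weightFiltration_succ]
  exact ⟨hA.hopf.counit_of_mem (S.deg_pos i).ne' (S.elt_mem i),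
    fun n φ _ => mem_weightFiltration_zero _⟩

theorem power_mem_weightFiltration (i : I) {k : ℕ} (hk : Odd (S.deg i) → k ≤ 1) :
    S.power i k ∈ weightFiltration 𝒜 γ k := by
  by_cases h : Even (S.deg i)
  · rw [power, if_pos h]
    exact hA.dividedPower_mem_weightFiltration (S.deg_pos i) h (S.elt_mem i) k
  · have := hk (Int.not_even_iff_odd.1 h)
    interval_cases k
    · exact mem_weightFiltration_zero _
    · rw [S.power_one hA]
      exact S.elt_mem_weightFiltration hA i

theorem contract_power {i : I} {k : ℕ} (hk : Odd (S.deg i) → k + 1 ≤ 1) {n : ℤ}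
    {φ : Module.Dual R A} (hφ : φ ∈ gammaPiece 𝒜 γ n) :
    contract 𝒜 φ (S.power i (k + 1)) = contract 𝒜 φ (S.elt i) * S.power i k := by
  by_cases h : Even (S.deg i)
  · rw [power, if_pos h, power, if_pos h]
    exact hA.contract_dividedPower hφ (S.deg_pos i) h (S.elt_mem i) k
  · have := hk (Int.not_even_iff_odd.1 h)
    obtain rfl : k = 0 := by omega
    rw [S.power_one hA, S.power_zero hA, mul_one]

theorem monomial_mem (l : List I) (e : I → ℕ) :
    S.monomial l e ∈ 𝒜 (l.map fun i => e i * S.deg i).sum := by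
  induction l with
  | nil => exact SetLike.GradedOne.one_mem
  | cons i l ih =>
    simp only [monomial, List.map_cons, List.prod_cons, List.sum_cons]
    exact SetLike.mul_mem_graded (S.power_mem hA i _) ih

theorem monomial_mem_weightFiltration (l : List I) {e : I → ℕ} (he : S.Admissible e) :
    S.monomial l e ∈ weightFiltration 𝒜 γ (l.map e).sum := by
  induction l with
  | nil => exact mem_weightFiltration_zero _
  | cons i l ih =>
    simp only [monomial, List.map_cons, List.prod_cons, List.sum_cons]
    exact hA.hopf.mul_mem_weightFiltration (S.power_mem hA i _)
      (S.power_mem_weightFiltration hA i (he i)) ih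

omit hA [GradedAlgebra 𝒜] in
theorem monomial_update_of_notMem {l : List I} {j : I} (hj : j ∉ l) (e : I → ℕ) (k : ℕ) :
    S.monomial l (Function.update e j k) = S.monomial l e := by
  unfold monomial
  congr 1
  refine List.map_congr_left fun i hi => ?_
  rw [Function.update_of_ne (by rintro rfl; exact hj hi)]

/-- Contraction lowers one exponent, up to a unit and to terms of higher weight. -/
theorem contract_monomial {l : List I} (hl : l.Nodup) {e : I → ℕ} (he : S.Admissible e) (j : I) :
    ∃ s : R, IsUnit s ∧ contract 𝒜 (S.functional j) (S.monomial l e) -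
      (if j ∈ l ∧ e j ≠ 0 then s else 0) • S.monomial l (Function.update e j (e j - 1)) ∈
        weightFiltration 𝒜 γ (l.map e).sum := by
  have hopf := hA.hopf
  have hφ := S.functional_mem j
  induction l with
  | nil => exact ⟨1, isUnit_one, mem_weightFiltration_zero _⟩
  | cons i l ih =>
    obtain ⟨s, hs, ih⟩ := ih hl.of_cons
    have hil : i ∉ l := (List.nodup_cons.1 hl).1
    have hmon : ∀ f, S.monomial (i :: l) f = S.power i (f i) * S.monomial l f := fun f => by
      simp [monomial]
    have hpow := S.power_mem hA i (e i)
    have hfil := S.power_mem_weightFiltration hA i (he i)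
    have hmul := hopf.contract_mul hφ.1 hφ.2.1 hpow (S.monomial l e)
    have helt := hopf.sub_counit_mem_weightFiltration (γ := γ)
      (contract 𝒜 (S.functional j) (S.elt i))
    rw [hopf.counit_contract, S.functional_elt] at helt
    have hdeg := hopf.contract_mem hφ.1 (S.elt_mem i)
    rw [hmon, hmul, List.map_cons, List.sum_cons]
    have hc : IsUnit (sgn R (S.deg j * (e i * S.deg i))) := isUnit_sgn _
    generalize sgn R (S.deg j * (e i * S.deg i)) = c at *
    -- For `j = i` the first Leibniz term is `(1 + weight ≥ 1)` times the lowered power, and the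
    -- second has high weight since `j` does not recur in the list. For `j ≠ i` the first has high
    -- weight and the second is covered by induction.
    by_cases hji : j = i
    · subst hji
      refine ⟨1, isUnit_one, ?_⟩
      rw [if_neg (fun h => hil h.1), zero_smul, sub_zero] at ih
      have h2 := Submodule.smul_mem _ c (hopf.mul_mem_weightFiltration hpow hfil ih)
      rcases Nat.eq_zero_or_eq_succ_pred (e j) with h0 | h0
      · rw [if_neg (fun h => h.2 h0), zero_smul, sub_zero, h0]
        rw [h0, S.power_zero hA, zero_add] at h2
        rw [S.power_zero hA, hopf.contract_one hφ.1 hφ.2.1, zero_mul, zero_add, zero_add]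
        exact h2
      · rw [if_pos ⟨List.mem_cons_self, by omega⟩, hmon, one_smul, Function.update_self,
          S.monomial_update_of_notMem hil]
        generalize (e j).pred = k at h0
        have hk : Odd (S.deg j) → k + 1 ≤ 1 := by have := he j; rwa [h0] at this
        rw [h0] at h2 ⊢
        rw [S.contract_power hA hk hφ, Nat.succ_sub_one]
        rw [if_pos rfl, one_smul] at helt
        rw [sub_self] at hdeg
        have h3 := hopf.mul_mem_weightFiltration (sub_mem hdeg SetLike.GradedOne.one_mem) helt
          (hopf.mul_mem_weightFiltration (S.power_mem hA j k)
            (S.power_mem_weightFiltration hA j fun h => (Nat.le_succ k).trans (hk h))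
            (S.monomial_mem_weightFiltration hA l he))
        -- Replacing the contraction of the generator by its augmentation `1` costs a term whose
        -- extra weight makes up for the lowered exponent.
        have e1 : 1 + (k + (l.map e).sum) = k.succ + (l.map e).sum := by omega
        rw [e1, sub_mul, one_mul] at h3
        convert add_mem h3 h2 using 1
        rw [mul_assoc]
        abel
    · refine ⟨c * s, hc.mul hs, ?_⟩
      rw [if_neg hji, zero_smul, sub_zero] at helt
      have h1 : contract 𝒜 (S.functional j) (S.power i (e i)) ∈ weightFiltration 𝒜 γ (e i) := by
        rcases Nat.eq_zero_or_eq_succ_pred (e i) with h0 | h0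
        · rw [h0]; exact mem_weightFiltration_zero _
        · generalize (e i).pred = k at h0
          have hk : Odd (S.deg i) → k + 1 ≤ 1 := by have := he i; rwa [h0] at this
          rw [h0, S.contract_power hA hk hφ, Nat.succ_eq_one_add]
          exact hopf.mul_mem_weightFiltration hdeg helt
            (S.power_mem_weightFiltration hA i fun h => (Nat.le_succ k).trans (hk h))
      have h2 := hopf.mul_mem_weightFiltration (hopf.contract_mem hφ.1 hpow) h1
        (S.monomial_mem_weightFiltration hA l he)
      have h3 := Submodule.smul_mem _ c (hopf.mul_mem_weightFiltration hpow hfil ih)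
      convert add_mem h2 h3 using 1
      have hite : (if j ∈ i :: l ∧ e j ≠ 0 then c * s else 0) =
          c * (if j ∈ l ∧ e j ≠ 0 then s else 0) := by
        simp only [List.mem_cons, hji, false_or, mul_ite, mul_zero]
      rw [hite, hmon, Function.update_of_ne (Ne.symm hji), mul_sub, smul_sub, mul_smul,
        mul_smul_comm]
      abel

end DualSystem

end Monomials

/-! ### A determinant criterion. -/

section TriangularMatrices

/-- The matrix is block triangular for the weight, and its diagonal blocks are diagonal with unit
entries. -/
theorem Matrix.isUnit_det_of_weight {R : Type*} [CommRing R] {n : Type*} [Fintype n]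
    [DecidableEq n] (M : Matrix n n R) (w : n → ℕ) (lt : ∀ i j, w i < w j → M i j = 0)
    (eq : ∀ i j, w i = w j → i ≠ j → M i j = 0) (diag : ∀ i, IsUnit (M i i)) : IsUnit M.det := by
  have h : M.BlockTriangular (OrderDual.toDual ∘ w) := fun i j hij => lt i j hij
  rw [h.det, IsUnit.prod_iff]
  intro a _
  have hd : M.toSquareBlock (OrderDual.toDual ∘ w) a = Matrix.diagonal fun i => M i.1 i.1 := by
    ext i j
    by_cases hij : i = j
    · subst hij; rw [Matrix.diagonal_apply_eq]; rfl
    · rw [Matrix.diagonal_apply_ne _ hij]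
      exact eq _ _ (OrderDual.toDual.injective (i.2.trans j.2.symm)) fun h => hij (Subtype.ext h)
  rw [hd, Matrix.det_diagonal, IsUnit.prod_univ_iff]
  exact fun i => diag i

end TriangularMatrices

/-! ### The pairing matrix of words and monomials. -/

namespace DualSystem

variable {R : Type*} [CommRing R] {A : Type*} [Ring A] [Algebra R A] [Coalgebra R A]
  {𝒜 : ℤ → Submodule R A} {γ : ℕ → A → A} {I : Type*} [DecidableEq I] [Fintype I]
  (S : DualSystem 𝒜 γ I)

/-- The monomial with exponents `e`. -/
noncomputable def mono (e : I → ℕ) : A := S.monomial Finset.univ.toList e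

open Classical in
/-- The admissible exponents of the monomials of degree `n`. -/
noncomputable def exponents (n : ℤ) : Finset (I → ℕ) :=
  -- The degrees are positive, so no exponent exceeds `n`; the box only serves to make the set
  -- finite.
  (Fintype.piFinset fun _ => Finset.range (n.toNat + 1)).filter fun e =>
    S.Admissible e ∧ ∑ i, e i * S.deg i = n

theorem mem_exponents {n : ℤ} {e : I → ℕ} :
    e ∈ S.exponents n ↔ S.Admissible e ∧ ∑ i, e i * S.deg i = n := by
  classical
  simp only [exponents, Finset.mem_filter, Fintype.mem_piFinset, Finset.mem_range,
    and_iff_right_iff_imp]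
  rintro ⟨-, rfl⟩ i
  have h0 : ∀ j ∈ Finset.univ, 0 ≤ (e j : ℤ) * S.deg j := fun j _ =>
    mul_nonneg (by positivity) (S.deg_pos j).le
  have h1 := Finset.single_le_sum h0 (Finset.mem_univ i)
  have h2 : (e i : ℤ) ≤ e i * S.deg i := le_mul_of_one_le_right (by positivity) (S.deg_pos i)
  omega

omit [DecidableEq I] in
/-- The list of indices in which `i` occurs `e i` times. -/
noncomputable def _root_.exponentList (e : I → ℕ) : List I :=
  Finset.univ.toList.flatMap fun i => List.replicate (e i) i

theorem _root_.count_exponentList (e : I → ℕ) (i : I) : (exponentList e).count i = e i := by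
  rw [exponentList, List.count_flatMap]
  have : (List.count i ∘ fun j => List.replicate (e j) j) = fun j => if j = i then e j else 0 := by
    ext j
    simp [List.count_replicate]
  rw [this, Finset.sum_map_toList]
  simp

omit [DecidableEq I] in
theorem _root_.length_exponentList (e : I → ℕ) : (exponentList e).length = ∑ i, e i := by
  rw [exponentList, List.length_flatMap]
  simp [Finset.sum_map_toList]

variable [GradedAlgebra 𝒜] {d : A →ₗ[R] A} (hA : IsGammaHopf 𝒜 d γ)

/-- The composition of the contractions with the functionals with indices in a list. -/
noncomputable def word (js : List I) : Module.End R A :=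
  (js.map fun j => contract 𝒜 (S.functional j)).prod

include hA

theorem mono_mem {n : ℤ} {e : I → ℕ} (he : e ∈ S.exponents n) : S.mono e ∈ 𝒜 n := by
  have h := S.monomial_mem hA Finset.univ.toList e
  rwa [Finset.sum_map_toList, (S.mem_exponents.1 he).2] at h

theorem mono_mem_weightFiltration {e : I → ℕ} (he : S.Admissible e) :
    S.mono e ∈ weightFiltration 𝒜 γ (∑ i, e i) := by
  have h := S.monomial_mem_weightFiltration hA Finset.univ.toList he
  rwa [Finset.sum_map_toList] at h

omit hA [Fintype I] in
theorem counit_word_eq_zero (js : List I) {w : ℕ} (hw : js.length < w) {a : A}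
    (ha : a ∈ weightFiltration 𝒜 γ w) : Coalgebra.counit (R := R) (S.word js a) = 0 :=
  counit_contract_list_eq_zero S.functional_mem js hw ha

/-- With as many letters as the total exponent, the error terms of `contract_monomial` are too heavy
to survive. Each letter lowers its own exponent, so a unit results if the letters match the
exponents, and zero otherwise. -/
theorem counit_word_mono (js : List I) {e : I → ℕ} (he : S.Admissible e)
    (hlen : ∑ i, e i = js.length) :
    ((∀ i, js.count i = e i) → IsUnit (Coalgebra.counit (R := R) (S.word js (S.mono e)))) ∧
      (¬ (∀ i, js.count i = e i) → Coalgebra.counit (R := R) (S.word js (S.mono e)) = 0) := by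
  -- The last letter acts first on the monomial.
  induction js using List.reverseRecOn generalizing e with
  | nil =>
    have h0 : ∀ i, e i = 0 := by simpa using hlen
    have h1 : S.mono e = 1 := by
      have : ∀ l : List I, S.monomial l e = 1 := by
        intro l
        induction l with
        | nil => rfl
        | cons i l ih =>
          rw [monomial] at ih
          rw [monomial, List.map_cons, List.prod_cons, ih, h0, S.power_zero hA, mul_one]
      exact this _
    constructor
    · intro _
      simp [h1, word, hA.hopf.counit_one]
    · intro h
      exact absurd (fun i => by rw [h0]; rfl) h
  | append_singleton js j ih =>
    obtain ⟨s, hs, h⟩ := S.contract_monomial hA (Finset.nodup_toList Finset.univ) he j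
    rw [Finset.sum_map_toList, hlen] at h
    have h1 := S.counit_word_eq_zero js (w := (js ++ [j]).length) (by simp) h
    have hw : S.word (js ++ [j]) (S.mono e) =
        S.word js (contract 𝒜 (S.functional j) (S.monomial Finset.univ.toList e)) := by
      simp [word, mono]
    rw [map_sub, map_sub, sub_eq_zero] at h1
    rw [hw, h1, map_smul, map_smul]
    by_cases hj : e j = 0
    · rw [if_neg (fun h => h.2 hj), zero_smul]
      refine ⟨fun h => ?_, fun _ => rfl⟩
      have := h j
      rw [hj] at this
      simp at this
    · rw [if_pos ⟨by simp, hj⟩, smul_eq_mul]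
      have he' : S.Admissible (Function.update e j (e j - 1)) := by
        intro i hi
        by_cases hij : i = j
        · subst hij
          rw [Function.update_self]
          have := he i hi
          omega
        · rw [Function.update_of_ne hij]
          exact he i hi
      have hsum : ∑ i, Function.update e j (e j - 1) i = js.length := by
        have h1 := Finset.sum_update_of_mem (Finset.mem_univ j) e (e j - 1)
        have h2 := Finset.add_sum_erase Finset.univ e (Finset.mem_univ j)
        rw [hlen, List.length_append, List.length_singleton] at h2
        rw [h1, Finset.sdiff_singleton_eq_erase]
        omega
      have hiff : (∀ i, (js ++ [j]).count i = e i) ↔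
          ∀ i, js.count i = Function.update e j (e j - 1) i := by
        refine forall_congr' fun i => ?_
        by_cases hij : i = j
        · subst hij
          rw [Function.update_self, List.count_append, List.count_singleton_self]
          omega
        · rw [Function.update_of_ne hij, List.count_append,
            List.count_eq_zero_of_not_mem (l := [j]) (by simpa using hij), add_zero]
      have ih' := ih he' hsum
      rw [hiff]
      exact ⟨fun h => hs.mul (ih'.1 h), fun h => by
        have := ih'.2 h
        unfold mono at this
        rw [this, mul_zero]⟩

omit hA in
/-- The matrix of the pairing between words in the functionals and monomials, in degree `n`. -/
noncomputable def pairingMatrix (n : ℤ) : Matrix (S.exponents n) (S.exponents n) R :=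
  fun e f => Coalgebra.counit (R := R) (S.word (exponentList e.1) (S.mono f.1))

/-- Order by total exponent: a word shorter than the monomial gives zero, and words of equal length
pair with monomials diagonally, by units. -/
theorem isUnit_det_pairingMatrix (n : ℤ) : IsUnit (S.pairingMatrix n).det := by
  refine Matrix.isUnit_det_of_weight _ (fun e => ∑ i, e.1 i) (fun e f h => ?_) (fun e f h hef => ?_)
    fun e => ?_
  · refine S.counit_word_eq_zero _ (w := ∑ i, f.1 i) (by rwa [length_exponentList]) ?_
    exact S.mono_mem_weightFiltration hA (S.mem_exponents.1 f.2).1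
  · refine (S.counit_word_mono hA _ (S.mem_exponents.1 f.2).1 (by
      rw [length_exponentList, h])).2 fun h => hef (Subtype.ext (funext fun i => ?_))
    rw [← h, count_exponentList]
  · exact (S.counit_word_mono hA _ (S.mem_exponents.1 e.2).1 (by
      rw [length_exponentList])).1 fun i => count_exponentList _ i

/-- If `r` divides a combination of monomials then it divides the coefficients. -/
theorem exists_eq_mul_of_smul_eq_sum {n : ℤ} {r : R} {a : A} {c : S.exponents n → R}
    (h : r • a = ∑ e, c e • S.mono e.1) : ∃ c' : S.exponents n → R, ∀ e, c e = r * c' e := by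
  have hM := S.isUnit_det_pairingMatrix hA n
  -- Pairing the relation with all words gives `M c = r v`, hence `c = r M⁻¹ v`.
  have h1 : (S.pairingMatrix n).mulVec c =
      r • fun e : S.exponents n => Coalgebra.counit (R := R) (S.word (exponentList e.1) a) := by
    ext e
    have h2 := congrArg (fun a => Coalgebra.counit (R := R) (S.word (exponentList e.1) a)) h
    simp only [map_smul, map_sum, smul_eq_mul] at h2
    rw [Pi.smul_apply, smul_eq_mul, h2, Matrix.mulVec, dotProduct]
    exact Finset.sum_congr rfl fun f _ => mul_comm _ _
  refine ⟨(S.pairingMatrix n)⁻¹.mulVec fun e : S.exponents n =>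
    Coalgebra.counit (R := R) (S.word (exponentList e.1) a), fun e => ?_⟩
  have h3 := congrArg (fun v => (S.pairingMatrix n)⁻¹.mulVec v) h1
  simp only [Matrix.mulVec_mulVec, Matrix.nonsing_inv_mul _ hM, Matrix.one_mulVec,
    Matrix.mulVec_smul] at h3
  rw [h3]
  rfl

end DualSystem

/-! ### The span of the monomials is closed under products and divided powers. -/

namespace DualSystem

variable {R : Type*} [CommRing R] {A : Type*} [Ring A] [Algebra R A] [Coalgebra R A]
  {𝒜 : ℤ → Submodule R A} {γ : ℕ → A → A} {I : Type*} [DecidableEq I]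
  (S : DualSystem 𝒜 γ I)

open Classical in
/-- The exponents of the product of two monomials. -/
noncomputable def mergeExponents (e f : I → ℕ) (i : I) : ℕ :=
  if Odd (S.deg i) then min 1 (e i + f i) else e i + f i

theorem admissible_mergeExponents (e f : I → ℕ) : S.Admissible (S.mergeExponents e f) := by
  intro i hi
  rw [mergeExponents, if_pos hi]
  exact min_le_left _ _

theorem admissible_single (i : I) {k : ℕ} (hk : Odd (S.deg i) → k ≤ 1) :
    S.Admissible (Pi.single i k) := by
  intro j hj
  by_cases h : j = i
  · subst h; rw [Pi.single_eq_same]; exact hk hj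
  · rw [Pi.single_eq_of_ne h]; exact Nat.zero_le _

variable [GradedAlgebra 𝒜] {d : A →ₗ[R] A} (hA : IsGammaHopf 𝒜 d γ)
include hA

theorem monomial_zero (l : List I) : S.monomial l 0 = 1 := by
  induction l with
  | nil => rfl
  | cons i l ih =>
    rw [monomial] at ih
    rw [monomial, List.map_cons, List.prod_cons, ih, Pi.zero_apply, S.power_zero hA, mul_one]

theorem monomial_single {l : List I} (hl : l.Nodup) (i : I) (k : ℕ) :
    S.monomial l (Pi.single i k) = if i ∈ l then S.power i k else 1 := by
  have hout : ∀ {l : List I}, i ∉ l → S.monomial l (Pi.single i k) = 1 := by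
    intro l h
    rw [← S.monomial_zero hA l, ← S.monomial_update_of_notMem h 0 k]
    rfl
  split_ifs with h
  · induction l with
    | nil => simp at h
    | cons j l ih =>
      rw [monomial, List.map_cons, List.prod_cons]
      by_cases hij : i = j
      · subst hij
        have := hout (List.nodup_cons.1 hl).1
        rw [monomial] at this
        rw [this, Pi.single_eq_same, mul_one]
      · have := ih hl.of_cons ((List.mem_cons.1 h).resolve_left hij)
        rw [monomial] at this
        rw [this, Pi.single_eq_of_ne (Ne.symm hij), S.power_zero hA, one_mul]
  · exact hout h

theorem power_mul_power (two : IsUnit (2 : R)) {e f : I → ℕ} (he : S.Admissible e)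
    (hf : S.Admissible f) (i : I) : ∃ c : R,
      S.power i (e i) * S.power i (f i) = c • S.power i (S.mergeExponents e f i) := by
  unfold mergeExponents
  by_cases h : Odd (S.deg i)
  · have h1 := he i h
    have h2 := hf i h
    rw [if_pos h]
    generalize e i = p at *
    generalize f i = q at *
    interval_cases p <;> interval_cases q
    · exact ⟨1, by simp [S.power_zero hA]⟩
    · exact ⟨1, by simp [S.power_zero hA]⟩
    · exact ⟨1, by simp [S.power_zero hA]⟩
    · exact ⟨0, by rw [S.power_one hA, mul_self_of_odd two hA.comm h (S.elt_mem i), zero_smul]⟩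
  · rw [if_neg h]
    rw [Int.not_odd_iff_even] at h
    refine ⟨((e i + f i).choose (e i) : ℕ), ?_⟩
    simp only [power, if_pos h]
    rw [hA.dividedPowers.mul _ _ (S.deg_pos i) h (S.elt_mem i), Nat.cast_smul_eq_nsmul]

theorem monomial_mul_monomial (two : IsUnit (2 : R)) (l : List I) {e f : I → ℕ}
    (he : S.Admissible e) (hf : S.Admissible f) : ∃ c : R,
      S.monomial l e * S.monomial l f = c • S.monomial l (S.mergeExponents e f) := by
  induction l with
  | nil => exact ⟨1, by simp [monomial]⟩
  | cons i l ih =>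
    obtain ⟨c, hc⟩ := ih
    obtain ⟨c', hc'⟩ := S.power_mul_power hA two he hf i
    have hcomm := hA.comm (S.monomial_mem hA l e) (S.power_mem hA i (f i))
    have hmon : ∀ f, S.monomial (i :: l) f = S.power i (f i) * S.monomial l f := fun f => by
      simp [monomial]
    generalize sgn R _ = s at hcomm
    refine ⟨s * (c' * c), ?_⟩
    rw [hmon, hmon, hmon, mul_assoc, ← mul_assoc (S.monomial l e), hcomm, smul_mul_assoc,
      mul_smul_comm, mul_assoc, hc, ← mul_assoc, hc', mul_smul_comm, smul_mul_assoc, mul_smul,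
      mul_smul, smul_comm c]

variable [Fintype I]

omit hA [GradedAlgebra 𝒜] in
/-- The span of the monomials. -/
noncomputable def monoSpan : Submodule R A := Submodule.span R (S.mono '' {e | S.Admissible e})

omit hA [GradedAlgebra 𝒜] in
theorem mono_mem_monoSpan {e : I → ℕ} (he : S.Admissible e) : S.mono e ∈ S.monoSpan :=
  Submodule.subset_span ⟨e, he, rfl⟩

theorem one_mem_monoSpan : 1 ∈ S.monoSpan := by
  rw [← S.monomial_zero hA Finset.univ.toList]
  exact S.mono_mem_monoSpan fun _ _ => Nat.zero_le _

theorem power_mem_monoSpan (i : I) {k : ℕ} (hk : Odd (S.deg i) → k ≤ 1) :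
    S.power i k ∈ S.monoSpan := by
  have h := S.monomial_single hA (Finset.nodup_toList Finset.univ) i k
  rw [if_pos (by simp)] at h
  rw [← h]
  exact S.mono_mem_monoSpan (S.admissible_single i hk)

theorem elt_mem_monoSpan (i : I) : S.elt i ∈ S.monoSpan := by
  rw [← S.power_one hA]
  exact S.power_mem_monoSpan hA i fun _ => le_rfl

variable (two : IsUnit (2 : R))
include two

theorem mul_mem_monoSpan {a b : A} (ha : a ∈ S.monoSpan) (hb : b ∈ S.monoSpan) :
    a * b ∈ S.monoSpan := by
  have h : S.monoSpan * S.monoSpan ≤ S.monoSpan := by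
    rw [monoSpan, Submodule.span_mul_span, Submodule.span_le]
    rintro _ ⟨_, ⟨e, he, rfl⟩, _, ⟨f, hf, rfl⟩, rfl⟩
    obtain ⟨c, hc⟩ := S.monomial_mul_monomial hA two Finset.univ.toList he hf
    change S.monomial _ e * S.monomial _ f ∈ _
    rw [hc]
    exact Submodule.smul_mem _ c (S.mono_mem_monoSpan (S.admissible_mergeExponents e f))
  exact h (Submodule.mul_mem_mul ha hb)

theorem pow_mem_monoSpan {a : A} (ha : a ∈ S.monoSpan) (k : ℕ) : a ^ k ∈ S.monoSpan := by
  induction k with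
  | zero => rw [pow_zero]; exact S.one_mem_monoSpan hA
  | succ k ih => rw [pow_succ]; exact S.mul_mem_monoSpan hA two ih ha

theorem monomial_mem_monoSpan (l : List I) {e : I → ℕ} (he : S.Admissible e) :
    S.monomial l e ∈ S.monoSpan := by
  induction l with
  | nil => exact S.one_mem_monoSpan hA
  | cons i l ih =>
    rw [monomial, List.map_cons, List.prod_cons]
    exact S.mul_mem_monoSpan hA two (S.power_mem_monoSpan hA i (he i)) ih

omit two in
theorem dividedPower_power_mem_monoSpan {i : I} {k : ℕ} (hk : 0 < k)
    (hd : Even (k * S.deg i)) (ho : Odd (S.deg i) → k ≤ 1) (m : ℕ) :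
    γ m (S.power i k) ∈ S.monoSpan := by
  by_cases h : Even (S.deg i)
  · have hp := S.power_mem_monoSpan hA i (k := m * k) fun h' => absurd h (Int.not_even_iff_odd.2 h')
    rw [power, if_pos h] at hp ⊢
    rw [hA.dividedPowers.comp _ _ hk (S.deg_pos i) h (S.elt_mem i)]
    exact nsmul_mem hp _
  · exfalso
    have := ho (Int.not_even_iff_odd.1 h)
    obtain rfl : k = 1 := by omega
    exact h (by simpa using hd)

/-- One factor is split off at a time. Two even factors fall under `even_mul`; two odd ones leave
only the divided powers of index `0` and `1`. -/
theorem dividedPower_monomial_mem_monoSpan (l : List I) {e : I → ℕ} (he : S.Admissible e)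
    {n : ℤ} (hn : (l.map fun i => e i * S.deg i).sum = n) (pos : 0 < n) (even : Even n) (k : ℕ) :
    γ k (S.monomial l e) ∈ S.monoSpan := by
  induction l generalizing n with
  | nil => simp at hn; omega
  | cons i l ih =>
    have hmon : S.monomial (i :: l) e = S.power i (e i) * S.monomial l e := by simp [monomial]
    rw [List.map_cons, List.sum_cons] at hn
    have hpl := S.monomial_mem hA l e
    have hpi := S.power_mem hA i (e i)
    have hsum : 0 ≤ (l.map fun i => e i * S.deg i).sum := by
      refine List.sum_nonneg fun x hx => ?_
      obtain ⟨j, _, rfl⟩ := List.mem_map.1 hx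
      exact mul_nonneg (by positivity) (S.deg_pos j).le
    rw [hmon]
    rcases Nat.eq_zero_or_pos (e i) with h0 | h0
    · rw [h0, Nat.cast_zero, zero_mul, zero_add] at hn
      rw [h0, S.power_zero hA, one_mul]
      exact ih hn pos even
    · have hi : 0 < e i * S.deg i := mul_pos (by positivity) (S.deg_pos i)
      have hcomm := hA.comm hpi hpl
      -- If the rest has degree zero, it must be the factor that is raised to an ordinary power,
      -- since `even_mul` needs positive degree for the other one.
      rcases hsum.eq_or_lt with hs | hs
      · rw [← hs, add_zero] at hn
        rw [← hs] at hcomm hpl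
        rw [mul_zero, sgn_zero, one_smul] at hcomm
        rw [hcomm, hA.dividedPowers.even_mul k le_rfl Even.zero hi (hn ▸ even) hpl hpi]
        exact S.mul_mem_monoSpan hA two
          (S.pow_mem_monoSpan hA two (S.monomial_mem_monoSpan hA two l he) k)
          (S.dividedPower_power_mem_monoSpan hA h0 (hn ▸ even) (he i) k)
      · rcases Int.even_or_odd (e i * S.deg i) with hie | hio
        · have hle : Even (l.map fun i => e i * S.deg i).sum := (Int.even_add.1 (hn ▸ even)).1 hie
          rw [hA.dividedPowers.even_mul k hi.le hie hs hle hpi hpl]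
          exact S.mul_mem_monoSpan hA two
            (S.pow_mem_monoSpan hA two (S.power_mem_monoSpan hA i (he i)) k) (ih rfl hs hle)
        · have hlo : Odd (l.map fun i => e i * S.deg i).sum := by
            by_contra h
            rw [Int.not_odd_iff_even] at h
            exact (Int.not_even_iff_odd.2 hio) ((Int.even_add.1 (hn ▸ even)).2 h)
          have hmem := SetLike.mul_mem_graded hpi hpl
          rw [hn] at hmem
          match k with
          | 0 => rw [hA.dividedPowers.zero pos even hmem]; exact S.one_mem_monoSpan hA
          | 1 =>
            rw [hA.dividedPowers.one pos even hmem]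
            exact S.mul_mem_monoSpan hA two (S.power_mem_monoSpan hA i (he i))
              (S.monomial_mem_monoSpan hA two l he)
          | k + 2 =>
            rw [hA.dividedPowers.odd_mul (k + 2) (by omega) hi hio hs hlo hpi hpl]
            exact zero_mem _

omit two in
-- The monomials are homogeneous, so projection to degree `n` discards those of other degrees. What
-- remains is a span of finitely many monomials.
theorem monoSpan_inf_le (n : ℤ) :
    S.monoSpan ⊓ 𝒜 n ≤ Submodule.span R (S.mono '' (S.exponents n : Set (I → ℕ))) := by
  rintro a ⟨ha, han⟩
  have h : GradedAlgebra.proj 𝒜 n a ∈ Submodule.span R (S.mono '' (S.exponents n : Set _)) := by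
    have h1 := Submodule.mem_map_of_mem (f := GradedAlgebra.proj 𝒜 n) ha
    rw [monoSpan, Submodule.map_span] at h1
    refine Submodule.span_le.2 ?_ h1
    rintro _ ⟨_, ⟨e, he, rfl⟩, rfl⟩
    have hmem := S.mono_mem hA (S.mem_exponents.2 ⟨he, rfl⟩)
    by_cases hn : ∑ i, e i * S.deg i = n
    · rw [hn] at hmem
      rw [GradedAlgebra.proj_apply, DirectSum.decompose_of_mem_same 𝒜 hmem]
      exact Submodule.subset_span ⟨e, S.mem_exponents.2 ⟨he, hn⟩, rfl⟩
    · rw [GradedAlgebra.proj_apply, DirectSum.decompose_of_mem_ne 𝒜 hmem hn]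
      exact zero_mem _
  rwa [GradedAlgebra.proj_apply, DirectSum.decompose_of_mem_same 𝒜 han] at h

theorem dividedPower_mem_monoSpan {n : ℤ} (pos : 0 < n) (even : Even n) {a : A} (ha : a ∈ 𝒜 n)
    (ha' : a ∈ S.monoSpan) (k : ℕ) : γ k a ∈ S.monoSpan := by
  have h : ∀ a, a ∈ Submodule.span R (S.mono '' (S.exponents n : Set (I → ℕ))) →
      a ∈ 𝒜 n ∧ ∀ k, γ k a ∈ S.monoSpan := by
    intro a ha
    induction ha using Submodule.span_induction with
    | mem a h =>
      obtain ⟨e, he, rfl⟩ := h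
      have he' := S.mem_exponents.1 he
      refine ⟨S.mono_mem hA he, fun k => ?_⟩
      refine S.dividedPower_monomial_mem_monoSpan hA two _ he'.1 ?_ pos even k
      rw [Finset.sum_map_toList, he'.2]
    | zero =>
      refine ⟨zero_mem _, fun k => ?_⟩
      have h := hA.dividedPowers.even_mul k le_rfl Even.zero pos even (zero_mem (𝒜 0))
        (zero_mem (𝒜 n))
      rw [zero_mul] at h
      cases k with
      | zero =>
        rw [hA.dividedPowers.zero pos even (zero_mem (𝒜 n))]
        exact S.one_mem_monoSpan hA
      | succ k =>
        rw [h, pow_succ, mul_zero, zero_mul]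
        exact zero_mem _
    | add a b _ _ ha hb =>
      refine ⟨add_mem ha.1 hb.1, fun k => ?_⟩
      rw [hA.dividedPowers.add k pos even ha.1 hb.1]
      exact Submodule.sum_mem _ fun p _ => S.mul_mem_monoSpan hA two (ha.2 _) (hb.2 _)
    | smul r a _ ha =>
      refine ⟨Submodule.smul_mem _ r ha.1, fun k => ?_⟩
      have h := hA.dividedPowers.even_mul k le_rfl Even.zero pos even
        (SetLike.algebraMap_mem_graded 𝒜 r) ha.1
      rw [← Algebra.smul_def] at h
      rw [h, ← map_pow, ← Algebra.smul_def]
      exact Submodule.smul_mem _ _ (ha.2 k)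
  exact (h a (S.monoSpan_inf_le hA n ⟨ha', ha⟩)).2 k

end DualSystem

/-! ### Indecomposables: new functionals and absence of torsion. -/

namespace DualSystem

variable {R : Type*} [CommRing R] {A : Type*} [Ring A] [Algebra R A] [Coalgebra R A]
  {𝒜 : ℤ → Submodule R A} {γ : ℕ → A → A} {I : Type*} [DecidableEq I] [Fintype I]
  (S : DualSystem 𝒜 γ I)

variable [GradedAlgebra 𝒜] {d : A →ₗ[R] A} (hA : IsGammaHopf 𝒜 d γ) (two : IsUnit (2 : R))
include hA

theorem piece_le_monoSpan_of_nonpos {n : ℤ} (hn : n ≤ 0) : 𝒜 n ≤ S.monoSpan := by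
  rcases hn.lt_or_eq with h | rfl
  · rw [hA.connected.1 n h]
    exact bot_le
  · intro a ha
    obtain ⟨r, rfl, _⟩ := hA.connected.2 a ha
    rw [Algebra.algebraMap_eq_smul_one]
    exact Submodule.smul_mem _ r (S.one_mem_monoSpan hA)

include two

/-- A functional of degree `n` is `Γ`-primitive if it vanishes on the subalgebra with divided
powers generated by the elements of smaller degree. -/
theorem mem_gammaPiece {n : ℤ} (hn : 0 < n) (complete : ∀ m < n, 𝒜 m ≤ S.monoSpan)
    {φ : Module.Dual R A} (hφ : φ ∈ dualPiece 𝒜 n) (h : ∀ a ∈ 𝒜 n, a ∈ S.monoSpan → φ a = 0) :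
    φ ∈ gammaPiece 𝒜 γ n := by
  have h0 : ∀ r : R, φ (algebraMap R A r) = 0 := fun r =>
    hφ 0 hn.ne _ (SetLike.algebraMap_mem_graded 𝒜 r)
  refine ⟨hφ, fun a b => ?_, fun m a k hm he ha => ?_⟩
  · refine homogeneous_induction 𝒜 a (fun i a ha => ?_) fun a a' e e' => ?_
    · refine homogeneous_induction 𝒜 b (fun j b hb => ?_) fun b b' e e' => ?_
      · rcases lt_trichotomy i 0 with hi | rfl | hi
        · rw [hA.connected.1 i hi, Submodule.mem_bot] at ha
          simp [ha]
        · obtain ⟨r, rfl, _⟩ := hA.connected.2 a ha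
          rw [h0, hA.hopf.counit_algebraMap, ← Algebra.smul_def, map_smul, zero_mul, zero_add,
            smul_eq_mul]
        · rcases lt_trichotomy j 0 with hj | rfl | hj
          · rw [hA.connected.1 j hj, Submodule.mem_bot] at hb
            simp [hb]
          · obtain ⟨r, rfl, _⟩ := hA.connected.2 b hb
            rw [h0, hA.hopf.counit_algebraMap, ← Algebra.commutes, ← Algebra.smul_def, map_smul,
              mul_zero, add_zero, smul_eq_mul, mul_comm]
          · rw [hA.hopf.counit_of_mem hi.ne' ha, hA.hopf.counit_of_mem hj.ne' hb, mul_zero,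
              zero_mul, add_zero]
            have hab := SetLike.mul_mem_graded ha hb
            by_cases hij : i + j = n
            · exact h _ (hij ▸ hab) (S.mul_mem_monoSpan hA two (complete i (by omega) ha)
                (complete j (by omega) hb))
            · exact hφ _ hij _ hab
      · rw [mul_add, map_add, e, e', map_add, map_add]; ring
    · rw [add_mul, map_add, e, e', map_add, map_add]; ring
  · have hmem := hA.dividedPowers.mem (k + 2) hm he ha
    by_cases hkn : ((k + 2 : ℕ) : ℤ) * m = n
    · refine h _ (hkn ▸ hmem) (S.dividedPower_mem_monoSpan hA two hm he ha
        (complete m ?_ ha) _)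
      rw [← hkn]
      push_cast
      nlinarith [(Nat.cast_nonneg k : (0 : ℤ) ≤ k)]
    · exact hφ _ hkn _ hmem

omit two in
/-- The quotient of a graded piece by the span of the monomials has no torsion. -/
theorem isTorsionFree_quotient [IsDomain R] [Module.Free R A] (n : ℤ) :
    Module.IsTorsionFree R (𝒜 n ⧸ S.monoSpan.comap (𝒜 n).subtype) := by
  refine Module.IsTorsionFree.of_smul_eq_zero fun r q hq => ?_
  by_contra! hne
  obtain ⟨hr, hq0⟩ := hne
  obtain ⟨a, rfl⟩ := Submodule.Quotient.mk_surjective _ q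
  rw [← Submodule.Quotient.mk_smul, Submodule.Quotient.mk_eq_zero, Submodule.mem_comap] at hq
  refine hq0 ((Submodule.Quotient.mk_eq_zero _).2 ?_)
  rw [Submodule.mem_comap]
  have h := S.monoSpan_inf_le hA n ⟨hq, (r • a).2⟩
  rw [Set.image_eq_range] at h
  obtain ⟨c, hc⟩ := (Submodule.mem_span_range_iff_exists_fun R).1 h
  have hc' : r • (a : A) = ∑ e : S.exponents n, c e • S.mono e.1 := hc.symm
  obtain ⟨c', hcc'⟩ := S.exists_eq_mul_of_smul_eq_sum hA hc'
  -- After division of the coefficients by `r`, the factor `r` cancels because `A` is free over a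
  -- domain.
  have heq : (a : A) = ∑ e : S.exponents n, c' e • S.mono e.1 := by
    refine smul_right_injective A hr ?_
    simp only [hc', Finset.smul_sum, smul_smul, hcc']
  rw [Submodule.subtype_apply, heq]
  exact Submodule.sum_mem _ fun e _ => Submodule.smul_mem _ _
    (S.mono_mem_monoSpan (S.mem_exponents.1 e.2).1)

end DualSystem

/-! ### Construction of dual systems, degree by degree. -/

namespace IsGammaHopf

open DualSystem

variable {R : Type*} [CommRing R] [IsDomain R] [IsPrincipalIdealRing R]
  {A : Type*} [Ring A] [Algebra R A] [Coalgebra R A] [Module.Free R A]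
  {𝒜 : ℤ → Submodule R A} [GradedAlgebra 𝒜] {γ : ℕ → A → A} {d : A →ₗ[R] A}

theorem exists_dualSystem (hA : IsGammaHopf 𝒜 d γ) (two : IsUnit (2 : R))
    (finite_type : ∀ n : ℤ, Module.Finite R (𝒜 n)) (N : ℕ) :
    ∃ (I : Type) (_ : DecidableEq I) (_ : Fintype I) (S : DualSystem 𝒜 γ I),
      (∀ i, S.deg i ≤ N) ∧ ∀ m : ℤ, m ≤ N → 𝒜 m ≤ S.monoSpan := by
  induction N with
  | zero =>
    let S : DualSystem 𝒜 γ Empty :=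
      { deg := Empty.elim
        elt := Empty.elim
        functional := Empty.elim
        deg_pos := fun i => i.elim
        elt_mem := fun i => i.elim
        functional_mem := fun i => i.elim
        functional_elt := fun i => i.elim }
    exact ⟨Empty, inferInstance, inferInstance, S, fun i => i.elim, fun m hm =>
      S.piece_le_monoSpan_of_nonpos hA (by simpa using hm)⟩
  | succ N ih =>
    obtain ⟨I, _, _, S, hdeg, hS⟩ := ih
    let n : ℤ := N + 1
    have hn : 0 < n := by positivity
    let D := S.monoSpan.comap (𝒜 n).subtype
    -- Finitely generated and torsion-free over a principal ideal domain means free: a basis of this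
    -- quotient provides the new generators.
    have : Module.IsTorsionFree R (𝒜 n ⧸ D) := S.isTorsionFree_quotient hA n
    let b := Module.finBasis R (𝒜 n ⧸ D)
    let p : A →ₗ[R] 𝒜 n := (DirectSum.component R ℤ (fun n => 𝒜 n) n) ∘ₗ
      (DirectSum.decomposeLinearEquiv 𝒜).toLinearMap
    have hp : ∀ a : A, (p a : A) = GradedAlgebra.proj 𝒜 n a := fun a => rfl
    let π : A →ₗ[R] 𝒜 n ⧸ D := D.mkQ ∘ₗ p
    have hπ : ∀ a (ha : a ∈ 𝒜 n), π a = D.mkQ ⟨a, ha⟩ := by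
      intro a ha
      have : p a = ⟨a, ha⟩ := Subtype.ext (by
        rw [hp, GradedAlgebra.proj_apply, DirectSum.decompose_of_mem_same 𝒜 ha])
      rw [LinearMap.comp_apply, this]
    have hπ' : ∀ m, m ≠ n → ∀ a ∈ 𝒜 m, π a = 0 := by
      intro m hm a ha
      have : p a = 0 := Subtype.ext (by
        rw [hp, GradedAlgebra.proj_apply, DirectSum.decompose_of_mem_ne 𝒜 ha hm]; rfl)
      rw [LinearMap.comp_apply, this, map_zero]
    choose w hw using fun k => D.mkQ_surjective (b k)
    -- The coordinate functionals vanish on `D`, which contains the products and higher divided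
    -- powers of degree `n` of elements of smaller positive degree; therefore they are
    -- `Γ`-primitive.
    let x : Fin (Module.finrank R (𝒜 n ⧸ D)) → Module.Dual R A := fun k => b.coord k ∘ₗ π
    have hx : ∀ k, x k ∈ dualPiece 𝒜 n := fun k m hm a ha => by
      simp only [x, LinearMap.comp_apply, hπ' m hm a ha, map_zero]
    have hx0 : ∀ k, ∀ a ∈ 𝒜 n, a ∈ S.monoSpan → x k a = 0 := by
      intro k a ha ha'
      have : D.mkQ ⟨a, ha⟩ = 0 := (Submodule.Quotient.mk_eq_zero _).2 ha'
      simp only [x, LinearMap.comp_apply, hπ a ha, this, map_zero]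
    let S' : DualSystem 𝒜 γ (I ⊕ Fin (Module.finrank R (𝒜 n ⧸ D))) :=
      { deg := Sum.elim S.deg fun _ => n
        elt := Sum.elim S.elt fun k => w k
        functional := Sum.elim S.functional x
        deg_pos := by
          rintro (i | k)
          · exact S.deg_pos i
          · exact hn
        elt_mem := by
          rintro (i | k)
          · exact S.elt_mem i
          · exact (w k).2
        functional_mem := by
          rintro (i | k)
          · exact S.functional_mem i
          · exact S.mem_gammaPiece hA two hn (fun m hm => hS m (by omega)) (hx k) (hx0 k)
        functional_elt := by
          -- Old and new members pair to zero for degree reasons, since all old degrees are at most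
          -- `N < n`.
          rintro (i | k) (j | l)
          · simp [S.functional_elt i j]
          · have := hdeg i
            simpa using (S.functional_mem i).1 n (by omega) _ (w l).2
          · have := hdeg j
            simpa using hx k _ (by omega) _ (S.elt_mem j)
          · have : x k (w l) = if k = l then 1 else 0 := by
              simp only [x, LinearMap.comp_apply, hπ _ (w l).2]
              rw [Subtype.coe_eta, hw, Module.Basis.coord_apply, Module.Basis.repr_self,
                Finsupp.single_apply]
              simp only [eq_comm]
            simpa using this }
    have hle : S.monoSpan ≤ S'.monoSpan := by
      refine Submodule.span_le.2 ?_
      rintro _ ⟨e, he, rfl⟩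
      have hpow : ∀ i k, S'.power (Sum.inl i) k = S.power i k := fun i k => rfl
      -- The order of the letters in `S'` is unrelated to that in `S`, so the old monomials are
      -- recovered as products of powers.
      have hmem : ∀ l : List I, S.monomial l e ∈ S'.monoSpan := by
        intro l
        induction l with
        | nil => exact S'.one_mem_monoSpan hA
        | cons i l ih =>
          rw [monomial, List.map_cons, List.prod_cons, ← hpow]
          exact S'.mul_mem_monoSpan hA two (S'.power_mem_monoSpan hA (Sum.inl i) (he i)) ih
      exact hmem _
    refine ⟨_, inferInstance, inferInstance, S', ?_, fun m hm => ?_⟩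
    · rintro (i | k)
      · exact (hdeg i).trans (by push_cast; omega)
      · exact le_of_eq (by push_cast; rfl)
    · by_cases hmn : m = n
      · subst hmn
        intro a ha
        have h1 : (⟨a, ha⟩ - ∑ k, b.repr (D.mkQ ⟨a, ha⟩) k • w k : 𝒜 n) ∈ D := by
          rw [← Submodule.Quotient.mk_eq_zero, ← Submodule.mkQ_apply, map_sub, map_sum]
          simp only [map_smul, hw, b.sum_repr, sub_self]
        have h2 := hle (Submodule.mem_comap.1 h1)
        rw [map_sub, map_sum] at h2
        have h3 : ∑ k, (𝒜 n).subtype (b.repr (D.mkQ ⟨a, ha⟩) k • w k) ∈ S'.monoSpan :=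
          Submodule.sum_mem _ fun k _ => by
            rw [map_smul]
            exact Submodule.smul_mem _ _ (S'.elt_mem_monoSpan hA (Sum.inr k))
        have h4 := add_mem h2 h3
        rwa [sub_add_cancel] at h4
      · exact (hS m (by push_cast at hm; omega)).trans hle

end IsGammaHopf

/-! ### Sorted words span the enveloping algebra. -/

section EnvSpanning

open DGLieAlgebra DGLieAlgebra.Env

variable {R : Type*} [CommRing R] (L : DGLieAlgebra R) {I : Type*} (deg : I → ℤ)
  (y : I → L.carrier)

namespace DGLieAlgebra.Env

/-- The product in `UL` of the elements with indices in a list. -/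
noncomputable def word (js : List I) : L.Env := (js.map fun j => ι L (y j)).prod

/-- The span of the words of length less than `k` and degree `n`. -/
noncomputable def wordSpan (k : ℕ) (n : ℤ) : Submodule R L.Env :=
  Submodule.span R (word L y '' {js | js.length < k ∧ (js.map deg).sum = n})

variable {L deg y}

theorem word_cons (j : I) (js : List I) : word L y (j :: js) = ι L (y j) * word L y js := by
  simp [word]

theorem word_mem_wordSpan {k : ℕ} {js : List I} (hk : js.length < k) :
    word L y js ∈ wordSpan L deg y k (js.map deg).sum :=
  Submodule.subset_span ⟨js, ⟨hk, rfl⟩, rfl⟩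

theorem ι_mul_mem_wordSpan (j : I) {k : ℕ} {n : ℤ} {u : L.Env} (hu : u ∈ wordSpan L deg y k n) :
    ι L (y j) * u ∈ wordSpan L deg y (k + 1) (deg j + n) := by
  have h : wordSpan L deg y k n ≤
      (wordSpan L deg y (k + 1) (deg j + n)).comap (LinearMap.mulLeft R (ι L (y j))) := by
    refine Submodule.span_le.2 ?_
    rintro _ ⟨js, ⟨hk, rfl⟩, rfl⟩
    change ι L (y j) * word L y js ∈ wordSpan L deg y (k + 1) (deg j + (js.map deg).sum)
    rw [← word_cons]
    have h := word_mem_wordSpan (L := L) (y := y) (deg := deg) (js := j :: js) (k := k + 1)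
      (by simpa using hk)
    rwa [List.map_cons, List.sum_cons] at h
  exact h hu

variable (hy : ∀ i, y i ∈ L.deg (deg i)) {N : ℤ}
  (gen : ∀ n ≤ N, L.deg n ≤ Submodule.span R (y '' {i | deg i = n}))
include gen

theorem ι_mul_word_mem_wordSpan {n : ℤ} (hn : n ≤ N) {x : L.carrier} (hx : x ∈ L.deg n)
    (js : List I) :
    ι L x * word L y js ∈ wordSpan L deg y (js.length + 2) (n + (js.map deg).sum) := by
  have h : Submodule.span R (y '' {i | deg i = n}) ≤
      (wordSpan L deg y (js.length + 2) (n + (js.map deg).sum)).comap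
        (LinearMap.mulRight R (word L y js) ∘ₗ ι L) := by
    refine Submodule.span_le.2 ?_
    rintro _ ⟨i, rfl, rfl⟩
    exact ι_mul_mem_wordSpan i (word_mem_wordSpan (by omega))
  exact h (gen n hn hx)

variable (pos : ∀ i, 0 < deg i)
include hy pos

omit hy gen in
theorem sum_deg_nonneg (js : List I) : 0 ≤ (js.map deg).sum :=
  List.sum_nonneg fun x hx => by
    obtain ⟨i, _, rfl⟩ := List.mem_map.1 hx
    exact (pos i).le

/-- Up to shorter words, a word depends on the order of its letters only through a sign. -/
theorem exists_word_sub_smul_mem {js js' : List I} (h : js.Perm js') (hN : (js.map deg).sum ≤ N) :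
    ∃ s : R, word L y js - s • word L y js' ∈ wordSpan L deg y js.length (js.map deg).sum := by
  induction h with
  | nil => exact ⟨1, by rw [one_smul, sub_self]; exact zero_mem _⟩
  | cons a h ih =>
    rw [List.map_cons, List.sum_cons] at hN
    obtain ⟨s, hs⟩ := ih (by have := pos a; omega)
    refine ⟨s, ?_⟩
    have := ι_mul_mem_wordSpan a hs
    rwa [mul_sub, mul_smul_comm, ← word_cons, ← word_cons] at this
  | swap a b l =>
    rw [List.map_cons, List.sum_cons, List.map_cons, List.sum_cons] at hN
    have hl := sum_deg_nonneg pos l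
    refine ⟨sgn R (deg b * deg a), ?_⟩
    -- The bracket has degree at most `N`, so it is a combination of generators: two letters are
    -- replaced by one.
    have := ι_mul_word_mem_wordSpan gen (by omega) (L.bracket_mem (hy b) (hy a)) l
    have hmul := ι_mul_ι L (hy b) (hy a)
    rw [negOnePow_smul_eq (R := R)] at hmul
    simp only [word_cons, ← mul_assoc, hmul, add_mul, smul_mul_assoc, add_sub_cancel_right]
    simpa [add_assoc] using this
  | trans h1 h2 ih1 ih2 =>
    obtain ⟨s, hs⟩ := ih1 hN
    obtain ⟨t, ht⟩ := ih2 (by rwa [← (h1.map deg).sum_eq])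
    rw [← (h1.map deg).sum_eq, ← h1.length_eq] at ht
    refine ⟨s * t, ?_⟩
    have := add_mem hs (Submodule.smul_mem _ s ht)
    rwa [smul_sub, smul_smul, sub_add_sub_cancel] at this

/-- For odd `x` the defining relation reads `2 x² = [x, x]`; as `2` is a unit, a repeated odd letter
gives shorter words. -/
theorem word_cons_cons_mem (two : IsUnit (2 : R)) {i : I} (hi : Odd (deg i)) {js : List I}
    (hN : ((i :: i :: js).map deg).sum ≤ N) : word L y (i :: i :: js) ∈
      wordSpan L deg y (i :: i :: js).length ((i :: i :: js).map deg).sum := by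
  rw [List.map_cons, List.sum_cons, List.map_cons, List.sum_cons] at hN ⊢
  have hl := sum_deg_nonneg pos js
  have hmul := ι_mul_ι L (hy i) (hy i)
  rw [negOnePow_smul_eq (R := R), sgn_of_odd (hi.mul hi), neg_one_smul, ← sub_eq_add_neg,
    eq_sub_iff_add_eq, ← two_smul R] at hmul
  have := ι_mul_word_mem_wordSpan gen (by omega) (L.bracket_mem (hy i) (hy i)) js
  rw [← hmul, smul_mul_assoc, mul_assoc, ← word_cons, ← word_cons, add_assoc] at this
  exact (Submodule.smul_mem_iff_of_isUnit _ two).1 this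

variable [Fintype I] [DecidableEq I]

omit L y hy gen pos [DecidableEq I] in
theorem _root_.sum_map_exponentList (deg : I → ℤ) (e : I → ℕ) :
    ((exponentList e).map deg).sum = ∑ i, e i * deg i := by
  have h : ∀ l : List I, ((l.flatMap fun i => List.replicate (e i) i).map deg).sum =
      (l.map fun i => e i * deg i).sum := by
    intro l
    induction l with
    | nil => rfl
    | cons i l ih =>
      rw [List.flatMap_cons, List.map_append, List.sum_append, ih, List.map_replicate,
        List.sum_replicate, nsmul_eq_mul, List.map_cons, List.sum_cons]
  rw [exponentList, h, Finset.sum_map_toList]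

/-- Induction on the length: modulo shorter words the letters may be permuted, either into sorted
order or so as to bring a repeated odd letter to the front. -/
theorem word_mem_span (two : IsUnit (2 : R)) (js : List I) (hN : (js.map deg).sum ≤ N) :
    word L y js ∈ Submodule.span R ((fun e => word L y (exponentList e)) ''
      {e | (∀ i, Odd (deg i) → e i ≤ 1) ∧ ∑ i, e i * deg i = (js.map deg).sum}) := by
  obtain ⟨k, hk⟩ : ∃ k, k = js.length := ⟨_, rfl⟩
  induction k using Nat.strong_induction_on generalizing js with
  | _ k ih =>
  have hle : wordSpan L deg y js.length (js.map deg).sum ≤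
      Submodule.span R ((fun e => word L y (exponentList e)) ''
        {e | (∀ i, Odd (deg i) → e i ≤ 1) ∧ ∑ i, e i * deg i = (js.map deg).sum}) := by
    refine Submodule.span_le.2 ?_
    rintro _ ⟨js', ⟨hlen, hsum⟩, rfl⟩
    have := ih _ (hk ▸ hlen) js' (hsum ▸ hN) rfl
    rwa [hsum] at this
  have hred : ∀ js', js.Perm js' → word L y js' ∈ Submodule.span R
      ((fun e => word L y (exponentList e)) ''
        {e | (∀ i, Odd (deg i) → e i ≤ 1) ∧ ∑ i, e i * deg i = (js.map deg).sum}) →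
      word L y js ∈ Submodule.span R ((fun e => word L y (exponentList e)) ''
        {e | (∀ i, Odd (deg i) → e i ≤ 1) ∧ ∑ i, e i * deg i = (js.map deg).sum}) := by
    intro js' hp hmem
    obtain ⟨s, hs⟩ := exists_word_sub_smul_mem hy gen pos hp hN
    have := add_mem (hle hs) (Submodule.smul_mem _ s hmem)
    rwa [sub_add_cancel] at this
  by_cases hadm : ∀ i, Odd (deg i) → js.count i ≤ 1
  · have hp : js.Perm (exponentList fun i => js.count i) :=
      List.perm_iff_count.2 fun i => (count_exponentList (fun i => js.count i) i).symm
    refine hred _ hp (Submodule.subset_span ⟨_, ⟨hadm, ?_⟩, rfl⟩)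
    rw [← sum_map_exponentList, (hp.map deg).sum_eq]
  · push Not at hadm
    obtain ⟨i, hi, hc⟩ := hadm
    have h1 : i ∈ js := List.count_pos_iff.1 (by omega)
    have h2 : i ∈ js.erase i := List.count_pos_iff.1 (by rw [List.count_erase_self]; omega)
    have hp : js.Perm (i :: i :: (js.erase i).erase i) :=
      (List.perm_cons_erase h1).trans ((List.perm_cons_erase h2).cons i)
    refine hred _ hp (hle ?_)
    rw [hp.length_eq, (hp.map deg).sum_eq]
    exact word_cons_cons_mem hy gen pos two hi (by rwa [← (hp.map deg).sum_eq])

omit hy [Fintype I] [DecidableEq I] in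
theorem prod_mem_span_word (hN0 : 0 ≤ N) (l : List (Σ i : ℤ, L.deg i)) (hN : (l.map Sigma.fst).sum ≤ N) :
    (l.map fun x => ι L (x.2 : L.carrier)).prod ∈
      Submodule.span R (word L y '' {js | (js.map deg).sum = (l.map Sigma.fst).sum}) := by
  induction l with
  | nil => exact Submodule.subset_span ⟨[], by simp, rfl⟩
  | cons x l ih =>
    rw [List.map_cons, List.sum_cons] at hN ⊢
    rw [List.map_cons, List.prod_cons]
    rcases le_or_gt x.1 0 with hx | hx
    · have hemp : {i : I | deg i = x.1} = ∅ := by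
        ext i
        have := pos i
        simp only [Set.mem_ofPred_eq, Set.mem_empty_iff_false, iff_false]
        omega
      have hx' := gen x.1 (hx.trans hN0) x.2.2
      rw [hemp, Set.image_empty, Submodule.span_empty, Submodule.mem_bot] at hx'
      rw [hx', map_zero, zero_mul]
      exact zero_mem _
    · have ih' := ih (by omega)
      -- A rest of negative degree is zero, by induction. Otherwise the degree of the first factor
      -- is at most `N`, so it is a combination of generators.
      rcases lt_or_ge (l.map Sigma.fst).sum 0 with hl | hl
      · have hemp : {js : List I | (js.map deg).sum = (l.map Sigma.fst).sum} = ∅ := by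
          ext js
          have := sum_deg_nonneg pos js
          simp only [Set.mem_ofPred_eq, Set.mem_empty_iff_false, iff_false]
          omega
        rw [hemp, Set.image_empty, Submodule.span_empty, Submodule.mem_bot] at ih'
        rw [ih', mul_zero]
        exact zero_mem _
      · have hx' := gen x.1 (by omega) x.2.2
        have h1 := Submodule.mul_mem_mul (Submodule.mem_map_of_mem (f := ι L) hx') ih'
        rw [Submodule.map_span, Submodule.span_mul_span] at h1
        refine Submodule.span_mono ?_ h1
        rintro _ ⟨_, ⟨_, ⟨i, hi, rfl⟩, rfl⟩, _, ⟨js, hjs, rfl⟩, rfl⟩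
        refine ⟨i :: js, ?_, word_cons i js⟩
        rw [Set.mem_ofPred_eq] at hi hjs ⊢
        rw [List.map_cons, List.sum_cons, hi, hjs]

/-- The sorted words span `UL` (the easy half of the Poincaré–Birkhoff–Witt theorem). -/
theorem piece_le_span_word (two : IsUnit (2 : R)) (hN0 : 0 ≤ N) {n : ℤ} (hn : n ≤ N) :
    piece L n ≤ Submodule.span R ((fun e => word L y (exponentList e)) ''
      {e | (∀ i, Odd (deg i) → e i ≤ 1) ∧ ∑ i, e i * deg i = n}) := by
  refine Submodule.span_le.2 ?_
  rintro _ ⟨l, rfl, rfl⟩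
  refine Submodule.span_le.2 ?_ (prod_mem_span_word gen pos hN0 l hn)
  rintro _ ⟨js, hjs, rfl⟩
  rw [Set.mem_ofPred_eq] at hjs
  have := word_mem_span hy gen pos two js (hjs ▸ hn)
  rwa [hjs] at this

end DGLieAlgebra.Env

end EnvSpanning

/-! ### Perfectness of the pairing and the theorem. -/

section Duality

open DGLieAlgebra DGLieAlgebra.Env DualSystem

variable {R : Type u} [CommRing R] [IsDomain R] [IsPrincipalIdealRing R]
  {A : Type v} [Ring A] [Algebra R A] [Coalgebra R A] [Module.Free R A]
  {𝒜 : ℤ → Submodule R A} [GradedAlgebra 𝒜] {γ : ℕ → A → A} {d : A →ₗ[R] A}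

namespace DualSystem

variable {I : Type*} [DecidableEq I] [Fintype I] (S : DualSystem 𝒜 γ I)
  (hA : IsGammaHopf 𝒜 d γ)
include hA

omit [IsDomain R] [IsPrincipalIdealRing R] [Module.Free R A] in
/-- A `Γ`-primitive functional is a combination of the functionals of the system. -/
theorem eq_sum_of_mem_gammaPiece {n : ℤ} (complete : 𝒜 n ≤ S.monoSpan) {φ : Module.Dual R A}
    (hφ : φ ∈ gammaPiece 𝒜 γ n) : φ = ∑ i, φ (S.elt i) • S.functional i := by
  -- A `Γ`-primitive functional vanishes in weight at least two and on `1`, so only its values on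
  -- the generators matter.
  have h2 : ∀ {m : ℤ} {ψ : Module.Dual R A}, ψ ∈ gammaPiece 𝒜 γ m →
      ∀ a ∈ weightFiltration 𝒜 γ 2, ψ a = 0 := by
    intro m ψ hψ a ha
    rw [← hA.hopf.counit_contract]
    exact (mem_weightFiltration_succ.1 ((mem_weightFiltration_succ.1 ha).2 m ψ hψ)).1
  refine linearMap_ext_homogeneous 𝒜 fun m a ha => ?_
  by_cases hm : m = n
  · subst hm
    have hspan := S.monoSpan_inf_le hA m ⟨complete ha, ha⟩
    have hle : Submodule.span R (S.mono '' (S.exponents m : Set (I → ℕ))) ≤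
        LinearMap.eqLocus φ (∑ i, φ (S.elt i) • S.functional i) := by
      refine Submodule.span_le.2 ?_
      rintro _ ⟨e, he, rfl⟩
      have he' := S.mem_exponents.1 he
      change φ (S.mono e) = (∑ i, φ (S.elt i) • S.functional i) (S.mono e)
      rw [LinearMap.sum_apply]
      simp only [LinearMap.smul_apply, smul_eq_mul]
      have hw := S.mono_mem_weightFiltration hA he'.1
      rcases Nat.lt_or_ge (∑ i, e i) 2 with hlt | hge
      · by_cases h0 : ∑ i, e i = 0
        · have he0 : e = 0 := funext fun i => (Finset.sum_eq_zero_iff.1 h0) i (Finset.mem_univ i)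
          have h1 : S.mono e = 1 := by rw [he0]; exact S.monomial_zero hA _
          rw [h1, hφ.2.1.map_one hA.hopf]
          exact (Finset.sum_eq_zero fun i _ => by
            rw [(S.functional_mem i).2.1.map_one hA.hopf, mul_zero]).symm
        · obtain ⟨i, _, hi⟩ := Finset.exists_ne_zero_of_sum_ne_zero h0
          have he1 : e = Pi.single i 1 := by
            have hsplit := Finset.add_sum_erase Finset.univ e (Finset.mem_univ i)
            have hrest : ∑ j ∈ Finset.univ.erase i, e j = 0 := by omega
            ext j
            by_cases hij : j = i
            · subst hij
              rw [Pi.single_eq_same]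
              omega
            · rw [Pi.single_eq_of_ne hij]
              exact (Finset.sum_eq_zero_iff.1 hrest) j (Finset.mem_erase.2 ⟨hij, Finset.mem_univ j⟩)
          have h1 : S.mono e = S.elt i := by
            rw [he1, mono, S.monomial_single hA (Finset.nodup_toList _), if_pos (by simp),
              S.power_one hA]
          rw [h1]
          simp [S.functional_elt]
      · have hw2 := weightFiltration_antitone (γ := γ) (𝒜 := 𝒜) hge hw
        rw [h2 hφ _ hw2]
        exact (Finset.sum_eq_zero fun i _ => by
          rw [h2 (S.functional_mem i) _ hw2, mul_zero]).symm
    exact hle hspan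
  · rw [hφ.1 m hm a ha, LinearMap.sum_apply]
    refine (Finset.sum_eq_zero fun i _ => ?_).symm
    rw [LinearMap.smul_apply, smul_eq_mul]
    by_cases hi : S.deg i = n
    · rw [(S.functional_mem i).1 m (hi ▸ hm) a ha, mul_zero]
    · rw [hφ.1 _ hi _ (S.elt_mem i), zero_mul]

end DualSystem

omit [IsDomain R] [IsPrincipalIdealRing R] in
theorem DGLieAlgebra.Env.word_mem_piece {L : DGLieAlgebra R} {I : Type*} {deg : I → ℤ}
    {y : I → L.carrier} (hy : ∀ i, y i ∈ L.deg (deg i)) (js : List I) :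
    word L y js ∈ piece L (js.map deg).sum := by
  induction js with
  | nil => exact SetLike.GradedOne.one_mem
  | cons j js ih =>
    rw [word_cons, List.map_cons, List.sum_cons]
    exact SetLike.mul_mem_graded (ι_mem L (hy j)) ih

namespace IsGammaHopf

variable (hA : IsGammaHopf 𝒜 d γ) (h𝒜 : ∀ n, Module.Finite R (Module.Dual R (𝒜 n)))

omit [Module.Free R A] in
theorem isPrimitiveRepresentation :
    IsPrimitiveRepresentation 𝒜 d (hA.lieAlgebra h𝒜) (hA.toDual h𝒜) where
  mem _ _ hx := (hA.toDual_mem h𝒜 hx).1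
  primitive _ _ hx := (hA.toDual_mem h𝒜 hx).2.1
  bracket := hA.toDual_bracket h𝒜
  del := hA.toDual_del h𝒜

/-- The functional on `A` given by an element of the enveloping algebra. -/
noncomputable def pairing : (hA.lieAlgebra h𝒜).Env →ₗ[R] Module.Dual R A :=
  (hA.isPrimitiveRepresentation h𝒜).pairing hA.hopf

omit [Module.Free R A] in
theorem pairing_word {I : Type*} [DecidableEq I] (S : DualSystem 𝒜 γ I)
    {y : I → (hA.lieAlgebra h𝒜).carrier} (hy : ∀ i, hA.toDual h𝒜 (y i) = S.functional i)
    (js : List I) (a : A) : hA.pairing h𝒜 (word (hA.lieAlgebra h𝒜) y js) a =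
      Coalgebra.counit (R := R) (S.word js a) := by
  have h : (hA.isPrimitiveRepresentation h𝒜).action hA.hopf (word (hA.lieAlgebra h𝒜) y js) =
      S.word js := by
    rw [DGLieAlgebra.Env.word, map_list_prod, DualSystem.word, List.map_map]
    congr 1
    refine List.map_congr_left fun j _ => ?_
    rw [Function.comp_apply, IsPrimitiveRepresentation.action_ι, hy]
  rw [pairing, IsPrimitiveRepresentation.pairing_apply, h]

/-- In degree `n` sorted words span `UL`, monomials span `A`, and the matrix between them is
invertible. Injectivity makes the words independent as well, so the hard half of
Poincaré–Birkhoff–Witt comes as a by-product. -/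
theorem pairing_bijOn (two : IsUnit (2 : R)) (finite_type : ∀ n : ℤ, Module.Finite R (𝒜 n))
    (n : ℤ) : (∀ u ∈ piece (hA.lieAlgebra h𝒜) n, hA.pairing h𝒜 u = 0 → u = 0) ∧
      ∀ φ ∈ dualPiece 𝒜 n, ∃ u ∈ piece (hA.lieAlgebra h𝒜) n, hA.pairing h𝒜 u = φ := by
  obtain ⟨I, _, _, S, -, hS⟩ := hA.exists_dualSystem two finite_type n.toNat
  choose y hy hyS using fun i => hA.exists_toDual_eq h𝒜 (S.functional_mem i)
  have gen : ∀ m ≤ (n.toNat : ℤ), (hA.lieAlgebra h𝒜).deg m ≤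
      Submodule.span R (y '' {i | S.deg i = m}) := by
    intro m hm x hx
    have hφ := hA.toDual_mem h𝒜 hx
    have h1 := S.eq_sum_of_mem_gammaPiece hA (hS m hm) hφ
    have h2 : x = ∑ i, hA.toDual h𝒜 x (S.elt i) • y i := by
      apply hA.toDual_injective h𝒜
      rw [map_sum]
      simp only [map_smul, hyS]
      exact h1
    rw [h2]
    refine Submodule.sum_mem _ fun i _ => ?_
    by_cases hi : S.deg i = m
    · exact Submodule.smul_mem _ _ (Submodule.subset_span ⟨i, hi, rfl⟩)
    · rw [hφ.1 _ hi _ (S.elt_mem i), zero_smul]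
      exact zero_mem _
  have hspan := piece_le_span_word hy gen S.deg_pos two (by positivity) (Int.self_le_toNat n)
  have hdet := S.isUnit_det_pairingMatrix hA n
  have hset : {e : I → ℕ | (∀ i, Odd (S.deg i) → e i ≤ 1) ∧ ∑ i, e i * S.deg i = n} =
      (S.exponents n : Set (I → ℕ)) := by
    ext e
    exact S.mem_exponents.symm
  rw [hset, Set.image_eq_range] at hspan
  have hpair : ∀ (c : S.exponents n → R) (f : S.exponents n), hA.pairing h𝒜
      (∑ e, c e • word (hA.lieAlgebra h𝒜) y (exponentList e.1)) (S.mono f.1) =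
      Matrix.vecMul c (S.pairingMatrix n) f := by
    intro c f
    rw [map_sum, LinearMap.sum_apply, Matrix.vecMul, dotProduct]
    refine Finset.sum_congr rfl fun e _ => ?_
    rw [map_smul, LinearMap.smul_apply, hA.pairing_word h𝒜 S hyS]
    rfl
  constructor
  · intro u hu hu0
    obtain ⟨c, rfl⟩ := (Submodule.mem_span_range_iff_exists_fun R).1 (hspan hu)
    have h1 : Matrix.vecMul c (S.pairingMatrix n) = 0 := by
      ext f
      have h0 := LinearMap.congr_fun hu0 (S.mono f.1)
      exact (hpair c f).symm.trans h0
    have h2 : c = 0 := by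
      have := congrArg (fun v => Matrix.vecMul v (S.pairingMatrix n)⁻¹) h1
      simpa [Matrix.vecMul_vecMul, Matrix.mul_nonsing_inv _ hdet] using this
    rw [h2]
    simp
  · intro φ hφ
    let b : S.exponents n → R := fun f => φ (S.mono f.1)
    -- The coefficients of the preimage solve the linear system given by the values of `φ` on
    -- monomials.
    let c := Matrix.vecMul b (S.pairingMatrix n)⁻¹
    have hc : Matrix.vecMul c (S.pairingMatrix n) = b := by
      rw [Matrix.vecMul_vecMul, Matrix.nonsing_inv_mul _ hdet, Matrix.vecMul_one]
    have hmem : ∑ e, c e • word (hA.lieAlgebra h𝒜) y (exponentList e.1) ∈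
        piece (hA.lieAlgebra h𝒜) n := by
      refine Submodule.sum_mem _ fun e _ => Submodule.smul_mem _ _ ?_
      have he := word_mem_piece hy (exponentList e.1)
      rwa [sum_map_exponentList, (S.mem_exponents.1 e.2).2] at he
    refine ⟨_, hmem, linearMap_ext_homogeneous 𝒜 fun m a ha => ?_⟩
    by_cases hm : m = n
    · subst hm
      have ha' := S.monoSpan_inf_le hA m ⟨hS m (Int.self_le_toNat m) ha, ha⟩
      have hle : Submodule.span R (S.mono '' (S.exponents m : Set (I → ℕ))) ≤
          LinearMap.eqLocus (hA.pairing h𝒜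
            (∑ e, c e • word (hA.lieAlgebra h𝒜) y (exponentList e.1))) φ := by
        refine Submodule.span_le.2 ?_
        rintro _ ⟨f, hf, rfl⟩
        exact (hpair c ⟨f, hf⟩).trans (congrFun hc ⟨f, hf⟩)
      exact hle ha'
    · rw [hφ m hm a ha]
      exact (hA.isPrimitiveRepresentation h𝒜).pairing_mem hA.hopf hmem m hm a ha

/-- The enveloping algebra of the Lie algebra of `Γ`-primitive functionals is dual to `A`. -/
theorem nonempty_isoToDual (two : IsUnit (2 : R))
    (finite_type : ∀ n : ℤ, Module.Finite R (𝒜 n)) :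
    Nonempty (IsoToDual 𝒜 d (piece (hA.lieAlgebra h𝒜)) (comul (hA.lieAlgebra h𝒜))
      (counit (hA.lieAlgebra h𝒜)).toLinearMap (Env.del (hA.lieAlgebra h𝒜))) := by
  classical
  have hbij := hA.pairing_bijOn h𝒜 two finite_type
  have hτ := hA.isPrimitiveRepresentation h𝒜
  have hinj : ∀ u, hA.pairing h𝒜 u = 0 → u = 0 := by
    intro u hu
    rw [← DirectSum.sum_support_decompose (piece (hA.lieAlgebra h𝒜)) u]
    refine Finset.sum_eq_zero fun n _ => (hbij n).1 _ (SetLike.coe_mem _) ?_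
    refine linearMap_ext_homogeneous 𝒜 fun m a ha => ?_
    by_cases hm : m = n
    · subst hm
      have h0 := LinearMap.congr_fun hu a
      rw [← DirectSum.sum_support_decompose (piece (hA.lieAlgebra h𝒜)) u, map_sum,
        LinearMap.sum_apply, Finset.sum_eq_single m] at h0
      · exact h0
      · intro k _ hk
        exact hτ.pairing_mem hA.hopf (SetLike.coe_mem _) m hk.symm a ha
      · intro hk
        rw [DFinsupp.notMem_support_iff.1 hk, ZeroMemClass.coe_zero, map_zero]
        rfl
    · exact hτ.pairing_mem hA.hopf (SetLike.coe_mem _) m hm a ha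
  have hker : LinearMap.ker (hA.pairing h𝒜) = ⊥ := LinearMap.ker_eq_bot'.2 hinj
  have hsurj : gradedDual 𝒜 ≤ LinearMap.range (hA.pairing h𝒜) := by
    refine iSup_le fun n φ hφ => ?_
    obtain ⟨u, -, hu⟩ := (hbij n).2 φ hφ
    exact ⟨u, hu⟩
  let e : (hA.lieAlgebra h𝒜).Env ≃ₗ[R] gradedDual 𝒜 :=
    LinearEquiv.ofBijective
      ((hA.pairing h𝒜).codRestrict (gradedDual 𝒜) (hτ.pairing_mem_gradedDual hA.hopf))
      ⟨fun u w huw => LinearMap.ker_eq_bot.1 hker (congrArg Subtype.val huw), fun φ => by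
        obtain ⟨u, hu⟩ := hsurj φ.2
        exact ⟨u, Subtype.ext hu⟩⟩
  refine ⟨hτ.isoToDual hA.hopf e (fun _ => rfl) fun n u hu => ?_⟩
  -- A preimage of degree `n` exists, and by injectivity it is `u`.
  obtain ⟨w, hw, hwu⟩ := (hbij n).2 _ hu
  rwa [← LinearMap.ker_eq_bot.1 hker hwu]

end IsGammaHopf

end Duality

theorem mainTheorem4 {R : Type u} [CommRing R] [IsDomain R] [IsPrincipalIdealRing R]
    (two_unit : IsUnit (2 : R))
    {A : Type v} [Ring A] [Algebra R A] [Coalgebra R A] (𝒜 : ℤ → Submodule R A) [GradedAlgebra 𝒜]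
    (d : A →ₗ[R] A) (hopf : IsDGHopfAlgebra 𝒜 d) (comm : IsGradedCommutative 𝒜)
    (free : Module.Free R A) (finite_type : ∀ n : ℤ, Module.Finite R (𝒜 n)) :
    (∃ L : DGLieAlgebra.{u, max u v} R,
      Nonempty (IsoToDual 𝒜 d (DGLieAlgebra.Env.piece L) (DGLieAlgebra.Env.comul L)
        (DGLieAlgebra.Env.counit L).toLinearMap (DGLieAlgebra.Env.del L))) ↔
      IsDGGammaHopfAlgebra 𝒜 d := by
  refine ⟨fun ⟨L, ⟨e⟩⟩ => e.isDGGammaHopfAlgebra two_unit hopf comm finite_type, fun h => ?_⟩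
  obtain ⟨-, -, conn, γ, hdp, hdiag, hd⟩ := h
  have hA : IsGammaHopf 𝒜 d γ :=
    ⟨hopf, fun i j a b ha hb => by rw [comm ha hb, negOnePow_smul_eq (R := R)], conn, hdp, hdiag, hd⟩
  have h𝒜 : ∀ n, Module.Finite R (Module.Dual R (𝒜 n)) := fun n => inferInstance
  exact ⟨hA.lieAlgebra h𝒜, hA.nonempty_isoToDual h𝒜 two_unit finite_type⟩
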